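/- Let $\beta>0$, let $-\infty\le b_-<b_+\le+\infty$, and let $[b_-,b_+]$ denote the closed interval $\{x\in\mathbb{R} : b_-\le x\le b_+\}$. Let $V:[b_-,b_+]\to\mathbb{R}$ be continuous and confining: for each sign $\tau\in\{+,-\}$ with $b_\tau=\tau\infty$, $$\liminf_{x\to\tau\infty}\frac{V(x)}{2\ln|x|}>1 .$$ For large $N$, let $\mu_N$ be the probability measure on $\mathbb{R}^N$ $$\mathrm{d}\mu_N(\lambda)=\frac1{Z_N}\prod_{1\le i<j\le N}|\lambda_i-\lambda_j|^\beta\prod_{i=1}^N e^{-\frac{N\beta}{2}V(\lambda_i)}\mathbf 1_{[b_-,b_+]}(\lambda_i)\,\mathrm{d}\lambda_i ,$$ and let $\lambda_{\max}=\max_i\lambda_i$ and $\lambda_{\min}=\min_i\lambda_i$. Let $\mu_{\mathrm{eq}}$ be the unique minimizer of $$\mathcal E[\mu]=\int V\,\mathrm{d}\mu-\iint\ln|\xi-\eta|\,\mathrm{d}\mu(\xi)\,\mathrm{d}\mu(\eta)$$ among the probability measures on $[b_-,b_+]$ (it has compact support), and let $\alpha_-$ and $\alpha_+$ be the smallest and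 the largest point of its support. Define $$\mathcal J(x)=\tfrac12V(x)-\int\ln|x-\xi|\,\mathrm{d}\mu_{\mathrm{eq}}(\xi)\quad (x\in[b_-,b_+]),\qquad \mathcal J(x)=+\infty\quad (x\notin[b_-,b_+]),$$ and $\widetilde{\mathcal J}=\mathcal J-\inf_{[b_-,b_+]}\mathcal J$. Let $\widetilde{\mathcal J}_{\max}(x)=\widetilde{\mathcal J}(x)$ for $x\ge\alpha_+$ and $\widetilde{\mathcal J}_{\max}(x)=+\infty$ for $x<\alpha_+$; let $\widetilde{\mathcal J}_{\min}(x)=\widetilde{\mathcal J}(x)$ for $x\le\alpha_-$ and $\widetilde{\mathcal J}_{\min}(x)=+\infty$ for $x>\alpha_-$. Assume that $\widetilde{\mathcal J}(x)\neq0$ for all $x\notin[\alpha_-,\alpha_+]$. Then: (i) $\beta\widetilde{\mathcal J}_{\max}$ (resp. $\beta\widetilde{\mathcal J}_{\min}$) is a good rate function on $[b_-,b_+]$ (lower semicontinuous, with values in $[0,+\infty]$ and compact sublevel sets), and it vanishes at $\alpha_+$ (resp. $\alpha_-$). (ii) The law of $\lambda_{\max}$ (resp. $\lambda_{\min}$)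 under $\mu_N$ satisfies a large deviation principle on $[b_-,b_+]$ with speed $N$ and rate function $\beta\widetilde{\mathcal J}_{\max}$ (resp. $\beta\widetilde{\mathcal J}_{\min}$): for all relatively closed $F\subseteq[b_-,b_+]$ and relatively open $\Omega\subseteq[b_-,b_+]$, $$\limsup_{N\to\infty}\frac1N\ln\mu_N(\lambda_{\max}\in F)\le-\beta\inf_{x\in F}\widetilde{\mathcal J}_{\max}(x),\qquad \liminf_{N\to\infty}\frac1N\ln\mu_N(\lambda_{\max}\in\Omega)\ge-\beta\inf_{x\in\Omega}\widetilde{\mathcal J}_{\max}(x),$$ and the same holds for $\lambda_{\min}$ with $\widetilde{\mathcal J}_{\min}$. (Here $\ln 0=-\infty$ and $\inf\emptyset=+\infty$.) In particular, for every $\varepsilon>0$, $$\limsup_{N\to\infty}\frac1N\ln\mu_N(\lambda_{\min}\le\alpha_--\varepsilon)<0,\qquad \limsup_{N\to\infty}\frac1N\ln\mu_N(\lambda_{\max}\ge\alpha_++\varepsilon)<0 .$$ -/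

import Mathlib

open MeasureTheory Filter Topology

noncomputable section

namespace BetaEnsemble

/-- The (possibly unbounded) closed interval of the real line with endpoints
`bm ≤ bp` in the extended real line. -/
def interval (bm bp : EReal) : Set ℝ := {x : ℝ | bm ≤ (x : EReal) ∧ (x : EReal) ≤ bp}

/-! ### The beta ensemble -/

/-- The unnormalised density
`∏ i, exp (- (N β / 2) V (l i)) * ∏ i < j, |l i - l j| ^ β`. -/
def weight (β : ℝ) (V : ℝ → ℝ) (N : ℕ) (l : Fin N → ℝ) : ℝ :=
  (∏ i, Real.exp (-((N : ℝ) * β / 2) * V (l i))) *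
    ∏ i, ∏ j ∈ Finset.Ioi i, |l i - l j| ^ β

/-- The partition function. -/
def partitionFunction (β : ℝ) (V : ℝ → ℝ) (S : Set ℝ) (N : ℕ) : ENNReal :=
  ∫⁻ l in {l : Fin N → ℝ | ∀ i, l i ∈ S}, ENNReal.ofReal (weight β V N l)

/-- The law of the eigenvalues `(l 0, …, l (N - 1))`, restricted to lie in `S`.
(The partition function is positive; it is finite for all large `N` when `V` is confining.) -/
def eigenvalueLaw (β : ℝ) (V : ℝ → ℝ) (S : Set ℝ) (N : ℕ) : Measure (Fin N → ℝ) :=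
  (partitionFunction β V S N)⁻¹ •
    ((volume.restrict {l : Fin N → ℝ | ∀ i, l i ∈ S}).withDensity
      fun l => ENNReal.ofReal (weight β V N l))

/-- The largest eigenvalue. -/
def lambdaMax {N : ℕ} (l : Fin N → ℝ) : ℝ := ⨆ i, l i

/-- The smallest eigenvalue. -/
def lambdaMin {N : ℕ} (l : Fin N → ℝ) : ℝ := ⨅ i, l i

/-- The law of the largest eigenvalue. -/
def lawMax (β : ℝ) (V : ℝ → ℝ) (S : Set ℝ) (N : ℕ) : Measure ℝ :=
  (eigenvalueLaw β V S N).map lambdaMax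

/-- The law of the smallest eigenvalue. -/
def lawMin (β : ℝ) (V : ℝ → ℝ) (S : Set ℝ) (N : ℕ) : Measure ℝ :=
  (eigenvalueLaw β V S N).map lambdaMin

/-! ### The equilibrium measure -/

/-- The logarithmic energy `- ∬ ln |x - y| dμ(x) dμ(y)`, where `ln 0 = -∞`: the integral of the
positive part of `- ln |x - y|` minus the integral of its negative part. -/
def logEnergy (μ : Measure ℝ) : EReal :=
  ((∫⁻ x, ∫⁻ y, (-(ENNReal.log (edist x y))).toENNReal ∂μ ∂μ : ENNReal) : EReal) -
    ((∫⁻ x, ∫⁻ y, (ENNReal.log (edist x y)).toENNReal ∂μ ∂μ : ENNReal) : EReal)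

open Classical in
/-- The energy `∫ V dμ - ∬ ln |x - y| dμ(x) dμ(y)`. A confining potential is bounded from below,
so `∫ V dμ = +∞` when `V` is not `μ`-integrable, and the energy is `+∞` then; when `V` is
integrable, so is the positive part of `ln |x - y|`, and the difference is well defined. -/
def energy (V : ℝ → ℝ) (μ : Measure ℝ) : EReal :=
  if Integrable V μ then ((∫ x, V x ∂μ : ℝ) : EReal) + logEnergy μ else ⊤

/-- `μ` minimises the energy among the probability measures on `S`. -/
structure IsEquilibriumMeasure (V : ℝ → ℝ) (S : Set ℝ) (μ : Measure ℝ) : Prop where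
  isProbabilityMeasure : IsProbabilityMeasure μ
  compl_null : μ Sᶜ = 0
  energy_le : ∀ ν : Measure ℝ, IsProbabilityMeasure ν → ν Sᶜ = 0 → energy V μ ≤ energy V ν

/-- The equilibrium measure: the minimiser of the energy over the probability measures on `S`. -/
def equilibriumMeasure (V : ℝ → ℝ) (S : Set ℝ) : Measure ℝ :=
  Classical.epsilon (IsEquilibriumMeasure V S)

/-- The left edge of the support of the equilibrium measure. -/
def alphaMinus (V : ℝ → ℝ) (S : Set ℝ) : ℝ := sInf (equilibriumMeasure V S).support

/-- The right edge of the support of the equilibrium measure. -/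
def alphaPlus (V : ℝ → ℝ) (S : Set ℝ) : ℝ := sSup (equilibriumMeasure V S).support

/-! ### The effective potential -/

open Classical in
/-- The function `V(x) / 2 - ∫ ln |x - ξ| dμ_eq(ξ)` on `S`, and `+∞` outside `S`.
As `μ_eq` has compact support, the integral is `-∞`, and the value `+∞`, when the logarithm is
not integrable. A point mass at `x`, where the integrand is `-∞`, also gives `+∞`. -/
def effPotential (V : ℝ → ℝ) (S : Set ℝ) (x : ℝ) : EReal :=
  if x ∈ S ∧ equilibriumMeasure V S {x} = 0 ∧
      Integrable (fun ξ => Real.log |x - ξ|) (equilibriumMeasure V S) then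
    ((V x / 2 - ∫ ξ, Real.log |x - ξ| ∂(equilibriumMeasure V S) : ℝ) : EReal)
  else ⊤

/-- The effective potential minus its infimum over `S`. -/
def effPotentialTilde (V : ℝ → ℝ) (S : Set ℝ) (x : ℝ) : EReal :=
  effPotential V S x - ⨅ ξ ∈ S, effPotential V S ξ

open Classical in
/-- `effPotentialTilde` to the right of the support, and `+∞` for `x < α₊`. -/
def effPotentialMax (V : ℝ → ℝ) (S : Set ℝ) (x : ℝ) : EReal :=
  if x < alphaPlus V S then ⊤ else effPotentialTilde V S x

open Classical in
/-- `effPotentialTilde` to the left of the support, and `+∞` for `x > α₋`. -/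
def effPotentialMin (V : ℝ → ℝ) (S : Set ℝ) (x : ℝ) : EReal :=
  if alphaMinus V S < x then ⊤ else effPotentialTilde V S x

/-! ### Large deviations -/

/-- A good rate function on `S`: lower semicontinuous with values in `[0, +∞]` and
compact sublevel sets. -/
structure IsGoodRateFunctionOn (I : ℝ → EReal) (S : Set ℝ) : Prop where
  nonneg : ∀ x ∈ S, 0 ≤ I x
  lowerSemicontinuousOn : LowerSemicontinuousOn I S
  isCompact_sublevel : ∀ c : ℝ, IsCompact {x ∈ S | I x ≤ (c : EReal)}

/-- `(1 / N) ln p`, in the extended real line, with `ln 0 = -∞`. -/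
def scaledLog (N : ℕ) (p : ENNReal) : EReal := (((1 : ℝ) / (N : ℝ) : ℝ) : EReal) * ENNReal.log p

/-- The large deviation principle on `S` with speed `N` and rate function `I`. The relatively
closed (open) subsets of `S` are the sets `F ∩ S` with `F` closed (`U ∩ S` with `U` open). -/
structure SatisfiesLDPOn (P : ℕ → Measure ℝ) (I : ℝ → EReal) (S : Set ℝ) : Prop where
  upper : ∀ F : Set ℝ, IsClosed F →
    limsup (fun N : ℕ => scaledLog N (P N (F ∩ S))) atTop ≤ -(⨅ x ∈ F ∩ S, I x)
  lower : ∀ U : Set ℝ, IsOpen U →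
    -(⨅ x ∈ U ∩ S, I x) ≤ liminf (fun N : ℕ => scaledLog N (P N (U ∩ S))) atTop

end BetaEnsemble

end

/-!
# Large deviations of the extreme points of a confined beta ensemble

Write `μ` for the equilibrium measure and `excess x = V x / 2 - ∫ ln |x - ξ| dμ(ξ) - ℓ` for the
effective potential minus its Euler-Lagrange constant `ℓ`. Removing one point `x` from a
configuration of `n + 1` points multiplies the density by the inverse of
`insertionFactor`, that is of
`exp (-(n + 1) β V x / 2) * ∏ |x - l j| ^ β * exp (-∑ β V (l j) / 2)`.
When the empirical measure of the remaining points `l` is close to `μ`, this factor is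
`exp (-β n (excess x + const) + o(n))`, the constant being independent of `x`; the constants cancel
in the ratio of two masses, and a point is found at `x` with probability
`exp (-β n excess x + o(n))`. The largest point behaves like this to the right of the support,
where the excess does not vanish by hypothesis, and it cannot lie strictly to the left of the right
edge except with probability `exp (-c n²)`, since this would keep the empirical measure away
from `μ`.

*Concentration.* Closeness to `μ` is measured by `discr`, the energy of `∑ δ (l j) - n μ` for the
regularised kernel `-ln √(x² + ε²)`. This kernel is a superposition of Poisson kernels up to an
infinite constant, hence positive definite on neutral measures (`regLog_posDef`). So `discr` is
nonnegative, and by the Cauchy-Schwarz inequality it controls the regularised potential of the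
configuration (`discr_cauchySchwarz`). Expanding the energy of a configuration around `μ` bounds the
density from above by `exp (-(β / 2) (discr + 2 n ∑ excess))` times a constant of order
`exp (O(n²))` (`weight_le`); Jensen's inequality for a measure of bounded density close to `μ` gives
a partition function of at least this constant, up to `exp (o(n²))` (`exists_le_mass_univ`). Hence
configurations that are not in `goodSet` have probability `exp (-c n²)`
(`exists_mass_compl_goodSet_le`). Configurations all of whose points lie to the left of a point `a`
with `μ (a, ∞) > 0` are not in `goodSet` (`exists_le_discr_of_forall_le`).

*One point.* The mass of the configurations of `n + 1` points whose first point lies in a given set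
is compared with the total mass for `n` points, from above in `eventually_mass_coord_le` and from
below in `eventually_le_mass_succ` and `eventually_le_mass_coord`, all with the same rate
`insertionRate`. A set on which the effective potential has a large excess is bounded by the union
bound. The lower bound for the largest point asks moreover that the other points stay to the left
of it. These estimates give the large deviation principle for the largest point
(`satisfiesLDPOn_max`); the one for the smallest point follows by reflection.

*Equilibrium measure.* The estimates above use `μ` through `IsRegularEquilibrium`: compact support,
the Euler-Lagrange conditions, and a potential that is the uniform limit of its regularisations.
The energy is, up to a constant, the integral of a nonnegative lower semicontinuous kernel that
grows at infinity, so that it has a minimiser by tightness (`exists_isMinimizer`). The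
Euler-Lagrange conditions follow from variations towards uniform measures on small segments
(`energy_le_kernelPot`) and from lower semicontinuity (`kernelPot_le_energy`). On the support they
express the potential through the continuous function `V`, and Dini's theorem makes the
convergence of the regularised potentials uniform (`isRegularEquilibrium`). Only these properties
enter, so the argument applies to whichever minimiser `equilibriumMeasure` selects, and uniqueness
of the minimiser plays no role.

The potential is given on a closed interval only. It is extended to the line with the same growth
(`exists_isConfining_extension`), which changes none of the objects in question.
-/

noncomputable section

namespace BetaEnsemble

/-! ### Regularised logarithms and positive definiteness -/

/-- The regularisation `-ln √(x² + ε²)` of the logarithmic kernel `-ln |x|`. -/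
def regLog (ε x : ℝ) : ℝ := -(1 / 2) * Real.log (x ^ 2 + ε ^ 2)

/-- The difference of two regularised logarithms, a bounded bump around the origin when
`0 < a < b`. -/
def bump (a b x : ℝ) : ℝ := regLog a x - regLog b x

/-- The mutual energy `∬ g (x - y) da(x) db(y)` of two measures for the kernel `g`. -/
def mutualEnergy (g : ℝ → ℝ) (a b : Measure ℝ) : ℝ := ∫ p : ℝ × ℝ, g (p.1 - p.2) ∂(a.prod b)

lemma continuous_regLog {ε : ℝ} (hε : 0 < ε) : Continuous (regLog ε) := by
  unfold regLog
  refine continuous_const.mul (Continuous.log (by fun_prop) fun x => ?_)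
  positivity

lemma continuous_bump {a b : ℝ} (ha : 0 < a) (hb : 0 < b) : Continuous (bump a b) :=
  (continuous_regLog ha).sub (continuous_regLog hb)

lemma regLog_neg (ε x : ℝ) : regLog ε (-x) = regLog ε x := by simp [regLog]

lemma regLog_sub_comm (ε x y : ℝ) : regLog ε (x - y) = regLog ε (y - x) := by
  rw [← regLog_neg, neg_sub]

/-- The Fourier representation of the Poisson kernel. -/
lemma integral_exp_mul_cos {t : ℝ} (ht : 0 < t) (x : ℝ) :
    ∫ k in Set.Ioi (0 : ℝ), Real.exp (-(t * k)) * Real.cos (k * x) = t / (x ^ 2 + t ^ 2) := by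
  have hre : ((-t : ℂ) + x * Complex.I).re < 0 := by simp [ht]
  have h := integral_exp_mul_complex_Ioi hre 0
  have hi := integrableOn_exp_mul_complex_Ioi hre 0
  have h2 := Complex.reCLM.integral_comp_comm hi
  rw [h] at h2
  have e1 : ∀ k : ℝ, Complex.reCLM (Complex.exp (((-t : ℂ) + x * Complex.I) * k)) =
      Real.exp (-(t * k)) * Real.cos (k * x) := by
    intro k
    simp [Complex.exp_re, mul_comm]
  simp only [e1] at h2
  rw [h2]
  have hne : t ^ 2 + x ^ 2 ≠ 0 := by positivity
  simp [Complex.inv_re, Complex.normSq_apply, neg_div]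
  field_simp
  ring

/-- The Poisson kernel is positive definite, its Fourier transform being positive. -/
lemma poisson_posDef {ι : Type*} [Fintype ι] (m : ι → Measure ℝ) [∀ i, IsFiniteMeasure (m i)]
    (c : ι → ℝ) {t : ℝ} (ht : 0 < t) :
    0 ≤ ∑ i, ∑ j, c i * c j * mutualEnergy (fun x => t / (x ^ 2 + t ^ 2)) (m i) (m j) := by
  set C : ι → ℝ → ℝ := fun i k => ∫ x, Real.cos (k * x) ∂(m i)
  set S : ι → ℝ → ℝ := fun i k => ∫ x, Real.sin (k * x) ∂(m i)
  have hexp : Integrable (fun k : ℝ => Real.exp (-(t * k))) (volume.restrict (Set.Ioi 0)) := by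
    have := integrableOn_exp_mul_Ioi (a := -t) (by linarith) 0
    simpa [IntegrableOn] using this
  have hint : ∀ i j, Integrable (Function.uncurry fun (p : ℝ × ℝ) (k : ℝ) =>
      Real.exp (-(t * k)) * Real.cos (k * (p.1 - p.2)))
      (((m i).prod (m j)).prod (volume.restrict (Set.Ioi 0))) := by
    intro i j
    have h1 := (integrable_const (μ := (m i).prod (m j)) (1 : ℝ)).mul_prod hexp
    refine h1.mono (by fun_prop) (ae_of_all _ fun z => ?_)
    simp only [Function.uncurry, norm_mul, one_mul, Real.norm_eq_abs]
    exact mul_le_of_le_one_right (abs_nonneg _) (Real.abs_cos_le_one _)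
  have hcos : ∀ i j k, ∫ p : ℝ × ℝ, Real.cos (k * (p.1 - p.2)) ∂((m i).prod (m j)) =
      C i k * C j k + S i k * S j k := by
    intro i j k
    simp only [mul_sub, Real.cos_sub]
    have hc : ∀ i, Integrable (fun x => Real.cos (k * x)) (m i) := fun i =>
      (integrable_const (1 : ℝ)).mono (by fun_prop)
        (ae_of_all _ fun x => by simpa using Real.abs_cos_le_one _)
    have hs : ∀ i, Integrable (fun x => Real.sin (k * x)) (m i) := fun i =>
      (integrable_const (1 : ℝ)).mono (by fun_prop)
        (ae_of_all _ fun x => by simpa using Real.abs_sin_le_one _)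
    rw [integral_add ((hc i).mul_prod (hc j)) ((hs i).mul_prod (hs j)),
      integral_prod_mul (fun x => Real.cos (k * x)) (fun x => Real.cos (k * x)),
      integral_prod_mul (fun x => Real.sin (k * x)) (fun x => Real.sin (k * x))]
  have hswap : ∀ i j, mutualEnergy (fun x => t / (x ^ 2 + t ^ 2)) (m i) (m j) =
      ∫ k in Set.Ioi (0 : ℝ), Real.exp (-(t * k)) * (C i k * C j k + S i k * S j k) := by
    intro i j
    unfold mutualEnergy
    simp only [← integral_exp_mul_cos ht]
    rw [integral_integral_swap (hint i j)]
    simp only [integral_const_mul, hcos]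
  have hint2 : ∀ i j, Integrable (fun k => Real.exp (-(t * k)) * (C i k * C j k + S i k * S j k))
      (volume.restrict (Set.Ioi 0)) := by
    intro i j
    have := (hint i j).integral_prod_right
    simpa only [Function.uncurry, integral_const_mul, hcos] using this
  have hsum : ∑ i, ∑ j, c i * c j * mutualEnergy (fun x => t / (x ^ 2 + t ^ 2)) (m i) (m j) =
      ∫ k in Set.Ioi (0 : ℝ), Real.exp (-(t * k)) *
        ((∑ i, c i * C i k) ^ 2 + (∑ i, c i * S i k) ^ 2) := by
    simp only [hswap, ← integral_const_mul]
    simp only [← integral_finsetSum _ fun j _ => (hint2 _ j).const_mul _]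
    rw [← integral_finsetSum _ fun i _ => integrable_finsetSum _ fun j _ => (hint2 i j).const_mul _]
    congr 1
    ext k
    rw [sq, sq, Finset.sum_mul_sum, Finset.sum_mul_sum, ← Finset.sum_add_distrib, Finset.mul_sum]
    refine Finset.sum_congr rfl fun i _ => ?_
    rw [← Finset.sum_add_distrib, Finset.mul_sum]
    exact Finset.sum_congr rfl fun j _ => by ring
  rw [hsum]
  exact integral_nonneg fun k => by positivity

/-- The difference of two regularised logarithms is a superposition of Poisson kernels. -/
lemma bump_eq_integral {a b : ℝ} (ha : 0 < a) (hab : a ≤ b) (x : ℝ) :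
    bump a b x = ∫ t in a..b, t / (x ^ 2 + t ^ 2) := by
  rw [intervalIntegral.integral_eq_sub_of_hasDerivAt (f := fun t => 1 / 2 * Real.log (x ^ 2 + t ^ 2))]
  · simp only [bump, regLog]; ring
  · intro t ht
    rw [Set.uIcc_of_le hab] at ht
    have h0 : 0 < t := ha.trans_le ht.1
    have h1 : HasDerivAt (fun t : ℝ => x ^ 2 + t ^ 2) (2 * t) t := by
      simpa using ((hasDerivAt_id t).pow 2).const_add (x ^ 2)
    have h2 := (h1.log (by positivity)).const_mul (1 / 2)
    refine h2.congr_deriv ?_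
    field_simp
  · refine ContinuousOn.intervalIntegrable fun t ht => ?_
    rw [Set.uIcc_of_le hab] at ht
    have h0 : 0 < t := ha.trans_le ht.1
    refine ContinuousAt.continuousWithinAt (ContinuousAt.div (by fun_prop) (by fun_prop) ?_)
    positivity

/-- The difference of two regularised logarithms is positive definite, like the Poisson kernels. -/
lemma bump_posDef {ι : Type*} [Fintype ι] (m : ι → Measure ℝ) [∀ i, IsFiniteMeasure (m i)]
    (c : ι → ℝ) {a b : ℝ} (ha : 0 < a) (hab : a ≤ b) :
    0 ≤ ∑ i, ∑ j, c i * c j * mutualEnergy (bump a b) (m i) (m j) := by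
  have hint : ∀ i j, Integrable (Function.uncurry fun (p : ℝ × ℝ) (t : ℝ) =>
      t / ((p.1 - p.2) ^ 2 + t ^ 2)) (((m i).prod (m j)).prod (volume.restrict (Set.Ioc a b))) := by
    intro i j
    have hm : Measurable (Function.uncurry fun (p : ℝ × ℝ) (t : ℝ) =>
      t / ((p.1 - p.2) ^ 2 + t ^ 2)) := by
      unfold Function.uncurry
      fun_prop
    have h0 : ∀ᵐ z ∂(((m i).prod (m j)).prod (volume.restrict (Set.Ioc a b))),
        z.2 ∈ Set.Ioc a b :=
      Measure.quasiMeasurePreserving_snd.ae (ae_restrict_mem measurableSet_Ioc)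
    refine (integrable_const (1 / a)).mono hm.aestronglyMeasurable ?_
    filter_upwards [h0] with z hz
    have hz0 : 0 < z.2 := ha.trans hz.1
    simp only [Function.uncurry]
    rw [Real.norm_of_nonneg (by positivity), Real.norm_of_nonneg (by positivity),
      div_le_div_iff₀ (by positivity) ha]
    nlinarith [sq_nonneg (z.1.1 - z.1.2), mul_lt_mul_of_pos_left hz.1 hz0]
  have hswap : ∀ i j, mutualEnergy (bump a b) (m i) (m j) =
      ∫ t in Set.Ioc a b, mutualEnergy (fun x => t / (x ^ 2 + t ^ 2)) (m i) (m j) := by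
    intro i j
    unfold mutualEnergy
    simp only [bump_eq_integral ha hab, intervalIntegral.integral_of_le hab]
    rw [integral_integral_swap (hint i j)]
  have hint2 : ∀ i j, Integrable (fun t => mutualEnergy (fun x => t / (x ^ 2 + t ^ 2)) (m i) (m j))
      (volume.restrict (Set.Ioc a b)) := fun i j => (hint i j).integral_prod_right
  simp only [hswap, ← integral_const_mul]
  simp only [← integral_finsetSum _ fun j _ => (hint2 _ j).const_mul _]
  rw [← integral_finsetSum _ fun i _ => integrable_finsetSum _ fun j _ => (hint2 i j).const_mul _]
  refine setIntegral_nonneg measurableSet_Ioc fun t ht => ?_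
  exact poisson_posDef m c (ha.trans ht.1)

lemma log_one_add_abs_nonneg (x : ℝ) : 0 ≤ Real.log (1 + |x|) :=
  Real.log_nonneg (by linarith [abs_nonneg x])

lemma log_one_add_abs_sub_le (x y : ℝ) :
    Real.log (1 + |x - y|) ≤ Real.log (1 + |x|) + Real.log (1 + |y|) := by
  have hx := abs_nonneg x
  have hy := abs_nonneg y
  rw [← Real.log_mul (by positivity) (by positivity)]
  refine Real.log_le_log (by positivity) ?_
  nlinarith [abs_sub x y, mul_nonneg hx hy]

lemma continuous_log_one_add_abs : Continuous fun x : ℝ => Real.log (1 + |x|) :=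
  Continuous.log (by fun_prop) fun x => by positivity

/-- A two-sided bound for the regularised logarithm, after subtraction of its behaviour in the
regularisation parameter. -/
lemma abs_regLog_add_log_le {R : ℝ} (hR : 1 ≤ R) (x : ℝ) :
    |regLog R x + Real.log R| ≤ Real.log (1 + |x|) := by
  have hR0 : 0 < R := by linarith
  have hx := abs_nonneg x
  have e : regLog R x + Real.log R = -(1 / 2) * Real.log ((x / R) ^ 2 + 1) := by
    have : x ^ 2 + R ^ 2 = ((x / R) ^ 2 + 1) * R ^ 2 := by field_simp
    rw [regLog, this, Real.log_mul (by positivity) (by positivity), Real.log_pow]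
    push_cast
    ring
  rw [e, abs_mul, abs_of_nonneg (Real.log_nonneg (by nlinarith [sq_nonneg (x / R)]))]
  have h2 : Real.log ((x / R) ^ 2 + 1) ≤ 2 * Real.log (1 + |x|) := by
    have : 2 * Real.log (1 + |x|) = Real.log ((1 + |x|) ^ 2) := by rw [Real.log_pow]; push_cast; ring
    rw [this]
    refine Real.log_le_log (by positivity) ?_
    have : (x / R) ^ 2 ≤ x ^ 2 := by
      rw [div_pow]
      exact div_le_self (sq_nonneg x) (one_le_pow₀ hR)
    nlinarith [sq_abs x]
  rw [show |(-(1 / 2) : ℝ)| = 1 / 2 by norm_num [abs_of_neg]]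
  linarith

/-- A wide regularisation turns the logarithmic kernel into a constant, which neutral measures do
not feel. -/
lemma tendsto_regLog_add_log (x : ℝ) :
    Tendsto (fun n : ℕ => regLog (n + 1) x + Real.log (n + 1)) atTop (𝓝 0) := by
  have e : ∀ n : ℕ, regLog (n + 1) x + Real.log (n + 1) =
      -(1 / 2) * Real.log ((x * (1 / ((n : ℝ) + 1))) ^ 2 + 1) := by
    intro n
    have h0 : (0 : ℝ) < n + 1 := by positivity
    have : x ^ 2 + ((n : ℝ) + 1) ^ 2 = ((x * (1 / ((n : ℝ) + 1))) ^ 2 + 1) * ((n : ℝ) + 1) ^ 2 := by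
      field_simp
    rw [regLog, this, Real.log_mul (by positivity) (by positivity), Real.log_pow]
    push_cast
    ring
  simp only [e]
  have h1 : Tendsto (fun n : ℕ => (x * (1 / ((n : ℝ) + 1))) ^ 2 + 1) atTop (𝓝 ((x * 0) ^ 2 + 1)) :=
    ((tendsto_one_div_add_atTop_nhds_zero_nat.const_mul x).pow 2).add_const 1
  have h2 := (h1.log (by simp)).const_mul (-(1 / 2) : ℝ)
  simpa using h2

lemma exists_abs_regLog_le {ε : ℝ} (hε : 0 < ε) :
    ∃ C : ℝ, ∀ x, |regLog ε x| ≤ C + Real.log (1 + |x|) := by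
  refine ⟨|Real.log ε| + |Real.log (1 + ε)|, fun x => ?_⟩
  have hx := abs_nonneg x
  have h1 : Real.log (x ^ 2 + ε ^ 2) ≤ 2 * (Real.log (1 + ε) + Real.log (1 + |x|)) := by
    rw [← Real.log_mul (by positivity) (by positivity)]
    have : ∀ y : ℝ, 2 * Real.log y = Real.log (y ^ 2) := fun y => by
      rw [Real.log_pow]; push_cast; ring
    rw [this]
    refine Real.log_le_log (by positivity) ?_
    have : 0 ≤ ε * |x| := by positivity
    have h3 : ((1 + ε) * (1 + |x|)) = 1 + ε + |x| + ε * |x| := by ring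
    rw [h3, ← sq_abs x]
    nlinarith
  have h2 : 2 * Real.log ε ≤ Real.log (x ^ 2 + ε ^ 2) := by
    have : 2 * Real.log ε = Real.log (ε ^ 2) := by rw [Real.log_pow]; push_cast; ring
    rw [this]
    exact Real.log_le_log (by positivity) (by nlinarith [sq_nonneg x])
  have h3 := neg_abs_le (Real.log ε)
  have h4 := le_abs_self (Real.log (1 + ε))
  have h5 := log_one_add_abs_nonneg x
  have h6 := abs_nonneg (Real.log ε)
  have h7 := abs_nonneg (Real.log (1 + ε))
  rw [regLog, abs_le]
  constructor <;> linarith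

/-- The logarithmic moment `∫ ln (1 + |x|) dm` is finite. -/
def HasLogMoment (m : Measure ℝ) : Prop := Integrable (fun x : ℝ => Real.log (1 + |x|)) m

lemma HasLogMoment.integrable_prod {a b : Measure ℝ} [IsFiniteMeasure a] [IsFiniteMeasure b]
    (ha : HasLogMoment a) (hb : HasLogMoment b) :
    Integrable (fun p : ℝ × ℝ => Real.log (1 + |p.1|) + Real.log (1 + |p.2|)) (a.prod b) :=
  (Integrable.comp_fst ha b).add (Integrable.comp_snd hb a)

lemma HasLogMoment.integrable_regLog_prod {a b : Measure ℝ} [IsFiniteMeasure a]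
    [IsFiniteMeasure b] (ha : HasLogMoment a) (hb : HasLogMoment b) {ε : ℝ} (hε : 0 < ε) :
    Integrable (fun p : ℝ × ℝ => regLog ε (p.1 - p.2)) (a.prod b) := by
  obtain ⟨C, hC⟩ := exists_abs_regLog_le hε
  refine ((integrable_const C).add (ha.integrable_prod hb)).mono'
    ((continuous_regLog hε).comp (by fun_prop)).aestronglyMeasurable (ae_of_all _ fun p => ?_)
  have := log_one_add_abs_sub_le p.1 p.2
  simp only [Real.norm_eq_abs, Pi.add_apply]
  linarith [hC (p.1 - p.2)]

lemma HasLogMoment.integrable_regLog {a : Measure ℝ} [IsFiniteMeasure a] (ha : HasLogMoment a)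
    {ε : ℝ} (hε : 0 < ε) (x : ℝ) : Integrable (fun ξ => regLog ε (x - ξ)) a := by
  obtain ⟨C, hC⟩ := exists_abs_regLog_le hε
  refine ((integrable_const (C + Real.log (1 + |x|))).add ha).mono'
    ((continuous_regLog hε).comp (by fun_prop)).aestronglyMeasurable (ae_of_all _ fun p => ?_)
  have := log_one_add_abs_sub_le x p
  simp only [Real.norm_eq_abs, Pi.add_apply]
  linarith [hC (x - p)]

/-- The regularised logarithm is conditionally positive definite: its energy is nonnegative on
neutral combinations of measures. -/
lemma regLog_posDef {ι : Type*} [Fintype ι] (m : ι → Measure ℝ) [∀ i, IsFiniteMeasure (m i)]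
    (hm : ∀ i, HasLogMoment (m i)) (c : ι → ℝ) (hc : ∑ i, c i * (m i).real Set.univ = 0)
    {ε : ℝ} (hε : 0 < ε) :
    0 ≤ ∑ i, ∑ j, c i * c j * mutualEnergy (regLog ε) (m i) (m j) := by
  -- The energy for `regLog ε` is at least the one for `regLog R` when `ε ≤ R`, and the latter
  -- tends to `0` as `R → ∞`, since the constant `ln R` does not contribute.
  have hlim : ∀ i j, Tendsto (fun n : ℕ => mutualEnergy (fun x => regLog (n + 1) x +
      Real.log (n + 1)) (m i) (m j)) atTop (𝓝 0) := by
    intro i j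
    have := tendsto_integral_of_dominated_convergence
      (F := fun (n : ℕ) (p : ℝ × ℝ) => regLog (n + 1) (p.1 - p.2) + Real.log (n + 1))
      (f := fun _ => (0 : ℝ)) (μ := (m i).prod (m j))
      (fun p => Real.log (1 + |p.1|) + Real.log (1 + |p.2|))
      (fun n => (((continuous_regLog (by positivity)).comp (by fun_prop)).add
        continuous_const).aestronglyMeasurable)
      ((hm i).integrable_prod (hm j))
      (fun n => ae_of_all _ fun p => by
        have h1 := abs_regLog_add_log_le (R := n + 1) (by linarith [n.cast_nonneg (α := ℝ)])
          (p.1 - p.2)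
        exact h1.trans (log_one_add_abs_sub_le _ _))
      (ae_of_all _ fun p => tendsto_regLog_add_log _)
    simpa [mutualEnergy] using this
  have hlim2 : Tendsto (fun n : ℕ => ∑ i, ∑ j, c i * c j * mutualEnergy (fun x => regLog (n + 1) x +
      Real.log (n + 1)) (m i) (m j)) atTop (𝓝 0) := by
    have := tendsto_finsetSum Finset.univ fun i _ => tendsto_finsetSum Finset.univ
      fun j _ => (hlim i j).const_mul (c i * c j)
    simpa using this
  refine le_of_tendsto hlim2 ?_
  filter_upwards [eventually_ge_atTop ⌈ε⌉₊] with n hn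
  have hn' : ε ≤ n + 1 := by
    have := Nat.ceil_le.mp hn
    linarith
  have hb := bump_posDef m c hε hn'
  have e : ∀ i j, mutualEnergy (bump ε (n + 1)) (m i) (m j) = mutualEnergy (regLog ε) (m i) (m j)
      - mutualEnergy (fun x => regLog (n + 1) x + Real.log (n + 1)) (m i) (m j)
      + Real.log (n + 1) * ((m i).real Set.univ * (m j).real Set.univ) := by
    intro i j
    have h1 := (hm i).integrable_regLog_prod (hm j) hε
    have h2 := (hm i).integrable_regLog_prod (hm j) (ε := n + 1) (by positivity)
    unfold mutualEnergy bump
    rw [integral_sub h1 h2, integral_add h2 (integrable_const _), integral_const]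
    simp only [← Set.univ_prod_univ, measureReal_prod_prod, smul_eq_mul]
    ring
  have hz : ∑ i, ∑ j, c i * c j * (Real.log (n + 1) * ((m i).real Set.univ * (m j).real Set.univ))
      = 0 := by
    have : ∑ i, ∑ j, c i * c j * (Real.log (n + 1) * ((m i).real Set.univ * (m j).real Set.univ))
      = Real.log (n + 1) * ((∑ i, c i * (m i).real Set.univ) * ∑ i, c i * (m i).real Set.univ) := by
      rw [Finset.sum_mul_sum, Finset.mul_sum]
      refine Finset.sum_congr rfl fun i _ => ?_
      rw [Finset.mul_sum]
      exact Finset.sum_congr rfl fun j _ => by ring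
    rw [this, hc]; ring
  simp only [e, mul_add, mul_sub, Finset.sum_add_distrib, Finset.sum_sub_distrib] at hb
  linarith

/-! ### Potentials and the discrepancy of a configuration -/

/-- The logarithmic potential `- ∫ ln |x - ξ| dμ(ξ)`. -/
def logPot (μ : Measure ℝ) (x : ℝ) : ℝ := -∫ ξ, Real.log |x - ξ| ∂μ

/-- The potential of `μ` for the regularised logarithm. -/
def regPot (ε : ℝ) (μ : Measure ℝ) (x : ℝ) : ℝ := ∫ ξ, regLog ε (x - ξ) ∂μ

/-- The counting measure of a configuration of points. -/
def countingMeasure {n : ℕ} (l : Fin n → ℝ) : Measure ℝ := ∑ i, Measure.dirac (l i)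

/-- The regularised energy of the neutral signed measure `∑ i, δ (l i) - n μ`. -/
def discr (ε : ℝ) (μ : Measure ℝ) {n : ℕ} (l : Fin n → ℝ) : ℝ :=
  (∑ i, ∑ j, regLog ε (l i - l j)) - 2 * n * ∑ i, regPot ε μ (l i) + n ^ 2 * ∫ x, regPot ε μ x ∂μ

instance {n : ℕ} (l : Fin n → ℝ) : IsFiniteMeasure (countingMeasure l) := by
  unfold countingMeasure; infer_instance

lemma integrable_countingMeasure {n : ℕ} (l : Fin n → ℝ) (f : ℝ → ℝ) :
    Integrable f (countingMeasure l) := by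
  unfold countingMeasure
  rw [integrable_finsetSum_measure]
  exact fun i _ => integrable_dirac (by simp)

lemma integral_countingMeasure {n : ℕ} (l : Fin n → ℝ) (f : ℝ → ℝ) :
    ∫ x, f x ∂(countingMeasure l) = ∑ i, f (l i) := by
  unfold countingMeasure
  rw [integral_finsetSum_measure fun i _ => integrable_dirac (by simp)]
  simp

lemma countingMeasure_real_univ {n : ℕ} (l : Fin n → ℝ) :
    (countingMeasure l).real Set.univ = n := by
  have := integral_countingMeasure l fun _ => 1
  simpa using this

lemma hasLogMoment_countingMeasure {n : ℕ} (l : Fin n → ℝ) : HasLogMoment (countingMeasure l) :=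
  integrable_countingMeasure l _

lemma hasLogMoment_dirac (x : ℝ) : HasLogMoment (Measure.dirac x) := integrable_dirac (by simp)

lemma mutualEnergy_comm {g : ℝ → ℝ} (hg : ∀ x, g (-x) = g x) (a b : Measure ℝ)
    [SFinite a] [SFinite b] : mutualEnergy g a b = mutualEnergy g b a := by
  unfold mutualEnergy
  rw [← integral_prod_swap]
  refine integral_congr_ae (ae_of_all _ fun p => ?_)
  simp only [Prod.fst_swap, Prod.snd_swap]
  rw [← hg, neg_sub]

/-- A nonnegative quadratic polynomial satisfies the Cauchy-Schwarz inequality. -/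
lemma sq_le_mul_of_quadratic_nonneg {A B C : ℝ} (h : ∀ t : ℝ, 0 ≤ A + 2 * t * B + t ^ 2 * C) :
    B ^ 2 ≤ A * C := by
  have := discrim_le_zero (a := C) (b := 2 * B) (c := A) fun t => by
    have := h t
    nlinarith
  unfold discrim at this
  nlinarith

section Config

variable {μ : Measure ℝ} [IsProbabilityMeasure μ] (hμ : HasLogMoment μ) {n : ℕ} (l : Fin n → ℝ)
include hμ

/-- The energy of the neutral signed measure `∑ j, δ (l j) - n μ + t (δ x - μ)` is nonnegative. -/
lemma discr_cauchySchwarz_aux {ε : ℝ} (hε : 0 < ε) (x t : ℝ) :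
    0 ≤ discr ε μ l + 2 * t * ((∑ j, (regLog ε (x - l j) - regPot ε μ (l j))) -
      n * (regPot ε μ x - ∫ y, regPot ε μ y ∂μ)) +
      t ^ 2 * (regLog ε 0 - 2 * regPot ε μ x + ∫ y, regPot ε μ y ∂μ) := by
  have hl := hasLogMoment_countingMeasure l
  have hx := hasLogMoment_dirac x
  have : ∀ i, IsFiniteMeasure (![countingMeasure l, μ, Measure.dirac x] i) := fun i => by
    fin_cases i <;> simp <;> infer_instance
  have h := regLog_posDef ![countingMeasure l, μ, Measure.dirac x] (ε := ε)
    (fun i => by fin_cases i <;> simp [hl, hμ, hx])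
    ![1, -n - t, t] (by simp [Fin.sum_univ_three, countingMeasure_real_univ]; ring) hε
  have e1 : ∀ b : Measure ℝ, HasLogMoment b → ∀ [IsFiniteMeasure b],
      mutualEnergy (regLog ε) (countingMeasure l) b = ∑ i, ∫ y, regLog ε (l i - y) ∂b := by
    intro b hb _
    rw [mutualEnergy, integral_prod _ (hl.integrable_regLog_prod hb hε), integral_countingMeasure]
  have e2 : ∀ b : Measure ℝ, HasLogMoment b → ∀ [IsFiniteMeasure b],
      mutualEnergy (regLog ε) μ b = ∫ x, ∫ y, regLog ε (x - y) ∂b ∂μ := by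
    intro b hb _
    rw [mutualEnergy, integral_prod _ (hμ.integrable_regLog_prod hb hε)]
  have e3 : mutualEnergy (regLog ε) (Measure.dirac x) (Measure.dirac x) = regLog ε 0 := by
    rw [mutualEnergy, integral_prod _ (hx.integrable_regLog_prod hx hε)]
    simp
  have c1 := mutualEnergy_comm (regLog_neg ε) (Measure.dirac x) (countingMeasure l)
  have c2 := mutualEnergy_comm (regLog_neg ε) (Measure.dirac x) μ
  have c3 := mutualEnergy_comm (regLog_neg ε) μ (countingMeasure l)
  simp only [Fin.sum_univ_three, Matrix.cons_val, c1, c2, c3, e3, e1 _ hl, e1 _ hμ, e1 _ hx, e2 _ hμ,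
    e2 _ hx, integral_countingMeasure, integral_dirac] at h
  have r1 : ∫ y, regLog ε (y - x) ∂μ = ∫ y, regLog ε (x - y) ∂μ := by
    simp only [regLog_sub_comm ε x]
  have r2 : ∑ i, regLog ε (l i - x) = ∑ i, regLog ε (x - l i) := by
    simp only [regLog_sub_comm ε x]
  rw [r1, r2] at h
  simp only [discr, regPot, Finset.sum_sub_distrib] at h ⊢
  refine h.trans (le_of_eq ?_)
  ring

lemma discr_nonneg {ε : ℝ} (hε : 0 < ε) : 0 ≤ discr ε μ l := by
  simpa using discr_cauchySchwarz_aux hμ l hε 0 0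

/-- The potential of `∑ j, δ (l j) - n μ`, tested against the neutral measure `δ x - μ`, is
controlled by the discrepancy. -/
lemma discr_cauchySchwarz {ε : ℝ} (hε : 0 < ε) (x : ℝ) :
    ((∑ j, (regLog ε (x - l j) - regPot ε μ (l j))) -
      n * (regPot ε μ x - ∫ y, regPot ε μ y ∂μ)) ^ 2 ≤
    discr ε μ l * (regLog ε 0 - 2 * regPot ε μ x + ∫ y, regPot ε μ y ∂μ) :=
  sq_le_mul_of_quadratic_nonneg (discr_cauchySchwarz_aux hμ l hε x)

/-- The energy of `∑ j, δ (l j) - n μ + t δ x` for the kernel `bump a b` is nonnegative. No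
neutrality is needed for this kernel, so that the test measure may be `δ x`. -/
lemma bump_cauchySchwarz_aux {a b : ℝ} (ha : 0 < a) (hab : a ≤ b) (x t : ℝ) :
    0 ≤ (discr a μ l - discr b μ l) + 2 * t * ((∑ j, bump a b (x - l j)) -
      n * ∫ ξ, bump a b (x - ξ) ∂μ) + t ^ 2 * bump a b 0 := by
  have hb : 0 < b := ha.trans_le hab
  have hl := hasLogMoment_countingMeasure l
  have hx := hasLogMoment_dirac x
  have : ∀ i, IsFiniteMeasure (![countingMeasure l, μ, Measure.dirac x] i) := fun i => by
    fin_cases i <;> simp <;> infer_instance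
  have h := bump_posDef ![countingMeasure l, μ, Measure.dirac x] ![1, -n, t] ha hab
  have hi : ∀ a' b' : Measure ℝ, ∀ [IsFiniteMeasure a'] [IsFiniteMeasure b'], HasLogMoment a' →
      HasLogMoment b' → Integrable (fun p : ℝ × ℝ => bump a b (p.1 - p.2)) (a'.prod b') :=
    fun a' b' _ _ ha' hb' =>
      (ha'.integrable_regLog_prod hb' ha).sub (ha'.integrable_regLog_prod hb' hb)
  have e1 : ∀ b' : Measure ℝ, HasLogMoment b' → ∀ [IsFiniteMeasure b'],
      mutualEnergy (bump a b) (countingMeasure l) b' = ∑ i, ∫ y, bump a b (l i - y) ∂b' := by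
    intro b' hb' _
    rw [mutualEnergy, integral_prod _ (hi _ _ hl hb'), integral_countingMeasure]
  have e2 : mutualEnergy (bump a b) μ μ = ∫ x, ∫ y, bump a b (x - y) ∂μ ∂μ := by
    rw [mutualEnergy, integral_prod _ (hi _ _ hμ hμ)]
  have e4 : mutualEnergy (bump a b) (Measure.dirac x) μ = ∫ y, bump a b (x - y) ∂μ := by
    rw [mutualEnergy, integral_prod _ (hi _ _ hx hμ)]
    simp
  have e3 : mutualEnergy (bump a b) (Measure.dirac x) (Measure.dirac x) = bump a b 0 := by
    rw [mutualEnergy, integral_prod _ (hi _ _ hx hx)]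
    simp
  have hneg : ∀ x, bump a b (-x) = bump a b x := fun x => by simp [bump, regLog_neg]
  have c1 := mutualEnergy_comm hneg (Measure.dirac x) (countingMeasure l)
  have c2 := mutualEnergy_comm hneg μ (Measure.dirac x)
  have c3 := mutualEnergy_comm hneg μ (countingMeasure l)
  have r2 : ∑ i, bump a b (l i - x) = ∑ i, bump a b (x - l i) :=
    Finset.sum_congr rfl fun i _ => by rw [← hneg, neg_sub]
  simp only [Fin.sum_univ_three, Matrix.cons_val, c1, c2, c3, e3, e4, e1 _ hl, e1 _ hμ, e1 _ hx, e2,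
    integral_countingMeasure, integral_dirac] at h
  rw [r2] at h
  have s1 : ∀ y, ∫ ξ, bump a b (y - ξ) ∂μ = regPot a μ y - regPot b μ y := fun y =>
    integral_sub (hμ.integrable_regLog ha y) (hμ.integrable_regLog hb y)
  have s2 : ∫ y, (regPot a μ y - regPot b μ y) ∂μ = (∫ y, regPot a μ y ∂μ) - ∫ y, regPot b μ y ∂μ :=
    integral_sub (hμ.integrable_regLog_prod hμ ha).integral_prod_left
      (hμ.integrable_regLog_prod hμ hb).integral_prod_left
  simp only [s1, s2] at h ⊢
  have s3 : ∑ i, ∑ j, bump a b (l i - l j) =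
    (∑ i, ∑ j, regLog a (l i - l j)) - ∑ i, ∑ j, regLog b (l i - l j) := by
    simp only [bump, Finset.sum_sub_distrib]
  rw [s3] at h
  simp only [discr, Finset.sum_sub_distrib] at h ⊢
  refine h.trans (le_of_eq ?_)
  ring

/-- Less regularisation increases the discrepancy. -/
lemma discr_antitone {a b : ℝ} (ha : 0 < a) (hab : a ≤ b) : discr b μ l ≤ discr a μ l := by
  have := bump_cauchySchwarz_aux hμ l ha hab 0 0
  simp at this
  linarith

/-- The difference of the bump potentials of the configuration and of `n μ` at a point is controlled
by the discrepancy. -/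
lemma bump_cauchySchwarz {a b : ℝ} (ha : 0 < a) (hab : a ≤ b) (x : ℝ) :
    ((∑ j, bump a b (x - l j)) - n * ∫ ξ, bump a b (x - ξ) ∂μ) ^ 2 ≤
      (discr a μ l - discr b μ l) * bump a b 0 :=
  sq_le_mul_of_quadratic_nonneg (bump_cauchySchwarz_aux hμ l ha hab x)

end Config

/-! ### Configurations that miss a part of the support -/

lemma bump_two_mul_eq {ε : ℝ} (hε : 0 < ε) (x : ℝ) :
    bump ε (2 * ε) x = 1 / 2 * Real.log ((x ^ 2 + (2 * ε) ^ 2) / (x ^ 2 + ε ^ 2)) := by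
  rw [bump, regLog, regLog, Real.log_div (by positivity) (by positivity)]
  ring

lemma bump_two_mul_zero {ε : ℝ} (hε : 0 < ε) : bump ε (2 * ε) 0 ≤ 1 := by
  rw [bump_two_mul_eq hε]
  have h : ((0 : ℝ) ^ 2 + (2 * ε) ^ 2) / (0 ^ 2 + ε ^ 2) = 4 := by field_simp; ring
  rw [h]
  have : Real.log 4 = 2 * Real.log 2 := by
    rw [show (4 : ℝ) = 2 ^ 2 by norm_num, Real.log_pow]; norm_num
  have := Real.log_two_lt_d9
  linarith

lemma bump_two_mul_nonneg {ε : ℝ} (hε : 0 < ε) (x : ℝ) : 0 ≤ bump ε (2 * ε) x := by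
  rw [bump_two_mul_eq hε]
  refine mul_nonneg (by norm_num) (Real.log_nonneg ?_)
  rw [one_le_div (by positivity)]
  nlinarith [sq_nonneg ε]

lemma le_bump_two_mul {ε x : ℝ} (hε : 0 < ε) (hx : |x| ≤ ε) : 1 / 4 ≤ bump ε (2 * ε) x := by
  rw [bump_two_mul_eq hε]
  have hx2 : x ^ 2 ≤ ε ^ 2 := by rw [← sq_abs x]; gcongr
  have h : (5 : ℝ) / 2 ≤ (x ^ 2 + (2 * ε) ^ 2) / (x ^ 2 + ε ^ 2) := by
    rw [div_le_div_iff₀ (by norm_num) (by positivity)]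
    nlinarith
  have h1 : Real.log (5 / 2) ≤ Real.log ((x ^ 2 + (2 * ε) ^ 2) / (x ^ 2 + ε ^ 2)) :=
    Real.log_le_log (by norm_num) h
  have h2 : Real.log 2 ≤ Real.log (5 / 2) := Real.log_le_log (by norm_num) (by norm_num)
  have := Real.log_two_gt_d9
  linarith

lemma bump_two_mul_le {ε d x : ℝ} (hε : 0 < ε) (hd : 0 < d) (hx : d ≤ |x|) :
    bump ε (2 * ε) x ≤ 3 / 2 * ε ^ 2 / d ^ 2 := by
  rw [bump_two_mul_eq hε]
  have hx2 : d ^ 2 ≤ x ^ 2 := by rw [← sq_abs x]; gcongr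
  have h := Real.log_le_sub_one_of_pos (x := (x ^ 2 + (2 * ε) ^ 2) / (x ^ 2 + ε ^ 2))
    (by positivity)
  have h2 : (x ^ 2 + (2 * ε) ^ 2) / (x ^ 2 + ε ^ 2) - 1 = 3 * ε ^ 2 / (x ^ 2 + ε ^ 2) := by
    field_simp; ring
  have h3 : 3 * ε ^ 2 / (x ^ 2 + ε ^ 2) ≤ 3 * ε ^ 2 / d ^ 2 := by
    gcongr
    nlinarith [sq_nonneg ε]
  have h4 : 3 / 2 * ε ^ 2 / d ^ 2 = 1 / 2 * (3 * ε ^ 2 / d ^ 2) := by ring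
  rw [h4]
  linarith

/-- A window of mass `m` contains a point where the bump potential of `μ` is of order `ε`. -/
lemma exists_le_integral_bump {μ : Measure ℝ} [IsProbabilityMeasure μ] {u₁ u₂ ε : ℝ}
    (hu : u₁ < u₂) (hm : 0 < μ.real (Set.Icc u₁ u₂)) (hε : 0 < ε) (hεu : ε ≤ u₂ - u₁) :
    ∃ u ∈ Set.Icc u₁ u₂,
      ε * μ.real (Set.Icc u₁ u₂) / (16 * (u₂ - u₁)) ≤ ∫ ξ, bump ε (2 * ε) (u - ξ) ∂μ := by
  by_contra! hcon
  have hcont := continuous_bump hε (b := 2 * ε) (by positivity)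
  have hint : Integrable (Function.uncurry fun u ξ : ℝ => bump ε (2 * ε) (u - ξ))
      ((volume.restrict (Set.Icc u₁ u₂)).prod μ) := by
    refine (integrable_const (1 : ℝ)).mono' (hcont.comp (by fun_prop)).aestronglyMeasurable
      (ae_of_all _ fun p => ?_)
    simp only [Function.uncurry]
    rw [Real.norm_of_nonneg (bump_two_mul_nonneg hε _)]
    refine le_trans ?_ (bump_two_mul_zero hε)
    rw [bump_two_mul_eq hε, bump_two_mul_eq hε]
    have : ((p.1 - p.2) ^ 2 + (2 * ε) ^ 2) / ((p.1 - p.2) ^ 2 + ε ^ 2) ≤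
        ((0 : ℝ) ^ 2 + (2 * ε) ^ 2) / (0 ^ 2 + ε ^ 2) := by
      rw [div_le_div_iff₀ (by positivity) (by positivity)]
      nlinarith [sq_nonneg ((p.1 - p.2) * ε)]
    have := Real.log_le_log (by positivity) this
    linarith
  have hswap := integral_integral_swap hint
  have hup : ∫ u in Set.Icc u₁ u₂, ∫ ξ, bump ε (2 * ε) (u - ξ) ∂μ ≤
      (u₂ - u₁) * (ε * μ.real (Set.Icc u₁ u₂) / (16 * (u₂ - u₁))) := by
    have := setIntegral_mono_on (μ := volume) hint.integral_prod_left
      (integrable_const (ε * μ.real (Set.Icc u₁ u₂) / (16 * (u₂ - u₁)))) measurableSet_Icc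
      (fun u hu => (hcon u hu).le)
    simpa [hu.le] using this
  have hlow : ε / 8 * μ.real (Set.Icc u₁ u₂) ≤
      ∫ ξ, (∫ u in Set.Icc u₁ u₂, bump ε (2 * ε) (u - ξ)) ∂μ := by
    have h1 : ∀ ξ ∈ Set.Icc u₁ u₂, ε / 8 ≤ ∫ u in Set.Icc u₁ u₂, bump ε (2 * ε) (u - ξ) := by
      intro ξ hξ
      -- one of the two intervals of length `ε / 2` next to `ξ` lies in the window
      obtain ⟨s, hs, hsξ⟩ : ∃ s, Set.Icc s (s + ε / 2) ⊆ Set.Icc u₁ u₂ ∧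
          ∀ u ∈ Set.Icc s (s + ε / 2), |u - ξ| ≤ ε := by
        rcases le_total (ξ + ε / 2) u₂ with h | h
        · refine ⟨ξ, Set.Icc_subset_Icc hξ.1 h, fun u hu => ?_⟩
          rw [abs_le]; constructor <;> linarith [hu.1, hu.2]
        · refine ⟨ξ - ε / 2, Set.Icc_subset_Icc (by linarith) (by linarith [hξ.2]), fun u hu => ?_⟩
          rw [abs_le]; constructor <;> linarith [hu.1, hu.2]
      have hi : IntegrableOn (fun u => bump ε (2 * ε) (u - ξ)) (Set.Icc u₁ u₂) :=
        (hcont.comp (by fun_prop : Continuous fun u : ℝ => u - ξ)).continuousOn.integrableOn_Icc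
      have h2 : ∫ u in Set.Icc s (s + ε / 2), bump ε (2 * ε) (u - ξ) ≤
          ∫ u in Set.Icc u₁ u₂, bump ε (2 * ε) (u - ξ) :=
        setIntegral_mono_set hi (ae_of_all _ fun u => bump_two_mul_nonneg hε _)
          (ae_of_all _ hs)
      refine le_trans ?_ h2
      have h3 := setIntegral_mono_on (μ := volume) (s := Set.Icc s (s + ε / 2))
        (f := fun _ => (1 / 4 : ℝ)) (integrable_const _) (hi.mono_set hs) measurableSet_Icc
        (fun u hu => le_bump_two_mul hε (hsξ u hu))
      have h4 : (0 : ℝ) ≤ ε / 2 := by positivity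
      simp [h4] at h3
      linarith
    have h5 : ∫ ξ in Set.Icc u₁ u₂, (ε / 8) ∂μ ≤
        ∫ ξ in Set.Icc u₁ u₂, (∫ u in Set.Icc u₁ u₂, bump ε (2 * ε) (u - ξ)) ∂μ :=
      setIntegral_mono_on (integrable_const _) hint.integral_prod_right.integrableOn
        measurableSet_Icc h1
    refine le_trans (le_of_eq ?_) (h5.trans (setIntegral_le_integral hint.integral_prod_right
      (ae_of_all _ fun ξ => integral_nonneg fun u => bump_two_mul_nonneg hε _)))
    simp [mul_comm]
  have h0 : (0 : ℝ) < u₂ - u₁ := by linarith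
  have e : (u₂ - u₁) * (ε * μ.real (Set.Icc u₁ u₂) / (16 * (u₂ - u₁))) =
    ε / 16 * μ.real (Set.Icc u₁ u₂) := by field_simp
  rw [e] at hup
  have := mul_pos hε hm
  linarith

/-- If `μ` charges the half-line to the right of `a`, the configurations in `(-∞, a]` have a
discrepancy of the order of the square of the number of points. -/
lemma exists_le_discr_of_forall_le {μ : Measure ℝ} [IsProbabilityMeasure μ] (hμ : HasLogMoment μ)
    {a : ℝ} (ha : μ (Set.Ioi a) ≠ 0) :
    ∃ ε > 0, ∃ c > 0, ∀ (n : ℕ) (l : Fin n → ℝ), (∀ i, l i ≤ a) → c * n ^ 2 ≤ discr ε μ l := by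
  obtain ⟨u₁, u₂, hu₁, hu, hm⟩ : ∃ u₁ u₂, a < u₁ ∧ u₁ < u₂ ∧ 0 < μ.real (Set.Icc u₁ u₂) := by
    by_contra! hcon
    apply ha
    have hcov : Set.Ioi a ⊆ ⋃ k : ℕ, Set.Icc (a + 1 / (k + 1)) (a + (k + 2)) := by
      intro x hx
      obtain ⟨k, hk⟩ := exists_nat_one_div_lt (sub_pos.2 (Set.mem_Ioi.1 hx))
      obtain ⟨k', hk'⟩ := exists_nat_ge (x - a)
      refine Set.mem_iUnion.2 ⟨max k k', ?_, ?_⟩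
      · have : (1 : ℝ) / ((max k k' : ℕ) + 1) ≤ 1 / (k + 1) := by
          gcongr
          exact_mod_cast le_max_left _ _
        linarith
      · have : (k' : ℝ) ≤ (max k k' : ℕ) := by exact_mod_cast le_max_right _ _
        linarith
    refine measure_mono_null hcov (measure_iUnion_null fun k => ?_)
    have h0 : (0 : ℝ) < 1 / (k + 1) := by positivity
    have h1 : (1 : ℝ) / (k + 1) ≤ 1 := by
      rw [div_le_one (by positivity)]; linarith [k.cast_nonneg (α := ℝ)]
    have := hcon (a + 1 / (k + 1)) (a + (k + 2)) (by linarith)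
      (by linarith [k.cast_nonneg (α := ℝ)])
    exact (measureReal_eq_zero_iff).1 (le_antisymm this measureReal_nonneg)
  set m := μ.real (Set.Icc u₁ u₂)
  set w := u₂ - u₁
  have hw : 0 < w := sub_pos.2 hu
  set d := u₁ - a
  have hd : 0 < d := sub_pos.2 hu₁
  -- with this choice of `ε`, the bound `3 ε² / (2 d²)` is at most half of `ε m / (16 w)`
  set ε := min w (m * d ^ 2 / (48 * w))
  have hε : 0 < ε := lt_min hw (by positivity)
  obtain ⟨u, huI, hB⟩ := exists_le_integral_bump hu hm hε (min_le_left _ _)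
  refine ⟨ε, hε, (ε * m / (32 * w)) ^ 2, by positivity, fun n l hl => ?_⟩
  have hcs := bump_cauchySchwarz hμ l hε (by linarith : ε ≤ 2 * ε) u
  have h1 : (discr ε μ l - discr (2 * ε) μ l) * bump ε (2 * ε) 0 ≤ discr ε μ l := by
    have h2 := discr_nonneg hμ l (ε := 2 * ε) (by positivity)
    have h3 := discr_antitone hμ l hε (by linarith : ε ≤ 2 * ε)
    have h4 := bump_two_mul_zero hε
    nlinarith
  have h5 : ∑ j, bump ε (2 * ε) (u - l j) ≤ n * (ε * m / (32 * w)) := by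
    have h6 : ∀ j, bump ε (2 * ε) (u - l j) ≤ ε * m / (32 * w) := by
      intro j
      have h7 : d ≤ |u - l j| := by
        refine le_trans ?_ (le_abs_self _)
        have := hl j
        have := huI.1
        simp only [d]
        linarith
      refine (bump_two_mul_le hε hd h7).trans ?_
      have h8 : ε ≤ m * d ^ 2 / (48 * w) := min_le_right _ _
      have h9 : 3 / 2 * ε ^ 2 / d ^ 2 = 3 / 2 * ε / d ^ 2 * ε := by ring
      have h10 : ε * m / (32 * w) = 3 / 2 * ε / d ^ 2 * (m * d ^ 2 / (48 * w)) := by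
        field_simp
        norm_num
      rw [h9, h10]
      gcongr
    have := Finset.sum_le_sum fun j (_ : j ∈ Finset.univ) => h6 j
    simpa using this
  have h11 : n * (ε * m / (32 * w)) ≤
      n * (∫ ξ, bump ε (2 * ε) (u - ξ) ∂μ) - ∑ j, bump ε (2 * ε) (u - l j) := by
    have h12 : ε * m / (16 * w) = 2 * (ε * m / (32 * w)) := by ring_nf
    rw [h12] at hB
    have := mul_le_mul_of_nonneg_left hB (Nat.cast_nonneg (α := ℝ) n)
    linarith
  have h13 : (n * (ε * m / (32 * w))) ^ 2 ≤
      (n * (∫ ξ, bump ε (2 * ε) (u - ξ) ∂μ) - ∑ j, bump ε (2 * ε) (u - l j)) ^ 2 := by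
    gcongr
  calc (ε * m / (32 * w)) ^ 2 * n ^ 2 = (n * (ε * m / (32 * w))) ^ 2 := by ring
    _ ≤ _ := h13
    _ = _ := by ring
    _ ≤ _ := hcs
    _ ≤ _ := h1

/-! ### Regular equilibria -/

/-- The properties of the potential, of its equilibrium measure `μ` on the interval `S` and of the
Euler-Lagrange constant `ℓ` on which the large deviation estimates rest. -/
structure IsRegularEquilibrium (V : ℝ → ℝ) (S : Set ℝ) (μ : Measure ℝ) (ℓ : ℝ) : Prop where
  continuous_potential : Continuous V
  /-- The potential grows faster than `2 ln |x|`. -/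
  growth : ∃ δ > 0, ∃ C, ∀ x, (1 + δ) * Real.log (1 + |x|) ≤ V x / 2 + C
  isClosed : IsClosed S
  ordConnected : S.OrdConnected
  nontrivial : ∃ p q, p < q ∧ p ∈ S ∧ q ∈ S
  isProbabilityMeasure : IsProbabilityMeasure μ
  compl_null : μ Sᶜ = 0
  bounded : ∃ A : ℝ, μ (Set.Icc (-A) A)ᶜ = 0
  integrable_log : ∀ x, Integrable (fun ξ => Real.log |x - ξ|) μ
  /-- The regularised potentials converge from below to the potential, uniformly on the line. -/
  regPot_approx : ∀ η > 0, ∃ ε₀ > 0, ∀ ε, 0 < ε → ε ≤ ε₀ → ∀ x,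
    regPot ε μ x ≤ logPot μ x ∧ logPot μ x ≤ regPot ε μ x + η
  /-- The Euler-Lagrange inequality on `S`. -/
  le_effective : ∀ x ∈ S, ℓ ≤ V x / 2 + logPot μ x
  /-- The Euler-Lagrange equality on the support. -/
  effective_eq : ∀ x ∈ μ.support, V x / 2 + logPot μ x = ℓ

lemma abs_regLog_sub_le {ε : ℝ} (hε : 0 < ε) (x y : ℝ) :
    |regLog ε x - regLog ε y| ≤ |x - y| / ε := by
  have hd : ∀ z : ℝ, HasDerivAt (regLog ε) (-(1 / 2) * (2 * z / (z ^ 2 + ε ^ 2))) z := by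
    intro z
    have h1 : HasDerivAt (fun z : ℝ => z ^ 2 + ε ^ 2) (2 * z) z := by
      simpa using ((hasDerivAt_id z).pow 2).add_const (ε ^ 2)
    exact (h1.log (by positivity)).const_mul _
  have hb : ∀ z : ℝ, ‖-(1 / 2) * (2 * z / (z ^ 2 + ε ^ 2))‖ ≤ 1 / ε := by
    intro z
    have e : -(1 / 2) * (2 * z / (z ^ 2 + ε ^ 2)) = -(z / (z ^ 2 + ε ^ 2)) := by ring
    rw [e, norm_neg, Real.norm_eq_abs, abs_div, abs_of_pos (by positivity : 0 < z ^ 2 + ε ^ 2),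
      div_le_div_iff₀ (by positivity) hε]
    nlinarith [sq_nonneg (|z| - ε), sq_abs z, sq_nonneg z]
  have := convex_univ.norm_image_sub_le_of_norm_hasDerivWithin_le (f := regLog ε)
    (fun z _ => (hd z).hasDerivWithinAt) (fun z _ => hb z) (Set.mem_univ y) (Set.mem_univ x)
  simpa [Real.norm_eq_abs, div_eq_inv_mul] using this

lemma abs_regPot_sub_le {μ : Measure ℝ} [IsProbabilityMeasure μ] (hμ : HasLogMoment μ)
    {ε : ℝ} (hε : 0 < ε) (x y : ℝ) : |regPot ε μ x - regPot ε μ y| ≤ |x - y| / ε := by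
  unfold regPot
  rw [← integral_sub (hμ.integrable_regLog hε x) (hμ.integrable_regLog hε y), ← Real.norm_eq_abs]
  have := norm_integral_le_of_norm_le_const (μ := μ) (C := |x - y| / ε)
    (f := fun ξ => regLog ε (x - ξ) - regLog ε (y - ξ)) (ae_of_all _ fun ξ => by
      simpa using abs_regLog_sub_le hε (x - ξ) (y - ξ))
  simpa using this

lemma continuous_regPot {μ : Measure ℝ} [IsProbabilityMeasure μ] (hμ : HasLogMoment μ)
    {ε : ℝ} (hε : 0 < ε) : Continuous (regPot ε μ) := by
  rw [Metric.continuous_iff]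
  intro x η hη
  refine ⟨ε * η, by positivity, fun y hy => ?_⟩
  rw [Real.dist_eq] at hy ⊢
  refine (abs_regPot_sub_le hμ hε y x).trans_lt ?_
  rw [div_lt_iff₀ hε]
  linarith

/-- Continuous functions are integrable for a finite measure carried by a bounded set. -/
lemma integrable_of_bounded {μ : Measure ℝ} [IsFiniteMeasure μ] {A : ℝ}
    (hA : μ (Set.Icc (-A) A)ᶜ = 0) {f : ℝ → ℝ} (hf : Continuous f) : Integrable f μ := by
  have h1 : IntegrableOn f (Set.Icc (-A) A) μ := hf.continuousOn.integrableOn_compact isCompact_Icc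
  have h2 : μ.restrict (Set.Icc (-A) A) = μ := Measure.restrict_eq_self_of_ae_mem
    (by rw [ae_iff]; exact hA)
  rwa [IntegrableOn, h2] at h1

namespace IsRegularEquilibrium

variable {V : ℝ → ℝ} {S : Set ℝ} {μ : Measure ℝ} {ℓ : ℝ}

lemma hasLogMoment (h : IsRegularEquilibrium V S μ ℓ) : HasLogMoment μ := by
  have := h.isProbabilityMeasure
  obtain ⟨A, hA⟩ := h.bounded
  exact integrable_of_bounded hA continuous_log_one_add_abs

lemma continuous_logPot (h : IsRegularEquilibrium V S μ ℓ) : Continuous (logPot μ) := by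
  have := h.isProbabilityMeasure
  rw [Metric.continuous_iff]
  intro x η hη
  obtain ⟨ε, hε, hεη⟩ := h.regPot_approx (η / 4) (by positivity)
  refine ⟨ε * (η / 4), by positivity, fun y hy => ?_⟩
  rw [Real.dist_eq] at hy ⊢
  have h1 := abs_regPot_sub_le h.hasLogMoment hε y x
  have h2 : |y - x| / ε ≤ η / 4 := by
    rw [div_le_iff₀ hε]
    linarith
  have h3 := hεη ε hε le_rfl x
  have h4 := hεη ε hε le_rfl y
  have h5 := abs_le.1 (h1.trans h2)
  rw [abs_lt]
  constructor <;> linarith [h5.1, h5.2, h3.1, h3.2, h4.1, h4.2]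

lemma integrable (h : IsRegularEquilibrium V S μ ℓ) {f : ℝ → ℝ} (hf : Continuous f) :
    Integrable f μ := by
  have := h.isProbabilityMeasure
  obtain ⟨A, hA⟩ := h.bounded
  exact integrable_of_bounded hA hf

/-- The integrated Euler-Lagrange equality: the energy of `μ` is `2 ℓ - ∫ logPot μ dμ`. -/
lemma integral_potential (h : IsRegularEquilibrium V S μ ℓ) :
    ∫ x, V x ∂μ = 2 * ℓ - 2 * ∫ x, logPot μ x ∂μ := by
  have := h.isProbabilityMeasure
  have h1 : ∫ x, (V x / 2 + logPot μ x) ∂μ = ℓ := by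
    have h2 : ∀ᵐ x ∂μ, V x / 2 + logPot μ x = ℓ := by
      filter_upwards [Measure.support_mem_ae (μ := μ)] with x hx using h.effective_eq x hx
    rw [integral_congr_ae h2]
    simp
  rw [integral_add ((h.integrable h.continuous_potential).div_const 2)
    (h.integrable h.continuous_logPot), integral_div] at h1
  linarith

lemma convex (h : IsRegularEquilibrium V S μ ℓ) : Convex ℝ S := h.ordConnected.convex

end IsRegularEquilibrium

/-! ### Smooth approximations of the equilibrium measure -/

lemma integrableOn_log_abs_sub (y a b : ℝ) :
    IntegrableOn (fun x => Real.log |y - x|) (Set.Icc a b) := by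
  rcases le_or_gt a b with hab | hab
  · have h1 : IntervalIntegrable (fun x => Real.log (y - x)) volume a b := by
      have := (intervalIntegral.intervalIntegrable_log' (a := y - a) (b := y - b)).comp_sub_left y
      simpa using this
    rw [← intervalIntegrable_iff_integrableOn_Icc_of_le hab]
    simpa [Real.log_abs] using h1
  · simp [hab]

/-- The law of `(1 - r) X + r W`, where `X` has law `μ` and `W` is uniform on `[p, q]`. -/
def smoothing (μ : Measure ℝ) (p q r : ℝ) : Measure ℝ :=
  (μ.prod (ProbabilityTheory.cond volume (Set.Icc p q))).map
    fun z : ℝ × ℝ => (1 - r) * z.1 + r * z.2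

section Smoothing

variable {μ : Measure ℝ} [IsProbabilityMeasure μ] {p q r A : ℝ}

lemma isProbabilityMeasure_uniform (hpq : p < q) :
    IsProbabilityMeasure (ProbabilityTheory.cond volume (Set.Icc p q)) := by
  have h1 : volume (Set.Icc p q) ≠ 0 := by simp [hpq]
  have h2 : volume (Set.Icc p q) ≠ ⊤ := by simp
  exact ProbabilityTheory.cond_isProbabilityMeasure_of_finite h1 h2

lemma isProbabilityMeasure_smoothing (hpq : p < q) : IsProbabilityMeasure (smoothing μ p q r) := by
  have := isProbabilityMeasure_uniform hpq
  exact Measure.isProbabilityMeasure_map (by fun_prop)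

omit [IsProbabilityMeasure μ] in
lemma ae_mem_prod_uniform (hpq : p < q) {T : Set ℝ} (hT : μ Tᶜ = 0) :
    ∀ᵐ z ∂(μ.prod (ProbabilityTheory.cond volume (Set.Icc p q))),
      z.1 ∈ T ∧ z.2 ∈ Set.Icc p q := by
  have := isProbabilityMeasure_uniform hpq
  have h1 : ∀ᵐ x ∂μ, x ∈ T := by rw [ae_iff]; exact hT
  have h2 : ∀ᵐ x ∂(ProbabilityTheory.cond volume (Set.Icc p q)), x ∈ Set.Icc p q :=
    ProbabilityTheory.ae_cond_mem measurableSet_Icc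
  exact (Measure.quasiMeasurePreserving_fst.ae h1).and (Measure.quasiMeasurePreserving_snd.ae h2)

omit [IsProbabilityMeasure μ] in
lemma smoothing_compl_null (hpq : p < q) (hr : 0 ≤ r) (hr1 : r ≤ 1) {T : Set ℝ} (hT : μ Tᶜ = 0)
    (hTm : MeasurableSet T) (hTc : Convex ℝ T) (hp : p ∈ T) (hq : q ∈ T) :
    smoothing μ p q r Tᶜ = 0 := by
  have h : ∀ᵐ x ∂(smoothing μ p q r), x ∈ T := by
    have hm : Measurable fun z : ℝ × ℝ => (1 - r) * z.1 + r * z.2 := by fun_prop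
    refine (ae_map_iff (p := fun x => x ∈ T) hm.aemeasurable hTm).2 ?_
    filter_upwards [ae_mem_prod_uniform hpq hT] with z hz
    have hw : z.2 ∈ T := hTc.ordConnected.out hp hq hz.2
    exact hTc hz.1 hw (by linarith) hr (by ring)
  rwa [ae_iff] at h

/-- The uniform component gives `smoothing μ p q r` a density bounded by `1 / ((q - p) r)`. -/
lemma smoothing_le (hpq : p < q) (hr : 0 < r) :
    smoothing μ p q r ≤ ENNReal.ofReal (1 / ((q - p) * r)) • volume := by
  have := isProbabilityMeasure_uniform hpq
  refine Measure.le_iff.2 fun B hB => ?_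
  have hm : Measurable fun z : ℝ × ℝ => (1 - r) * z.1 + r * z.2 := by fun_prop
  rw [smoothing, Measure.map_apply hm hB, Measure.prod_apply (hm hB)]
  have h1 : ∀ x : ℝ, ProbabilityTheory.cond volume (Set.Icc p q)
      (Prod.mk x ⁻¹' ((fun z : ℝ × ℝ => (1 - r) * z.1 + r * z.2) ⁻¹' B)) ≤
      ENNReal.ofReal (1 / ((q - p) * r)) * volume B := by
    intro x
    have e : (Prod.mk x ⁻¹' ((fun z : ℝ × ℝ => (1 - r) * z.1 + r * z.2) ⁻¹' B)) =
      (fun w => r * w) ⁻¹' ((fun y => (1 - r) * x + y) ⁻¹' B) := rfl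
    rw [e, ProbabilityTheory.cond_apply measurableSet_Icc]
    have h2 : volume (Set.Icc p q ∩ (fun w => r * w) ⁻¹' ((fun y => (1 - r) * x + y) ⁻¹' B)) ≤
        ENNReal.ofReal (1 / r) * volume B := by
      refine (measure_mono Set.inter_subset_right).trans ?_
      rw [Real.volume_preimage_mul_left hr.ne', measure_preimage_add, abs_of_pos (by positivity),
        one_div]
    refine (mul_le_mul_right h2 _).trans (le_of_eq ?_)
    rw [Real.volume_Icc, ← mul_assoc, ← ENNReal.ofReal_inv_of_pos (by linarith),
      ← ENNReal.ofReal_mul (by simp; linarith), one_div, one_div, mul_inv]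
  refine (lintegral_mono h1).trans ?_
  simp

end Smoothing

/-- The equilibrium measure is approximated, in energy and from below in potential, by measures
with a bounded density. -/
lemma IsRegularEquilibrium.exists_smooth_approx {V : ℝ → ℝ} {S : Set ℝ} {μ : Measure ℝ} {ℓ : ℝ}
    (h : IsRegularEquilibrium V S μ ℓ) {η : ℝ} (hη : 0 < η) :
    ∃ (ρ : Measure ℝ) (M : ℝ), IsProbabilityMeasure ρ ∧ 0 < M ∧
      ρ ≤ ENNReal.ofReal M • volume.restrict S ∧ (∃ A : ℝ, ρ (Set.Icc (-A) A)ᶜ = 0) ∧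
      (∀ y, Integrable (fun x => Real.log |y - x|) ρ) ∧ (∀ y, logPot ρ y ≤ logPot μ y + η) ∧
      ∫ x, V x ∂ρ ≤ ∫ x, V x ∂μ + η ∧ ∫ x, logPot μ x ∂ρ ≤ ∫ x, logPot μ x ∂μ + η := by
  have hprob := h.isProbabilityMeasure
  obtain ⟨p, q, hpq, hp, hq⟩ := h.nontrivial
  obtain ⟨A, hA0, hpA, hqA, hA⟩ : ∃ A : ℝ, 0 < A ∧ -A ≤ p ∧ q ≤ A ∧ μ (Set.Icc (-A) A)ᶜ = 0 := by
    obtain ⟨A', hA'⟩ := h.bounded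
    refine ⟨max 1 (max A' (max |p| |q|)), by positivity, ?_, ?_,
      measure_mono_null (Set.compl_subset_compl.2 (Set.Icc_subset_Icc ?_ ?_)) hA'⟩
    · have : |p| ≤ max 1 (max A' (max |p| |q|)) := by simp
      linarith [neg_abs_le p]
    · have : |q| ≤ max 1 (max A' (max |p| |q|)) := by simp
      linarith [le_abs_self q]
    · have : A' ≤ max 1 (max A' (max |p| |q|)) := by simp
      linarith
    · simp
  have huni := isProbabilityMeasure_uniform hpq
  obtain ⟨ε, hε, hεη⟩ := h.regPot_approx (η / 2) (by positivity)
  -- the modulus of continuity of a continuous function on `[-A, A]`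
  have hmod : ∀ f : ℝ → ℝ, Continuous f → ∃ τ > 0, ∀ x ∈ Set.Icc (-A) A, ∀ y ∈ Set.Icc (-A) A,
      |x - y| < τ → f x ≤ f y + η := by
    intro f hf
    have := (isCompact_Icc (a := -A) (b := A)).uniformContinuousOn_of_continuous hf.continuousOn
    obtain ⟨τ, hτ, hτ'⟩ := Metric.uniformContinuousOn_iff.1 this η hη
    refine ⟨τ, hτ, fun x hx y hy hxy => ?_⟩
    have := hτ' x hx y hy hxy
    rw [Real.dist_eq] at this
    linarith [le_abs_self (f x - f y)]
  obtain ⟨τ₁, hτ₁, hV⟩ := hmod V h.continuous_potential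
  obtain ⟨τ₂, hτ₂, hU⟩ := hmod _ h.continuous_logPot
  obtain ⟨r, hr, hr2, hrε, hrτ₁, hrτ₂⟩ : ∃ r : ℝ, 0 < r ∧ r ≤ 1 / 2 ∧ r * (8 * A) ≤ ε * η ∧
      r * (4 * A) ≤ τ₁ ∧ r * (4 * A) ≤ τ₂ := by
    refine ⟨min (1 / 2) (min (ε * η / (8 * A)) (min (τ₁ / (4 * A)) (τ₂ / (4 * A)))),
      by positivity, min_le_left _ _, ?_, ?_, ?_⟩
    · rw [← le_div_iff₀ (by positivity)]; simp
    · rw [← le_div_iff₀ (by positivity)]; simp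
    · rw [← le_div_iff₀ (by positivity)]; simp
  have hr1 : 0 < 1 - r := by linarith
  set ρ := smoothing μ p q r
  set κ := ProbabilityTheory.cond volume (Set.Icc p q)
  have hρ : IsProbabilityMeasure ρ := isProbabilityMeasure_smoothing hpq
  have hρA : ρ (Set.Icc (-A) A)ᶜ = 0 := smoothing_compl_null hpq hr.le (by linarith) hA
    measurableSet_Icc (convex_Icc _ _) ⟨hpA, by linarith⟩ ⟨by linarith, hqA⟩
  have hρS : ρ Sᶜ = 0 := smoothing_compl_null hpq hr.le (by linarith) h.compl_null
    h.isClosed.measurableSet h.convex hp hq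
  have hρle : ρ ≤ ENNReal.ofReal (1 / ((q - p) * r)) • volume := smoothing_le hpq hr
  have hM : 0 < 1 / ((q - p) * r) := by
    have := sub_pos.2 hpq
    positivity
  have hrestr : ∀ T : Set ℝ, MeasurableSet T → ρ Tᶜ = 0 →
      ρ ≤ ENNReal.ofReal (1 / ((q - p) * r)) • volume.restrict T := by
    intro T hTm hT
    have e : ρ.restrict T = ρ := Measure.restrict_eq_self_of_ae_mem (by rw [ae_iff]; exact hT)
    rw [← e, ← Measure.restrict_smul]
    exact Measure.restrict_mono subset_rfl hρle
  have hlog : ∀ y, Integrable (fun x => Real.log |y - x|) ρ := fun y =>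
    ((integrableOn_log_abs_sub y (-A) A).smul_measure ENNReal.ofReal_ne_top).mono_measure
      (hrestr _ measurableSet_Icc hρA)
  have hmap : Measurable fun z : ℝ × ℝ => (1 - r) * z.1 + r * z.2 := by fun_prop
  have haeprod := ae_mem_prod_uniform (μ := μ) hpq hA
  have hshift : ∀ f : ℝ → ℝ, Continuous f → (∀ x ∈ Set.Icc (-A) A, ∀ y ∈ Set.Icc (-A) A,
      |x - y| < r * (4 * A) → f x ≤ f y + η) → ∫ x, f x ∂ρ ≤ ∫ x, f x ∂μ + η := by
    intro f hf hfη
    have hfi : Integrable (fun z : ℝ × ℝ => f ((1 - r) * z.1 + r * z.2)) (μ.prod κ) :=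
      (integrable_map_measure hf.aestronglyMeasurable hmap.aemeasurable).1
        (integrable_of_bounded hρA hf)
    have e1 : ∫ x, f x ∂ρ = ∫ z : ℝ × ℝ, f ((1 - r) * z.1 + r * z.2) ∂(μ.prod κ) :=
      integral_map hmap.aemeasurable hf.aestronglyMeasurable
    have e2 : ∫ x, f x ∂μ = ∫ z : ℝ × ℝ, f z.1 ∂(μ.prod κ) := by
      rw [integral_fun_fst]; simp
    have hfi2 : Integrable (fun z : ℝ × ℝ => f z.1) (μ.prod κ) :=
      (integrable_of_bounded hA hf).comp_fst κ
    rw [e1, e2]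
    have h3 : ∫ z : ℝ × ℝ, (f z.1 + η) ∂(μ.prod κ) = ∫ z : ℝ × ℝ, f z.1 ∂(μ.prod κ) + η := by
      rw [integral_add hfi2 (integrable_const _)]; simp
    rw [← h3]
    refine integral_mono_ae hfi (hfi2.add (integrable_const _)) ?_
    filter_upwards [haeprod] with z hz
    have hz2 : z.2 ∈ Set.Icc (-A) A := ⟨hpA.trans hz.2.1, hz.2.2.trans hqA⟩
    refine hfη _ (convex_Icc (-A) A hz.1 hz2 hr1.le hr.le (by ring)) _ hz.1 ?_
    have e3 : (1 - r) * z.1 + r * z.2 - z.1 = r * (z.2 - z.1) := by ring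
    rw [smul_eq_mul, smul_eq_mul, e3, abs_mul, abs_of_pos hr]
    have : |z.2 - z.1| ≤ 2 * A := by
      rw [abs_le]; constructor <;> linarith [hz.1.1, hz.1.2, hz2.1, hz2.2]
    nlinarith
  refine ⟨ρ, _, hρ, hM, hrestr S h.isClosed.measurableSet hρS, ⟨A, hρA⟩, hlog, fun y => ?_,
    hshift V h.continuous_potential fun x hx y hy hxy => hV x hx y hy (hxy.trans_le hrτ₁),
    hshift _ h.continuous_logPot fun x hx y hy hxy => hU x hx y hy (hxy.trans_le hrτ₂)⟩
  -- the potential is averaged over `W`; given `W = w`, the law is an affine image of `μ`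
  have hmeas : Measurable fun x : ℝ => Real.log |y - x| := by fun_prop
  have hi : Integrable (fun z : ℝ × ℝ => Real.log |y - ((1 - r) * z.1 + r * z.2)|) (μ.prod κ) :=
    (integrable_map_measure hmeas.aestronglyMeasurable hmap.aemeasurable).1 (hlog y)
  have e1 : ∫ x, Real.log |y - x| ∂ρ =
      ∫ w, ∫ x, Real.log |y - ((1 - r) * x + r * w)| ∂μ ∂κ := by
    have : ∫ x, Real.log |y - x| ∂ρ =
      ∫ z : ℝ × ℝ, Real.log |y - ((1 - r) * z.1 + r * z.2)| ∂(μ.prod κ) :=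
      integral_map hmap.aemeasurable hmeas.aestronglyMeasurable
    rw [this, integral_prod_symm _ hi]
  have hw : ∀ᵐ w ∂κ, -(logPot μ y + η) ≤ ∫ x, Real.log |y - ((1 - r) * x + r * w)| ∂μ := by
    filter_upwards [ProbabilityTheory.ae_cond_mem (μ := volume) (s := Set.Icc p q)
      measurableSet_Icc, hi.prod_left_ae] with w hw hwi
    have hε' : 0 < (1 - r) * ε := by positivity
    set y' := (y - r * w) / (1 - r)
    have hy' : ∀ x, y - ((1 - r) * x + r * w) = (1 - r) * (y' - x) := by
      intro x
      simp only [y']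
      field_simp
      ring
    have h1 : ∫ x, (Real.log (1 - r) + Real.log |y' - x|) ∂μ ≤
        ∫ x, Real.log |y - ((1 - r) * x + r * w)| ∂μ := by
      refine integral_mono ((integrable_const _).add (h.integrable_log y')) hwi fun x => ?_
      dsimp only
      rw [hy']
      rcases eq_or_ne (y' - x) 0 with h0 | h0
      · rw [h0]
        simpa using Real.log_nonpos hr1.le (by linarith)
      · rw [abs_mul, Real.log_mul (by positivity) (by positivity), abs_of_pos hr1]
    have h2 : ∫ x, (Real.log (1 - r) + Real.log |y' - x|) ∂μ = Real.log (1 - r) - logPot μ y' := by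
      rw [integral_add (integrable_const _) (h.integrable_log y'), logPot]
      simp
    have h3 := (hεη ε hε le_rfl y').2
    have h4 : regPot ε μ y' - Real.log (1 - r) ≤ regPot ((1 - r) * ε) μ y + η / 2 := by
      have e3 : regPot ε μ y' - Real.log (1 - r) =
          ∫ x, (regLog ε (y' - x) - Real.log (1 - r)) ∂μ := by
        rw [integral_sub (h.hasLogMoment.integrable_regLog hε y') (integrable_const _), regPot]
        simp
      have e4 : regPot ((1 - r) * ε) μ y + η / 2 =
          ∫ x, (regLog ((1 - r) * ε) (y - x) + η / 2) ∂μ := by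
        rw [integral_add (h.hasLogMoment.integrable_regLog hε' y) (integrable_const _), regPot]
        simp
      rw [e3, e4]
      refine integral_mono_ae ((h.hasLogMoment.integrable_regLog hε y').sub (integrable_const _))
        ((h.hasLogMoment.integrable_regLog hε' y).add (integrable_const _)) ?_
      have hAae : ∀ᵐ x ∂μ, x ∈ Set.Icc (-A) A := by rw [ae_iff]; exact hA
      filter_upwards [hAae] with x hx
      have e5 : regLog ε (y' - x) - Real.log (1 - r) =
          regLog ((1 - r) * ε) (y - ((1 - r) * x + r * w)) := by
        have : ((1 - r) * (y' - x)) ^ 2 + ((1 - r) * ε) ^ 2 =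
          (1 - r) ^ 2 * ((y' - x) ^ 2 + ε ^ 2) := by ring
        rw [hy', regLog, regLog, this, Real.log_mul (by positivity) (by positivity), Real.log_pow]
        push_cast
        ring
      rw [e5]
      have h5 := abs_regLog_sub_le hε' (y - ((1 - r) * x + r * w)) (y - x)
      have e6 : y - ((1 - r) * x + r * w) - (y - x) = -(r * (w - x)) := by ring
      have h6 : |w - x| ≤ 2 * A := by
        rw [abs_le]; constructor <;> linarith [hx.1, hx.2, hw.1, hw.2]
      have h7 : |y - ((1 - r) * x + r * w) - (y - x)| / ((1 - r) * ε) ≤ η / 2 := by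
        rw [e6, abs_neg, abs_mul, abs_of_pos hr, div_le_iff₀ hε']
        have h8 : r * |w - x| ≤ r * (2 * A) := by gcongr
        have h9 : 1 / 2 * (ε * η) ≤ (1 - r) * (ε * η) := by
          have : 0 < ε * η := by positivity
          gcongr
          linarith
        linarith
      linarith [le_abs_self (regLog ((1 - r) * ε) (y - ((1 - r) * x + r * w)) -
        regLog ((1 - r) * ε) (y - x))]
    have h5 := (hεη ((1 - r) * ε) hε' (mul_le_of_le_one_left hε.le (by linarith)) y).1
    linarith
  have e2 : -(logPot μ y + η) ≤ ∫ w, ∫ x, Real.log |y - ((1 - r) * x + r * w)| ∂μ ∂κ := by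
    have := integral_mono_ae (integrable_const (-(logPot μ y + η))) hi.integral_prod_right hw
    simpa using this
  rw [logPot, e1]
  linarith

/-! ### The unnormalised ensemble -/

/-- Lebesgue measure on `S ^ n`. -/
def boxMeasure (S : Set ℝ) (n : ℕ) : Measure (Fin n → ℝ) :=
  Measure.pi fun _ => volume.restrict S

/-- The ensemble density with a general external field `W`, independent of the number of
points. -/
def fieldWeight (β : ℝ) (W : ℝ → ℝ) (n : ℕ) (l : Fin n → ℝ) : ℝ :=
  (∏ i, Real.exp (-W (l i))) * ∏ i, ∏ j ∈ Finset.Ioi i, |l i - l j| ^ β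

/-- The unnormalised mass that the ensemble of `n` points gives to a set of configurations. -/
def mass (β : ℝ) (V : ℝ → ℝ) (S : Set ℝ) (n : ℕ) (A : Set (Fin n → ℝ)) : ENNReal :=
  ∫⁻ l in A, ENNReal.ofReal (weight β V n l) ∂(boxMeasure S n)

lemma weight_eq_fieldWeight (β : ℝ) (V : ℝ → ℝ) (n : ℕ) :
    weight β V n = fieldWeight β (fun x => n * β / 2 * V x) n := by
  ext l
  simp [weight, fieldWeight, neg_mul]

lemma fieldWeight_nonneg (β : ℝ) (W : ℝ → ℝ) (n : ℕ) (l : Fin n → ℝ) :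
    0 ≤ fieldWeight β W n l := by
  unfold fieldWeight; positivity

lemma measurable_fieldWeight (β : ℝ) {W : ℝ → ℝ} (hW : Measurable W) (n : ℕ) :
    Measurable (fieldWeight β W n) := by
  unfold fieldWeight
  fun_prop

lemma measurable_weight (β : ℝ) {V : ℝ → ℝ} (hV : Measurable V) (n : ℕ) :
    Measurable (weight β V n) := by
  unfold weight
  fun_prop

lemma boxMeasure_eq (S : Set ℝ) (n : ℕ) :
    boxMeasure S n = volume.restrict {l : Fin n → ℝ | ∀ i, l i ∈ S} := by
  rw [boxMeasure, ← Measure.restrict_pi_pi, ← volume_pi]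
  congr 1
  ext l
  simp

instance (S : Set ℝ) (n : ℕ) : SigmaFinite (boxMeasure S n) := by
  unfold boxMeasure; infer_instance

lemma ae_mem_box {S : Set ℝ} (hS : MeasurableSet S) (n : ℕ) :
    ∀ᵐ l ∂(boxMeasure S n), ∀ i, l i ∈ S := by
  have hm : MeasurableSet {l : Fin n → ℝ | ∀ i, l i ∈ S} := by
    have : {l : Fin n → ℝ | ∀ i, l i ∈ S} = Set.univ.pi fun _ => S := by ext; simp
    rw [this]
    exact MeasurableSet.univ_pi fun _ => hS
  rw [boxMeasure_eq]
  exact ae_restrict_mem hm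

lemma partitionFunction_eq_mass (β : ℝ) (V : ℝ → ℝ) (S : Set ℝ) (n : ℕ) :
    partitionFunction β V S n = mass β V S n Set.univ := by
  rw [partitionFunction, mass, Measure.restrict_univ, boxMeasure_eq]

lemma eigenvalueLaw_apply (β : ℝ) (V : ℝ → ℝ) (S : Set ℝ) (n : ℕ) {A : Set (Fin n → ℝ)}
    (hA : MeasurableSet A) :
    eigenvalueLaw β V S n A = (mass β V S n Set.univ)⁻¹ * mass β V S n A := by
  rw [eigenvalueLaw, partitionFunction_eq_mass, Measure.smul_apply, withDensity_apply _ hA,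
    ← boxMeasure_eq, smul_eq_mul, mass, mass]

lemma mass_mono {β : ℝ} {V : ℝ → ℝ} {S : Set ℝ} {n : ℕ} {A B : Set (Fin n → ℝ)} (h : A ⊆ B) :
    mass β V S n A ≤ mass β V S n B :=
  lintegral_mono_set h

lemma mass_union_le {β : ℝ} {V : ℝ → ℝ} {S : Set ℝ} {n : ℕ} (A B : Set (Fin n → ℝ)) :
    mass β V S n (A ∪ B) ≤ mass β V S n A + mass β V S n B :=
  lintegral_union_le _ _ _

lemma mass_le_of_forall_mem {β : ℝ} {V : ℝ → ℝ} {S : Set ℝ} (hS : MeasurableSet S) {n : ℕ}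
    {A B : Set (Fin n → ℝ)} (h : ∀ l, (∀ i, l i ∈ S) → l ∈ A → l ∈ B) :
    mass β V S n A ≤ mass β V S n B := by
  unfold mass
  refine lintegral_mono' (Measure.restrict_mono_ae ?_) le_rfl
  filter_upwards [ae_mem_box hS n] with l hl hA
  exact h l hl hA

lemma lintegral_box_succ (S : Set ℝ) (n : ℕ) {f : (Fin (n + 1) → ℝ) → ENNReal}
    (hf : Measurable f) :
    ∫⁻ l, f l ∂(boxMeasure S (n + 1)) =
      ∫⁻ x in S, ∫⁻ l, f (Fin.cons x l) ∂(boxMeasure S n) := by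
  have hmp := (measurePreserving_piFinSuccAbove
    (fun _ : Fin (n + 1) => volume.restrict S) 0).symm
  rw [boxMeasure, ← hmp.lintegral_comp hf, lintegral_prod]
  · simp only [MeasurableEquiv.piFinSuccAbove_symm_apply, Fin.insertNthEquiv, Equiv.coe_fn_mk,
      Fin.insertNth_zero']
    rfl
  · exact (hf.comp hmp.measurable).aemeasurable

lemma measurable_cons (n : ℕ) :
    Measurable fun z : ℝ × (Fin n → ℝ) => (Fin.cons z.1 z.2 : Fin (n + 1) → ℝ) := by
  rw [measurable_pi_iff]
  intro i
  refine Fin.cases ?_ (fun j => ?_) i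
  · simpa using measurable_fst
  · simp only [Fin.cons_succ]; fun_prop

lemma lintegral_box_succ_swap (S : Set ℝ) (n : ℕ) {f : (Fin (n + 1) → ℝ) → ENNReal}
    (hf : Measurable f) :
    ∫⁻ l, f l ∂(boxMeasure S (n + 1)) =
      ∫⁻ l, (∫⁻ x in S, f (Fin.cons x l)) ∂(boxMeasure S n) := by
  rw [lintegral_box_succ S n hf, lintegral_lintegral_swap]
  exact (hf.comp (measurable_cons n)).aemeasurable

lemma lintegral_box_prod (S : Set ℝ) (n : ℕ) {f : ℝ → ENNReal} (hf : Measurable f) :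
    ∫⁻ l, ∏ i, f (l i) ∂(boxMeasure S n) = (∫⁻ x in S, f x) ^ n := by
  induction n with
  | zero => simp [boxMeasure]
  | succ n ih =>
    rw [lintegral_box_succ S n (by fun_prop)]
    simp only [Fin.prod_univ_succ, Fin.cons_zero, Fin.cons_succ]
    have hm : Measurable fun l : Fin n → ℝ => ∏ i, f (l i) := by fun_prop
    simp only [lintegral_const_mul _ hm, ih]
    rw [lintegral_mul_const _ hf, pow_succ, mul_comm]

lemma fieldWeight_cons (β : ℝ) (W : ℝ → ℝ) (n : ℕ) (x : ℝ) (l : Fin n → ℝ) :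
    fieldWeight β W (n + 1) (Fin.cons x l) =
      Real.exp (-W x) * (∏ j, |x - l j| ^ β) * fieldWeight β W n l := by
  simp only [fieldWeight, Fin.prod_univ_succ, Fin.prod_Ioi_zero, Fin.prod_Ioi_succ, Fin.cons_zero,
    Fin.cons_succ]
  ring

lemma fieldWeight_add (β : ℝ) (W W' : ℝ → ℝ) (n : ℕ) (l : Fin n → ℝ) :
    fieldWeight β (fun x => W x + W' x) n l =
      Real.exp (-∑ j, W' (l j)) * fieldWeight β W n l := by
  simp only [fieldWeight, neg_add, Real.exp_add, Finset.prod_mul_distrib, ← Finset.sum_neg_distrib,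
    Real.exp_sum]
  ring

/-- The factor by which the density changes when a point `x` is added to a configuration. -/
def insertionFactor (β : ℝ) (V : ℝ → ℝ) {n : ℕ} (x : ℝ) (l : Fin n → ℝ) : ℝ :=
  Real.exp (-((n + 1 : ℝ) * β / 2 * V x)) * (∏ j, |x - l j| ^ β) *
    Real.exp (-∑ j, β / 2 * V (l j))

lemma insertionFactor_nonneg (β : ℝ) (V : ℝ → ℝ) {n : ℕ} (x : ℝ) (l : Fin n → ℝ) :
    0 ≤ insertionFactor β V x l := by
  unfold insertionFactor; positivity

lemma measurable_insertionFactor (β : ℝ) {V : ℝ → ℝ} (hV : Measurable V) (n : ℕ) :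
    Measurable fun z : ℝ × (Fin n → ℝ) => insertionFactor β V z.1 z.2 := by
  unfold insertionFactor
  fun_prop

lemma weight_cons (β : ℝ) (V : ℝ → ℝ) (n : ℕ) (x : ℝ) (l : Fin n → ℝ) :
    weight β V (n + 1) (Fin.cons x l) = insertionFactor β V x l * weight β V n l := by
  have e : (fun x => ((n + 1 : ℕ) : ℝ) * β / 2 * V x) =
      fun x => (n : ℝ) * β / 2 * V x + β / 2 * V x := by
    ext y; push_cast; ring
  rw [weight_eq_fieldWeight, weight_eq_fieldWeight, fieldWeight_cons, insertionFactor]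
  simp only [e, fieldWeight_add]
  push_cast
  ring

/-- The density is symmetric in the points: its interaction part is a power of the absolute value
of a Vandermonde determinant. -/
lemma weight_comp_perm (β : ℝ) (V : ℝ → ℝ) (n : ℕ) (l : Fin n → ℝ) (σ : Equiv.Perm (Fin n)) :
    weight β V n (l ∘ σ) = weight β V n l := by
  have hv : ∀ l : Fin n → ℝ, ∏ i, ∏ j ∈ Finset.Ioi i, |l i - l j| ^ β =
      |(Matrix.vandermonde l).det| ^ β := by
    intro l
    rw [Matrix.det_vandermonde, Finset.abs_prod, ← Real.finsetProd_rpow _ _ fun i _ => abs_nonneg _]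
    refine Finset.prod_congr rfl fun i _ => ?_
    rw [Finset.abs_prod, ← Real.finsetProd_rpow _ _ fun i _ => abs_nonneg _]
    exact Finset.prod_congr rfl fun j _ => by rw [abs_sub_comm]
  have hd : |(Matrix.vandermonde (l ∘ σ)).det| = |(Matrix.vandermonde l).det| := by
    have : Matrix.vandermonde (l ∘ σ) = (Matrix.vandermonde l).submatrix σ id := by
      ext i j; simp [Matrix.vandermonde]
    rw [this, Matrix.det_permute, abs_mul]
    rcases Int.units_eq_one_or (Equiv.Perm.sign σ) with h | h <;> simp [h]
  unfold weight
  rw [hv, hv, hd]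
  congr 1
  exact Equiv.prod_comp σ fun i => Real.exp (-((n : ℝ) * β / 2) * V (l i))

lemma measurePreserving_comp_perm (S : Set ℝ) (n : ℕ) (σ : Equiv.Perm (Fin n)) :
    MeasurePreserving (fun l : Fin n → ℝ => l ∘ σ) (boxMeasure S n) (boxMeasure S n) := by
  have := measurePreserving_piCongrLeft (fun _ : Fin n => volume.restrict S) σ.symm
  unfold boxMeasure
  convert this using 1
  ext l i
  have h := MeasurableEquiv.piCongrLeft_apply_apply (β := fun _ => ℝ) (e := σ.symm) l (σ i)
  simpa using h.symm

lemma mass_coord_eq (β : ℝ) {V : ℝ → ℝ} (hV : Measurable V) (S : Set ℝ) (n : ℕ) {T : Set ℝ}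
    (hT : MeasurableSet T) (i : Fin (n + 1)) :
    mass β V S (n + 1) {l | l i ∈ T} = mass β V S (n + 1) {l | l 0 ∈ T} := by
  have hm : ∀ i : Fin (n + 1), MeasurableSet {l : Fin (n + 1) → ℝ | l i ∈ T} :=
    fun i => measurable_pi_apply i hT
  unfold mass
  rw [← lintegral_indicator (hm i), ← lintegral_indicator (hm 0),
    ← (measurePreserving_comp_perm S (n + 1) (Equiv.swap 0 i)).lintegral_comp
      (((measurable_weight β hV _).ennreal_ofReal).indicator (hm i))]
  refine lintegral_congr fun l => ?_
  classical
  simp only [Set.indicator_apply, Set.mem_ofPred_eq, Function.comp_apply, Equiv.swap_apply_right,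
    weight_comp_perm]

/-- A union bound over the points. -/
lemma mass_exists_le (β : ℝ) {V : ℝ → ℝ} (hV : Measurable V) (S : Set ℝ) (n : ℕ) {T : Set ℝ}
    (hT : MeasurableSet T) :
    mass β V S (n + 1) {l | ∃ i, l i ∈ T} ≤ (n + 1 : ℕ) * mass β V S (n + 1) {l | l 0 ∈ T} := by
  have e : {l : Fin (n + 1) → ℝ | ∃ i, l i ∈ T} = ⋃ i, {l | l i ∈ T} := by ext; simp
  rw [e]
  refine (lintegral_iUnion_le _ _).trans ?_
  rw [tsum_fintype]
  have := fun i => mass_coord_eq β hV S n hT i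
  unfold mass at this
  simp only [this]
  simp [mass]

/-- Mass of a set of configurations, computed by integrating out the first point. -/
lemma mass_succ (β : ℝ) {V : ℝ → ℝ} (hV : Measurable V) (S : Set ℝ) (n : ℕ)
    {A : Set (Fin (n + 1) → ℝ)} (hA : MeasurableSet A) :
    mass β V S (n + 1) A = ∫⁻ x in S, ∫⁻ l in {l | Fin.cons x l ∈ A},
      ENNReal.ofReal (insertionFactor β V x l) * ENNReal.ofReal (weight β V n l)
        ∂(boxMeasure S n) := by
  unfold mass
  rw [← lintegral_indicator hA,
    lintegral_box_succ S n (((measurable_weight β hV _).ennreal_ofReal).indicator hA)]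
  refine lintegral_congr fun x => ?_
  have hm : MeasurableSet {l : Fin n → ℝ | (Fin.cons x l : Fin (n + 1) → ℝ) ∈ A} :=
    ((measurable_cons n).comp (measurable_const.prodMk measurable_id)) hA
  rw [← lintegral_indicator hm]
  refine lintegral_congr fun l => ?_
  classical
  simp only [Set.indicator_apply, Set.mem_ofPred_eq, weight_cons,
    ENNReal.ofReal_mul (insertionFactor_nonneg β V x l)]

/-- The total mass, with the first point integrated before the others. -/
lemma mass_succ_univ_swap (β : ℝ) {V : ℝ → ℝ} (hV : Measurable V) (S : Set ℝ) (n : ℕ) :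
    mass β V S (n + 1) Set.univ = ∫⁻ l,
      (∫⁻ x in S, ENNReal.ofReal (insertionFactor β V x l)) * ENNReal.ofReal (weight β V n l)
        ∂(boxMeasure S n) := by
  unfold mass
  rw [Measure.restrict_univ, lintegral_box_succ_swap S n (measurable_weight β hV _).ennreal_ofReal]
  refine lintegral_congr fun l => ?_
  have hm : Measurable fun x => ENNReal.ofReal (insertionFactor β V x l) :=
    ((measurable_insertionFactor β hV n).comp (measurable_id.prodMk measurable_const)).ennreal_ofReal
  rw [← lintegral_mul_const _ hm]
  refine lintegral_congr fun x => ?_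
  rw [weight_cons, ENNReal.ofReal_mul (insertionFactor_nonneg β V x l)]

/-! ### Lower bounds from Jensen's inequality -/

lemma ofReal_exp_integral_le {ρ : Measure ℝ} [IsProbabilityMeasure ρ] {f : ℝ → ℝ}
    (hf : Integrable f ρ) :
    ENNReal.ofReal (Real.exp (∫ x, f x ∂ρ)) ≤ ∫⁻ x, ENNReal.ofReal (Real.exp (f x)) ∂ρ := by
  by_cases hi : Integrable (fun x => Real.exp (f x)) ρ
  · rw [← ofReal_integral_eq_lintegral_ofReal hi (ae_of_all _ fun x => (Real.exp_pos _).le)]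
    exact ENNReal.ofReal_le_ofReal (convexOn_exp.map_integral_le Real.continuous_exp.continuousOn
      isClosed_univ (ae_of_all _ fun _ => Set.mem_univ _) hf hi)
  · have h := (lintegral_ofReal_ne_top_iff_integrable (μ := ρ) (f := fun x => Real.exp (f x))
      (Real.continuous_exp.comp_aestronglyMeasurable hf.1)
      (ae_of_all _ fun x => (Real.exp_pos _).le)).not.2 hi
    rw [not_ne_iff] at h
    rw [h]
    exact le_top

/-- Integrating out one point, with Jensen's inequality for a measure `ρ` of bounded density. -/
lemma le_lintegral_exp_mul_prod {β : ℝ} {ρ : Measure ℝ} [IsProbabilityMeasure ρ] {S : Set ℝ}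
    {M : ℝ} (hρ : ρ ≤ ENNReal.ofReal M • volume.restrict S)
    (hlog : ∀ y, Integrable (fun x => Real.log |y - x|) ρ) {W : ℝ → ℝ} (hW : Integrable W ρ)
    {n : ℕ} (l : Fin n → ℝ) :
    ENNReal.ofReal (Real.exp (-(∫ x, W x ∂ρ) - β * ∑ j, logPot ρ (l j))) ≤
      ENNReal.ofReal M *
        ∫⁻ x in S, ENNReal.ofReal (Real.exp (-W x) * ∏ j, |x - l j| ^ β) := by
  have hlog' : ∀ j, Integrable (fun x => Real.log |x - l j|) ρ := fun j => by
    simpa only [abs_sub_comm] using hlog (l j)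
  have hf : Integrable (fun x => -W x + β * ∑ j, Real.log |x - l j|) ρ :=
    hW.neg.add ((integrable_finsetSum _ fun j _ => hlog' j).const_mul β)
  have e1 : ∫ x, (-W x + β * ∑ j, Real.log |x - l j|) ∂ρ =
      -(∫ x, W x ∂ρ) - β * ∑ j, logPot ρ (l j) := by
    have h1 := integral_add hW.neg ((integrable_finsetSum Finset.univ fun j _ => hlog' j).const_mul β)
    simp only [Pi.neg_apply] at h1
    rw [h1, integral_const_mul, integral_finsetSum _ fun j _ => hlog' j]
    simp only [integral_neg, logPot, Finset.sum_neg_distrib, abs_sub_comm (l _)]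
    ring
  rw [← e1]
  refine (ofReal_exp_integral_le hf).trans ?_
  refine (lintegral_mono' hρ le_rfl).trans ?_
  rw [lintegral_smul_measure, smul_eq_mul]
  refine mul_le_mul_right (le_of_eq (lintegral_congr_ae (ae_restrict_of_ae ?_))) _
  have hfin : ∀ᵐ x : ℝ, x ∉ Set.range l := by
    rw [ae_iff]
    simp only [not_not]
    exact (Set.finite_range l).measure_zero volume
  filter_upwards [hfin] with x hx
  rw [Real.exp_add, Finset.mul_sum, Real.exp_sum]
  congr 2
  refine Finset.prod_congr rfl fun j _ => ?_
  have : 0 < |x - l j| := abs_pos.2 (sub_ne_zero.2 fun h => hx ⟨j, h.symm⟩)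
  rw [Real.rpow_def_of_pos this, mul_comm]

/-- A lower bound for the partition function in an external field, by integrating out the points
one after the other. -/
lemma le_lintegral_fieldWeight {β : ℝ} (hβ : 0 ≤ β) {ρ : Measure ℝ} [IsProbabilityMeasure ρ]
    {S : Set ℝ} {M A e : ℝ} (hM : 0 ≤ M) (hρ : ρ ≤ ENNReal.ofReal M • volume.restrict S)
    (hA : ρ (Set.Icc (-A) A)ᶜ = 0) (hlog : ∀ y, Integrable (fun x => Real.log |y - x|) ρ)
    {U : ℝ → ℝ} (hU : Continuous U) (hle : ∀ y, logPot ρ y ≤ U y) (he : ∫ x, U x ∂ρ ≤ e) (n : ℕ) :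
    ∀ W : ℝ → ℝ, Continuous W →
      ENNReal.ofReal (Real.exp (-(n * ∫ x, W x ∂ρ) - β * (n * (n - 1) / 2) * e)) ≤
        ENNReal.ofReal (M ^ n) *
          ∫⁻ l, ENNReal.ofReal (fieldWeight β W n l) ∂(boxMeasure S n) := by
  induction n with
  | zero => intro W _; simp [fieldWeight, boxMeasure]
  | succ n ih =>
    intro W hW
    have h1 := ih (fun x => W x + β * U x) (hW.add (hU.const_mul β))
    have e1 : ∫ x, (W x + β * U x) ∂ρ = ∫ x, W x ∂ρ + β * ∫ x, U x ∂ρ := by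
      rw [integral_add (integrable_of_bounded hA hW) ((integrable_of_bounded hA hU).const_mul β),
        integral_const_mul]
    have h2 : ∀ l : Fin n → ℝ, ENNReal.ofReal (Real.exp (-∫ x, W x ∂ρ)) *
        ENNReal.ofReal (fieldWeight β (fun x => W x + β * U x) n l) ≤
        ENNReal.ofReal M * ∫⁻ x in S, ENNReal.ofReal (fieldWeight β W (n + 1) (Fin.cons x l)) := by
      intro l
      have h3 := le_lintegral_exp_mul_prod (β := β) hρ hlog (integrable_of_bounded hA hW) l
      have h4 : Real.exp (-∫ x, W x ∂ρ) * Real.exp (-∑ j, β * U (l j)) ≤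
          Real.exp (-(∫ x, W x ∂ρ) - β * ∑ j, logPot ρ (l j)) := by
        rw [← Real.exp_add]
        refine Real.exp_le_exp.2 ?_
        have : β * ∑ j, logPot ρ (l j) ≤ ∑ j, β * U (l j) := by
          rw [← Finset.mul_sum]
          exact mul_le_mul_of_nonneg_left (Finset.sum_le_sum fun j _ => hle _) hβ
        linarith
      have hm : Measurable fun x => ENNReal.ofReal (Real.exp (-W x) * ∏ j, |x - l j| ^ β) := by
        have := hW.measurable
        fun_prop
      simp only [fieldWeight_cons, ENNReal.ofReal_mul' (fieldWeight_nonneg β W n l)]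
      rw [lintegral_mul_const _ hm, ← mul_assoc, fieldWeight_add,
        ← ENNReal.ofReal_mul (Real.exp_pos _).le, ← mul_assoc,
        ENNReal.ofReal_mul' (fieldWeight_nonneg β W n l)]
      exact mul_le_mul_left ((ENNReal.ofReal_le_ofReal h4).trans h3) _
    have hm : Measurable fun l => ENNReal.ofReal (fieldWeight β (fun x => W x + β * U x) n l) :=
      (measurable_fieldWeight β (hW.add (hU.const_mul β)).measurable n).ennreal_ofReal
    have hmW : Measurable fun l => ENNReal.ofReal (fieldWeight β W (n + 1) l) :=
      (measurable_fieldWeight β hW.measurable (n + 1)).ennreal_ofReal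
    calc ENNReal.ofReal (Real.exp (-(((n + 1 : ℕ) : ℝ) * ∫ x, W x ∂ρ) -
          β * (((n + 1 : ℕ) : ℝ) * (((n + 1 : ℕ) : ℝ) - 1) / 2) * e))
        ≤ ENNReal.ofReal (Real.exp (-∫ x, W x ∂ρ)) * ENNReal.ofReal (Real.exp
          (-(n * ∫ x, (W x + β * U x) ∂ρ) - β * (n * (n - 1) / 2) * e)) := by
          rw [← ENNReal.ofReal_mul (Real.exp_pos _).le, ← Real.exp_add]
          refine ENNReal.ofReal_le_ofReal (Real.exp_le_exp.2 ?_)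
          rw [e1]
          push_cast
          have : 0 ≤ β * n * (e - ∫ x, U x ∂ρ) := by
            have := sub_nonneg.2 he
            positivity
          nlinarith
      _ ≤ ENNReal.ofReal (Real.exp (-∫ x, W x ∂ρ)) * (ENNReal.ofReal (M ^ n) * ∫⁻ l,
          ENNReal.ofReal (fieldWeight β (fun x => W x + β * U x) n l) ∂(boxMeasure S n)) := by
          gcongr
      _ = ENNReal.ofReal (M ^ n) * ∫⁻ l, ENNReal.ofReal (Real.exp (-∫ x, W x ∂ρ)) *
          ENNReal.ofReal (fieldWeight β (fun x => W x + β * U x) n l) ∂(boxMeasure S n) := by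
          rw [lintegral_const_mul _ hm]; ring
      _ ≤ ENNReal.ofReal (M ^ n) * ∫⁻ l, (ENNReal.ofReal M * ∫⁻ x in S,
          ENNReal.ofReal (fieldWeight β W (n + 1) (Fin.cons x l))) ∂(boxMeasure S n) := by
          exact mul_le_mul_right (lintegral_mono h2) _
      _ = _ := by
          rw [lintegral_const_mul' _ _ ENNReal.ofReal_ne_top, ← lintegral_box_succ_swap S n hmW,
            ← mul_assoc, ← ENNReal.ofReal_mul (by positivity), pow_succ]

/-! ### Pointwise bounds for the density -/

/-- The effective potential minus its Euler-Lagrange constant. -/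
def excess (V : ℝ → ℝ) (μ : Measure ℝ) (ℓ x : ℝ) : ℝ := V x / 2 + logPot μ x - ℓ

/-- The configurations whose empirical measure is close to `μ`: the energy excess, split into a
discrepancy and the mean of the effective potential, is at most `η n²`. -/
def goodSet (V : ℝ → ℝ) (μ : Measure ℝ) (ℓ ε η : ℝ) (n : ℕ) : Set (Fin n → ℝ) :=
  {l | 2 * n * ∑ i, excess V μ ℓ (l i) + discr ε μ l ≤ η * n ^ 2}

lemma regLog_le_neg_log {ε z : ℝ} (hz : z ≠ 0) : regLog ε z ≤ -Real.log |z| := by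
  have h : Real.log (|z| ^ 2) ≤ Real.log (z ^ 2 + ε ^ 2) :=
    Real.log_le_log (by positivity) (by rw [sq_abs]; nlinarith [sq_nonneg ε])
  rw [Real.log_pow] at h
  push_cast at h
  rw [regLog]
  linarith

/-- The regularisation only decreases the repulsion; at `z = 0` the left side vanishes. -/
lemma abs_rpow_le_exp_regLog {β ε : ℝ} (hβ : 0 < β) (z : ℝ) :
    |z| ^ β ≤ Real.exp (-β * regLog ε z) := by
  rcases eq_or_ne z 0 with rfl | hz
  · rw [abs_zero, Real.zero_rpow hβ.ne']
    positivity
  · rw [Real.rpow_def_of_pos (abs_pos.2 hz)]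
    refine Real.exp_le_exp.2 ?_
    have := mul_le_mul_of_nonneg_left (regLog_le_neg_log (ε := ε) hz) hβ.le
    linarith

/-- Away from the singularity, the regularisation has little effect. -/
lemma neg_log_le_regLog_add {ε d z : ℝ} (hε : 0 < ε) (hd : 0 < d) (hz : d ≤ |z|) :
    -Real.log |z| ≤ regLog ε z + ε ^ 2 / (2 * d ^ 2) := by
  have hz0 : 0 < |z| := hd.trans_le hz
  have h1 := Real.log_le_sub_one_of_pos (x := (z ^ 2 + ε ^ 2) / |z| ^ 2) (by positivity)
  rw [Real.log_div (by positivity) (by positivity), Real.log_pow] at h1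
  have h2 : (z ^ 2 + ε ^ 2) / |z| ^ 2 - 1 = ε ^ 2 / |z| ^ 2 := by
    rw [sq_abs]
    have : z ≠ 0 := abs_pos.1 hz0
    field_simp
    ring
  have h3 : ε ^ 2 / |z| ^ 2 ≤ ε ^ 2 / d ^ 2 := by gcongr
  have h4 : ε ^ 2 / (2 * d ^ 2) = 1 / 2 * (ε ^ 2 / d ^ 2) := by field_simp
  rw [h4, regLog]
  push_cast at h1
  linarith

lemma sum_Ioi_eq {n : ℕ} (l : Fin n → ℝ) {g : ℝ → ℝ} (hg : ∀ x, g (-x) = g x) :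
    2 * ∑ i, ∑ j ∈ Finset.Ioi i, g (l i - l j) = (∑ i, ∑ j, g (l i - l j)) - n * g 0 := by
  have h := Finset.sum_sum_Ioi_add_eq_sum_sum_off_diag fun i j => g (l j - l i)
  have h1 : ∀ i, ∑ j ∈ ({i}ᶜ : Finset (Fin n)), g (l i - l j) = (∑ j, g (l i - l j)) - g 0 := by
    intro i
    have := Finset.sum_compl_add_sum {i} fun j => g (l i - l j)
    simp at this
    linarith
  simp only [h1, Finset.sum_sub_distrib, Finset.sum_const, Finset.card_univ, Fintype.card_fin,
    nsmul_eq_mul] at h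
  rw [← h, Finset.mul_sum]
  refine Finset.sum_congr rfl fun i _ => ?_
  rw [Finset.mul_sum]
  refine Finset.sum_congr rfl fun j _ => ?_
  rw [← hg (l j - l i), neg_sub]
  ring

namespace IsRegularEquilibrium

variable {V : ℝ → ℝ} {S : Set ℝ} {μ : Measure ℝ} {ℓ : ℝ}

lemma excess_nonneg (h : IsRegularEquilibrium V S μ ℓ) {x : ℝ} (hx : x ∈ S) :
    0 ≤ excess V μ ℓ x := by
  have := h.le_effective x hx
  unfold excess
  linarith

lemma continuous_excess (h : IsRegularEquilibrium V S μ ℓ) : Continuous (excess V μ ℓ) :=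
  ((h.continuous_potential.div_const 2).add h.continuous_logPot).sub continuous_const

lemma neg_logPot_le (h : IsRegularEquilibrium V S μ ℓ) (x : ℝ) :
    -logPot μ x ≤ Real.log (1 + |x|) + ∫ ξ, Real.log (1 + |ξ|) ∂μ := by
  have := h.isProbabilityMeasure
  have e : Real.log (1 + |x|) + ∫ ξ, Real.log (1 + |ξ|) ∂μ =
      ∫ ξ, (Real.log (1 + |x|) + Real.log (1 + |ξ|)) ∂μ := by
    rw [integral_add (integrable_const _) h.hasLogMoment]
    simp
  rw [logPot, neg_neg, e]
  refine integral_mono (h.integrable_log x) ((integrable_const _).add h.hasLogMoment) fun ξ => ?_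
  refine le_trans ?_ (log_one_add_abs_sub_le x ξ)
  rcases eq_or_ne (x - ξ) 0 with h0 | h0
  · simp [h0]
  · exact Real.log_le_log (abs_pos.2 h0) (by linarith)

lemma exists_growth_excess (h : IsRegularEquilibrium V S μ ℓ) :
    ∃ δ > 0, ∃ C, ∀ x, δ * Real.log (1 + |x|) ≤ excess V μ ℓ x + C := by
  obtain ⟨δ, hδ, C, hC⟩ := h.growth
  refine ⟨δ, hδ, C + ℓ + ∫ ξ, Real.log (1 + |ξ|) ∂μ, fun x => ?_⟩
  have h1 := hC x
  have h2 := h.neg_logPot_le x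
  unfold excess
  linarith

lemma sum_potential (V : ℝ → ℝ) (μ : Measure ℝ) (ℓ : ℝ) {n : ℕ} (l : Fin n → ℝ) :
    ∑ i, V (l i) = 2 * ∑ i, excess V μ ℓ (l i) + 2 * n * ℓ - 2 * ∑ i, logPot μ (l i) := by
  have : ∀ i, V (l i) = 2 * excess V μ ℓ (l i) + 2 * ℓ - 2 * logPot μ (l i) := fun i => by
    unfold excess; ring
  simp only [this, Finset.sum_sub_distrib, Finset.sum_add_distrib, ← Finset.mul_sum]
  simp
  ring

lemma integral_regPot_le (h : IsRegularEquilibrium V S μ ℓ) {ε : ℝ} (hε : 0 < ε)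
    (hle : ∀ x, regPot ε μ x ≤ logPot μ x) : ∫ x, regPot ε μ x ∂μ ≤ ∫ x, logPot μ x ∂μ := by
  have := h.isProbabilityMeasure
  exact integral_mono (h.integrable (continuous_regPot h.hasLogMoment hε))
    (h.integrable h.continuous_logPot) hle

lemma le_integral_regPot (h : IsRegularEquilibrium V S μ ℓ) {ε s : ℝ} (hε : 0 < ε)
    (hle : ∀ x, logPot μ x ≤ regPot ε μ x + s) :
    ∫ x, logPot μ x ∂μ ≤ ∫ x, regPot ε μ x ∂μ + s := by
  have := h.isProbabilityMeasure
  have e : ∫ x, regPot ε μ x ∂μ + s = ∫ x, (regPot ε μ x + s) ∂μ := by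
    rw [integral_add (h.integrable (continuous_regPot h.hasLogMoment hε)) (integrable_const _)]
    simp
  rw [e]
  exact integral_mono (h.integrable h.continuous_logPot)
    ((h.integrable (continuous_regPot h.hasLogMoment hε)).add (integrable_const _)) hle

/-- The energy of a configuration, expanded around the equilibrium measure. -/
lemma weight_le (h : IsRegularEquilibrium V S μ ℓ) {β ε s : ℝ} (hβ : 0 < β) (hε : 0 < ε)
    (hs : ∀ x, regPot ε μ x ≤ logPot μ x ∧ logPot μ x ≤ regPot ε μ x + s) {n : ℕ}
    (l : Fin n → ℝ) :
    weight β V n l ≤ Real.exp (β / 2 * (-(2 * n * ∑ i, excess V μ ℓ (l i) + discr ε μ l) -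
      n ^ 2 * (2 * ℓ - ∫ x, logPot μ x ∂μ) + 2 * n ^ 2 * s + n * regLog ε 0)) := by
  have h1 : weight β V n l ≤ Real.exp (-((n : ℝ) * β / 2) * ∑ i, V (l i)) *
      Real.exp (-β * ∑ i, ∑ j ∈ Finset.Ioi i, regLog ε (l i - l j)) := by
    unfold weight
    rw [Finset.mul_sum, Real.exp_sum, Finset.mul_sum, Real.exp_sum]
    refine mul_le_mul_of_nonneg_left (Finset.prod_le_prod (fun i _ => by positivity)
      fun i _ => ?_) (by positivity)
    rw [Finset.mul_sum, Real.exp_sum]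
    exact Finset.prod_le_prod (fun j _ => by positivity)
      fun j _ => abs_rpow_le_exp_regLog hβ _
  refine h1.trans ?_
  rw [← Real.exp_add]
  refine Real.exp_le_exp.2 ?_
  have h2 := sum_Ioi_eq l (regLog_neg ε)
  have h3 := sum_potential V μ ℓ l
  have h4 : ∑ i, logPot μ (l i) ≤ ∑ i, regPot ε μ (l i) + n * s := by
    have := Finset.sum_le_sum fun i (_ : i ∈ Finset.univ) => (hs (l i)).2
    simpa [Finset.sum_add_distrib] using this
  have h5 := h.integral_regPot_le hε fun x => (hs x).1
  have h6 : 0 ≤ 2 * n * (∑ i, regPot ε μ (l i) + n * s - ∑ i, logPot μ (l i)) +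
      n ^ 2 * (∫ x, logPot μ x ∂μ - ∫ x, regPot ε μ x ∂μ) := by
    have := sub_nonneg.2 h4
    have := sub_nonneg.2 h5
    positivity
  have h7 := mul_nonneg (by positivity : 0 ≤ β / 2) h6
  rw [h3, discr]
  have e : -β * ∑ i, ∑ j ∈ Finset.Ioi i, regLog ε (l i - l j) =
      -(β / 2) * ((∑ i, ∑ j, regLog ε (l i - l j)) - n * regLog ε 0) := by
    rw [← h2]; ring
  rw [e]
  nlinarith

/-- The interaction of a far away point with the others is compensated by the growth of the
potential. -/
lemma exists_insertionFactor_le (h : IsRegularEquilibrium V S μ ℓ) {β : ℝ} (hβ : 0 < β) :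
    ∃ δ > 0, ∃ C, ∀ (n : ℕ) (x : ℝ) (l : Fin n → ℝ), insertionFactor β V x l ≤
      Real.exp (β * (n + 1) * (C - δ * Real.log (1 + |x|))) := by
  obtain ⟨δ, hδ, C, hC⟩ := h.growth
  refine ⟨δ, hδ, 2 * max C 0, fun n x l => ?_⟩
  have h1 : insertionFactor β V x l ≤ Real.exp (-((n + 1 : ℝ) * β / 2 * V x)) *
      Real.exp (∑ j, β * Real.log (1 + |x - l j|)) * Real.exp (-∑ j, β / 2 * V (l j)) := by
    unfold insertionFactor
    rw [Real.exp_sum]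
    gcongr with j _
    have h0 := abs_nonneg (x - l j)
    rw [mul_comm β, ← Real.rpow_def_of_pos (by linarith)]
    exact Real.rpow_le_rpow h0 (by linarith) hβ.le
  refine h1.trans ?_
  rw [← Real.exp_add, ← Real.exp_add]
  refine Real.exp_le_exp.2 ?_
  -- each factor is bounded by the growth of the potential at `l j`
  have h2 : ∀ j, β * Real.log (1 + |x - l j|) - β / 2 * V (l j) ≤
      β * (Real.log (1 + |x|) + max C 0) := by
    intro j
    have h3 := log_one_add_abs_sub_le x (l j)
    have h4 := hC (l j)
    have h5 := mul_nonneg hδ.le (log_one_add_abs_nonneg (l j))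
    have h6 : Real.log (1 + |x - l j|) - V (l j) / 2 ≤ Real.log (1 + |x|) + max C 0 := by
      linarith [le_max_left C 0]
    have := mul_le_mul_of_nonneg_left h6 hβ.le
    linarith
  have h7 := Finset.sum_le_sum fun j (_ : j ∈ Finset.univ) => h2 j
  simp only [Finset.sum_sub_distrib, Finset.sum_const, Finset.card_univ, Fintype.card_fin,
    nsmul_eq_mul] at h7
  have h8 : (n : ℝ) * (β * (Real.log (1 + |x|) + max C 0)) ≤
      (n + 1) * (β * (Real.log (1 + |x|) + max C 0)) := by
    have := log_one_add_abs_nonneg x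
    have := le_max_right C 0
    gcongr
    linarith
  have h9 := mul_le_mul_of_nonneg_left (hC x) (by positivity : 0 ≤ (n + 1 : ℝ) * β)
  have h10 := mul_le_mul_of_nonneg_left (le_max_left C 0) (by positivity : 0 ≤ (n + 1 : ℝ) * β)
  nlinarith

/-- On a good configuration, the potential created by the points is close to the one of the
equilibrium measure, uniformly on bounded sets. -/
lemma exists_good_potential (h : IsRegularEquilibrium V S μ ℓ) {ε τ : ℝ} (hε : 0 < ε) (hτ : 0 < τ)
    (R : ℝ) :
    ∃ η > 0, ∀ (n : ℕ) (x : ℝ) (l : Fin n → ℝ), |x| ≤ R → (∀ i, l i ∈ S) →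
      l ∈ goodSet V μ ℓ ε η n →
      |(∑ j, (regLog ε (x - l j) - regPot ε μ (l j))) -
        n * (regPot ε μ x - ∫ y, regPot ε μ y ∂μ)| ≤ τ * n ∧
      ∑ j, excess V μ ℓ (l j) ≤ τ * n := by
  have := h.isProbabilityMeasure
  have hμ := h.hasLogMoment
  -- a bound for the energy of the test measure `δ x - μ`
  obtain ⟨D, hD⟩ := (isCompact_Icc (a := -R) (b := R)).exists_bound_of_continuousOn
    (f := fun x => regLog ε 0 - 2 * regPot ε μ x + ∫ y, regPot ε μ y ∂μ)
    ((continuous_const.sub (continuous_const.mul (continuous_regPot hμ hε))).add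
      continuous_const).continuousOn
  refine ⟨min (τ ^ 2 / max D 1) τ, by positivity, fun n x l hx hl hgood => ?_⟩
  set η := min (τ ^ 2 / max D 1) τ
  have hη1 : η * max D 1 ≤ τ ^ 2 := by
    rw [← le_div_iff₀ (by positivity)]; exact min_le_left _ _
  have hη2 : η ≤ τ := min_le_right _ _
  have hη0 : 0 < η := by positivity
  have hsum : 0 ≤ ∑ j, excess V μ ℓ (l j) := Finset.sum_nonneg fun j _ => h.excess_nonneg (hl j)
  have hdisc := discr_nonneg hμ l hε
  simp only [goodSet, Set.mem_ofPred_eq] at hgood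
  have hn0 : (0 : ℝ) ≤ n := n.cast_nonneg
  have hd2 : discr ε μ l ≤ η * n ^ 2 := by nlinarith [mul_nonneg hn0 hsum]
  constructor
  · have hcs := discr_cauchySchwarz hμ l hε x
    have hDx := (le_abs_self _).trans (hD x (abs_le.1 hx))
    have h1 : discr ε μ l * (regLog ε 0 - 2 * regPot ε μ x + ∫ y, regPot ε μ y ∂μ) ≤
        (τ * n) ^ 2 := by
      calc _ ≤ discr ε μ l * max D 1 :=
            mul_le_mul_of_nonneg_left (hDx.trans (le_max_left _ _)) hdisc
        _ ≤ η * n ^ 2 * max D 1 := by gcongr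
        _ = η * max D 1 * n ^ 2 := by ring
        _ ≤ τ ^ 2 * n ^ 2 := by gcongr
        _ = (τ * n) ^ 2 := by ring
    exact abs_le_of_sq_le_sq (hcs.trans h1) (by positivity)
  · rcases Nat.eq_zero_or_pos n with rfl | hn
    · simp
    · have hn' : (0 : ℝ) < n := by exact_mod_cast hn
      have h1 : 2 * (∑ j, excess V μ ℓ (l j)) * n ≤ η * n * n := by nlinarith
      have h2 := le_of_mul_le_mul_right h1 hn'
      have h3 : η * n ≤ τ * n := by gcongr
      linarith

/-- On good configurations, the insertion of a point at `x` costs at least the excess of the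
effective potential at `x`. -/
lemma exists_insertionFactor_good_le (h : IsRegularEquilibrium V S μ ℓ) {β τ : ℝ} (hβ : 0 < β)
    (hτ : 0 < τ) (R : ℝ) :
    ∃ ε > 0, ∃ η > 0, ∃ C, ∀ (n : ℕ) (x : ℝ) (l : Fin n → ℝ), |x| ≤ R → (∀ i, l i ∈ S) →
      l ∈ goodSet V μ ℓ ε η n →
      insertionFactor β V x l ≤ Real.exp (β * (-(n + 1) * (excess V μ ℓ x + ℓ) +
        n * ((∫ y, logPot μ y ∂μ) - ℓ) + τ * n + C)) := by
  obtain ⟨ε, hε, hεs⟩ := h.regPot_approx (τ / 3) (by positivity)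
  have hs := hεs ε hε le_rfl
  obtain ⟨η, hη, hgood⟩ := h.exists_good_potential hε (by positivity : 0 < τ / 3) R
  obtain ⟨D, hD⟩ := (isCompact_Icc (a := -R) (b := R)).exists_bound_of_continuousOn
    h.continuous_logPot.continuousOn
  refine ⟨ε, hε, η, hη, D, fun n x l hx hl hlg => ?_⟩
  obtain ⟨h1, -⟩ := hgood n x l hx hl hlg
  have hDx := (le_abs_self _).trans (hD x (abs_le.1 hx))
  have h2 : insertionFactor β V x l ≤ Real.exp (-((n + 1 : ℝ) * β / 2 * V x)) *
      Real.exp (∑ j, -β * regLog ε (x - l j)) * Real.exp (-∑ j, β / 2 * V (l j)) := by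
    unfold insertionFactor
    rw [Real.exp_sum]
    gcongr with j _
    exact abs_rpow_le_exp_regLog hβ _
  refine h2.trans ?_
  rw [← Real.exp_add, ← Real.exp_add]
  refine Real.exp_le_exp.2 ?_
  have h3 := sum_potential V μ ℓ l
  have h4 : ∑ i, logPot μ (l i) ≤ ∑ i, regPot ε μ (l i) + n * (τ / 3) := by
    have := Finset.sum_le_sum fun i (_ : i ∈ Finset.univ) => (hs (l i)).2
    simpa [Finset.sum_add_distrib] using this
  have h5 := h.integral_regPot_le hε fun x => (hs x).1
  have hsum : 0 ≤ ∑ j, excess V μ ℓ (l j) := Finset.sum_nonneg fun j _ => h.excess_nonneg (hl j)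
  have h6 := (abs_le.1 h1).1
  have h7 := (hs x).2
  have hn0 : (0 : ℝ) ≤ n := n.cast_nonneg
  rw [Finset.sum_sub_distrib] at h6
  rw [← Finset.mul_sum, ← Finset.mul_sum, h3]
  have h8 : V x = 2 * (excess V μ ℓ x + ℓ - logPot μ x) := by unfold excess; ring
  rw [h8]
  have h9 : -((n + 1 : ℝ) * β / 2 * (2 * (excess V μ ℓ x + ℓ - logPot μ x))) +
      -β * ∑ j, regLog ε (x - l j) + -(β / 2 * (2 * ∑ i, excess V μ ℓ (l i) + 2 * n * ℓ -
      2 * ∑ i, logPot μ (l i))) = β * (-(n + 1) * (excess V μ ℓ x + ℓ) + (n + 1) * logPot μ x -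
      ∑ j, regLog ε (x - l j) - ∑ i, excess V μ ℓ (l i) - n * ℓ + ∑ i, logPot μ (l i)) := by ring
  rw [h9]
  refine mul_le_mul_of_nonneg_left ?_ hβ.le
  have h10 := mul_le_mul_of_nonneg_left h7 hn0
  have h11 := mul_le_mul_of_nonneg_left h5 hn0
  nlinarith

/-- On good configurations, the insertion of a point at `x` costs at most the excess of the effective
potential at `x`, if the other points keep a distance to `x`. -/
lemma exists_le_insertionFactor_good (h : IsRegularEquilibrium V S μ ℓ) {β τ d : ℝ} (hβ : 0 < β)
    (hτ : 0 < τ) (hd : 0 < d) (R : ℝ) :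
    ∃ ε > 0, ∃ η > 0, ∃ C, ∀ (n : ℕ) (x : ℝ) (l : Fin n → ℝ), |x| ≤ R → (∀ i, l i ∈ S) →
      l ∈ goodSet V μ ℓ ε η n → (∀ j, d ≤ |x - l j|) →
      Real.exp (β * (-(n + 1) * (excess V μ ℓ x + ℓ) +
        n * ((∫ y, logPot μ y ∂μ) - ℓ) - τ * n - C)) ≤ insertionFactor β V x l := by
  obtain ⟨ε₀, hε₀, hεs⟩ := h.regPot_approx (τ / 4) (by positivity)
  -- at distance `d` from the singularity, this regularisation changes the logarithm by `τ / 4`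
  obtain ⟨ε, hε, hεε₀, hεd⟩ : ∃ ε : ℝ, 0 < ε ∧ ε ≤ ε₀ ∧ ε ^ 2 / (2 * d ^ 2) ≤ τ / 4 := by
    refine ⟨min ε₀ (d * min 1 (τ / 4)), by positivity, min_le_left _ _, ?_⟩
    rw [div_le_iff₀ (by positivity)]
    have h1 : min ε₀ (d * min 1 (τ / 4)) ≤ d * min 1 (τ / 4) := min_le_right _ _
    have h2 : min 1 (τ / 4) * min 1 (τ / 4) ≤ 1 * (τ / 4) := by
      gcongr
      · exact min_le_left _ _
      · exact min_le_right _ _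
    calc (min ε₀ (d * min 1 (τ / 4))) ^ 2 ≤ (d * min 1 (τ / 4)) ^ 2 := by gcongr
      _ = d ^ 2 * (min 1 (τ / 4) * min 1 (τ / 4)) := by ring
      _ ≤ d ^ 2 * (1 * (τ / 4)) := by gcongr
      _ ≤ _ := by nlinarith [sq_nonneg d]
  have hs := hεs ε hε hεε₀
  obtain ⟨η, hη, hgood⟩ := h.exists_good_potential hε (by positivity : 0 < τ / 4) R
  obtain ⟨D, hD⟩ := (isCompact_Icc (a := -R) (b := R)).exists_bound_of_continuousOn
    h.continuous_logPot.continuousOn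
  refine ⟨ε, hε, η, hη, D, fun n x l hx hl hlg hxl => ?_⟩
  obtain ⟨h1, h1'⟩ := hgood n x l hx hl hlg
  have hDx := (neg_le_abs _).trans (hD x (abs_le.1 hx))
  have h2 : Real.exp (-((n + 1 : ℝ) * β / 2 * V x)) *
      Real.exp (∑ j, -β * (regLog ε (x - l j) + τ / 4)) * Real.exp (-∑ j, β / 2 * V (l j)) ≤
      insertionFactor β V x l := by
    unfold insertionFactor
    rw [Real.exp_sum]
    gcongr with j _
    rw [Real.rpow_def_of_pos (hd.trans_le (hxl j))]
    refine Real.exp_le_exp.2 ?_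
    have h3 := neg_log_le_regLog_add hε hd (hxl j)
    have := mul_le_mul_of_nonneg_left (h3.trans (add_le_add_right hεd _)) hβ.le
    linarith
  refine le_trans ?_ h2
  rw [← Real.exp_add, ← Real.exp_add]
  refine Real.exp_le_exp.2 ?_
  have h3 := sum_potential V μ ℓ l
  have h4 : ∑ i, regPot ε μ (l i) ≤ ∑ i, logPot μ (l i) :=
    Finset.sum_le_sum fun i (_ : i ∈ Finset.univ) => (hs (l i)).1
  have h5 := h.le_integral_regPot hε fun x => (hs x).2
  have h6 := (abs_le.1 h1).2
  have h7 := (hs x).1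
  have hn0 : (0 : ℝ) ≤ n := n.cast_nonneg
  rw [Finset.sum_sub_distrib] at h6
  rw [← Finset.mul_sum, ← Finset.mul_sum, h3, Finset.sum_add_distrib]
  have h8 : V x = 2 * (excess V μ ℓ x + ℓ - logPot μ x) := by unfold excess; ring
  rw [h8]
  simp only [Finset.sum_const, Finset.card_univ, Fintype.card_fin, nsmul_eq_mul]
  have h9 : -((n + 1 : ℝ) * β / 2 * (2 * (excess V μ ℓ x + ℓ - logPot μ x))) +
      -β * ((∑ j, regLog ε (x - l j)) + n * (τ / 4)) +
      -(β / 2 * (2 * ∑ i, excess V μ ℓ (l i) + 2 * n * ℓ -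
      2 * ∑ i, logPot μ (l i))) = β * (-(n + 1) * (excess V μ ℓ x + ℓ) + (n + 1) * logPot μ x -
      ∑ j, regLog ε (x - l j) - n * (τ / 4) - ∑ i, excess V μ ℓ (l i) - n * ℓ +
      ∑ i, logPot μ (l i)) := by ring
  rw [h9]
  refine mul_le_mul_of_nonneg_left ?_ hβ.le
  have h10 := mul_le_mul_of_nonneg_left h7 hn0
  have h11 := mul_le_mul_of_nonneg_left h5 hn0
  nlinarith

end IsRegularEquilibrium

/-! ### Concentration of the empirical measure -/

lemma eventually_mul_exp_le {f g : ℕ → ℝ} (h : Tendsto (fun n => g n - f n) atTop atTop) (K : ℝ) :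
    ∀ᶠ n in atTop, K * Real.exp (f n) ≤ Real.exp (g n) := by
  filter_upwards [h.eventually_ge_atTop (Real.log (max K 1))] with n hn
  have h1 : K ≤ Real.exp (g n - f n) := by
    calc K ≤ max K 1 := le_max_left _ _
      _ = Real.exp (Real.log (max K 1)) := (Real.exp_log (by positivity)).symm
      _ ≤ _ := Real.exp_le_exp.2 hn
  calc K * Real.exp (f n) ≤ Real.exp (g n - f n) * Real.exp (f n) := by gcongr
    _ = Real.exp (g n) := by rw [← Real.exp_add]; congr 1; ring

lemma tendsto_linear_atTop {a : ℝ} (ha : 0 < a) (b : ℝ) :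
    Tendsto (fun n : ℕ => a * n + b) atTop atTop :=
  tendsto_atTop_add_const_right _ _ (tendsto_natCast_atTop_atTop.const_mul_atTop ha)

lemma tendsto_quadratic_atTop {a : ℝ} (ha : 0 < a) (b c : ℝ) :
    Tendsto (fun n : ℕ => a * n ^ 2 + b * n + c) atTop atTop := by
  have h : Tendsto (fun n : ℕ => (n : ℝ) * (a * n + b) + c) atTop atTop :=
    tendsto_atTop_add_const_right _ _
      (tendsto_natCast_atTop_atTop.atTop_mul_atTop₀ (tendsto_linear_atTop ha b))
  refine h.congr fun n => ?_
  ring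

lemma measurable_discr {μ : Measure ℝ} [IsProbabilityMeasure μ] (hμ : HasLogMoment μ) {ε : ℝ}
    (hε : 0 < ε) (n : ℕ) : Measurable fun l : Fin n → ℝ => discr ε μ l := by
  have h1 := (continuous_regLog hε).measurable
  have h2 := (continuous_regPot hμ hε).measurable
  unfold discr
  fun_prop

namespace IsRegularEquilibrium

variable {V : ℝ → ℝ} {S : Set ℝ} {μ : Measure ℝ} {ℓ : ℝ}

lemma measurableSet_goodSet (h : IsRegularEquilibrium V S μ ℓ) {ε : ℝ} (hε : 0 < ε) (η : ℝ)
    (n : ℕ) : MeasurableSet (goodSet V μ ℓ ε η n) := by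
  have := h.isProbabilityMeasure
  have h1 := measurable_discr h.hasLogMoment hε n
  have h2 := h.continuous_excess.measurable
  exact measurableSet_le (by fun_prop) measurable_const

/-- The lower bound for the partition function, at the scale `n²`. -/
lemma exists_le_mass_univ (h : IsRegularEquilibrium V S μ ℓ) {β η : ℝ} (hβ : 0 < β) (hη : 0 < η) :
    ∃ C, ∀ n : ℕ, ENNReal.ofReal (Real.exp (-(β / 2) * n ^ 2 * (2 * ℓ - ∫ x, logPot μ x ∂μ) -
      η * n ^ 2 - C * n)) ≤ mass β V S n Set.univ := by
  obtain ⟨ρ, M, hρ, hM, hle, ⟨A, hA⟩, hlog, hpot, hV, hU⟩ :=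
    h.exists_smooth_approx (by positivity : 0 < 2 * η / (3 * β))
  set η' := 2 * η / (3 * β)
  set c₀ := ∫ x, logPot μ x ∂μ
  have hη' : 3 * β / 2 * η' = η := by simp only [η']; field_simp
  have hUc : Continuous fun y => logPot μ y + η' := h.continuous_logPot.add continuous_const
  have he : ∫ y, (logPot μ y + η') ∂ρ ≤ c₀ + 2 * η' := by
    rw [integral_add (integrable_of_bounded hA h.continuous_logPot) (integrable_const _)]
    simp
    linarith
  refine ⟨|Real.log M| + β / 2 * |c₀ + 2 * η'|, fun n => ?_⟩
  have h1 := le_lintegral_fieldWeight hβ.le hM.le hle hA hlog hUc hpot he n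
    (fun x => n * β / 2 * V x) (h.continuous_potential.const_mul _)
  rw [← weight_eq_fieldWeight, integral_const_mul] at h1
  have h2 : mass β V S n Set.univ = ∫⁻ l, ENNReal.ofReal (weight β V n l) ∂(boxMeasure S n) := by
    rw [mass, Measure.restrict_univ]
  rw [h2]
  have hMn : ENNReal.ofReal (M ^ n) ≠ 0 := by simp; positivity
  rw [← ENNReal.mul_le_mul_iff_right hMn ENNReal.ofReal_ne_top]
  refine le_trans ?_ h1
  rw [← ENNReal.ofReal_mul (by positivity)]
  refine ENNReal.ofReal_le_ofReal ?_
  have h3 : M ^ n = Real.exp (n * Real.log M) := by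
    rw [← Real.log_pow, Real.exp_log (by positivity)]
  rw [h3, ← Real.exp_add]
  refine Real.exp_le_exp.2 ?_
  rw [h.integral_potential] at hV
  have hn0 : (0 : ℝ) ≤ n := n.cast_nonneg
  have h4 := mul_le_mul_of_nonneg_left hV (by positivity : 0 ≤ (n : ℝ) * (n * β / 2))
  have h5 := mul_le_mul_of_nonneg_left (le_abs_self (Real.log M)) hn0
  have h6 := mul_le_mul_of_nonneg_left (neg_abs_le (c₀ + 2 * η')) (by positivity : 0 ≤ β / 2 * n)
  have h7 : η * (n : ℝ) ^ 2 = 3 * β / 2 * η' * n ^ 2 := by rw [hη']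
  rw [h7]
  nlinarith

/-- The confinement makes a power of `exp (-excess)` integrable. -/
lemma exists_lintegral_exp_excess_ne_top (h : IsRegularEquilibrium V S μ ℓ) {β : ℝ} (hβ : 0 < β) :
    ∃ n₀ : ℕ, ∫⁻ x in S, ENNReal.ofReal (Real.exp (-(β / 2) * n₀ * excess V μ ℓ x)) ≠ ⊤ := by
  obtain ⟨δ, hδ, C, hC⟩ := h.exists_growth_excess
  obtain ⟨n₀, hn₀⟩ := exists_nat_ge (2 / (β / 2 * δ))
  rw [div_le_iff₀ (by positivity)] at hn₀
  refine ⟨n₀, ne_top_of_le_ne_top ?_ (setLIntegral_le_lintegral _ _)⟩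
  have hi : Integrable fun x : ℝ => Real.exp (β / 2 * n₀ * C) * (1 + ‖x‖) ^ (-2 : ℝ) :=
    (integrable_one_add_norm (by simp)).const_mul _
  refine ne_top_of_le_ne_top hi.lintegral_lt_top.ne (lintegral_mono fun x => ?_)
  refine ENNReal.ofReal_le_ofReal ?_
  rw [Real.rpow_def_of_pos (by positivity), ← Real.exp_add]
  refine Real.exp_le_exp.2 ?_
  have h1 := mul_le_mul_of_nonneg_left (hC x) (by positivity : 0 ≤ β / 2 * n₀)
  have h2 := mul_le_mul_of_nonneg_right hn₀ (log_one_add_abs_nonneg x)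
  rw [Real.norm_eq_abs]
  nlinarith

/-- The upper bound for the mass of a set of configurations with a large energy excess. -/
lemma exists_mass_le (h : IsRegularEquilibrium V S μ ℓ) {β ε s : ℝ} (hβ : 0 < β) (hε : 0 < ε)
    (hs : ∀ x, regPot ε μ x ≤ logPot μ x ∧ logPot μ x ≤ regPot ε μ x + s) :
    ∃ C, ∃ n₀ : ℕ, ∀ n ≥ n₀, ∀ (θ : ℝ) (T : Set (Fin n → ℝ)), MeasurableSet T →
      (∀ l ∈ T, (∀ i, l i ∈ S) → θ * n ^ 2 ≤ 2 * n * ∑ i, excess V μ ℓ (l i) + discr ε μ l) →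
      mass β V S n T ≤ ENNReal.ofReal (Real.exp (β / 2 * n ^ 2 *
        (-(θ / 2) - (2 * ℓ - ∫ x, logPot μ x ∂μ) + 2 * s) + C * n)) := by
  have := h.isProbabilityMeasure
  obtain ⟨n₀, hn₀⟩ := h.exists_lintegral_exp_excess_ne_top hβ
  set B := ∫⁻ x in S, ENNReal.ofReal (Real.exp (-(β / 2) * n₀ * excess V μ ℓ x))
  have hBpos : 0 < B.toReal + 1 := by positivity
  refine ⟨Real.log (B.toReal + 1) + β / 2 * regLog ε 0, n₀, fun n hn θ T hT hθ => ?_⟩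
  -- half of the energy excess gives the decay in `θ`, the other half makes the integral finite
  set K := β / 2 * (-(θ / 2) * n ^ 2 - n ^ 2 * (2 * ℓ - ∫ x, logPot μ x ∂μ) + 2 * n ^ 2 * s +
    n * regLog ε 0)
  have hn0 : (0 : ℝ) ≤ n := n.cast_nonneg
  have hmeas : Measurable fun x => ENNReal.ofReal (Real.exp (-(β / 2) * n * excess V μ ℓ x)) := by
    have := h.continuous_excess.measurable
    fun_prop
  have h1 : mass β V S n T ≤ ∫⁻ l, ENNReal.ofReal (Real.exp K) *
      ∏ i, ENNReal.ofReal (Real.exp (-(β / 2) * n * excess V μ ℓ (l i))) ∂(boxMeasure S n) := by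
    refine le_trans ?_ (setLIntegral_le_lintegral T _)
    refine lintegral_mono_ae ?_
    filter_upwards [ae_restrict_mem hT, ae_restrict_of_ae (ae_mem_box h.isClosed.measurableSet n)]
      with l hlT hl
    rw [← ENNReal.ofReal_prod_of_nonneg fun i _ => (Real.exp_pos _).le, ← Real.exp_sum,
      ← ENNReal.ofReal_mul (Real.exp_pos _).le, ← Real.exp_add]
    refine ENNReal.ofReal_le_ofReal ((h.weight_le hβ hε hs l).trans (Real.exp_le_exp.2 ?_))
    have h2 := hθ l hlT hl
    have h3 := discr_nonneg h.hasLogMoment l hε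
    rw [← Finset.mul_sum]
    simp only [K]
    nlinarith
  have h2 : ∫⁻ x in S, ENNReal.ofReal (Real.exp (-(β / 2) * n * excess V μ ℓ x)) ≤
      ENNReal.ofReal (B.toReal + 1) := by
    have h3 : ∫⁻ x in S, ENNReal.ofReal (Real.exp (-(β / 2) * n * excess V μ ℓ x)) ≤ B := by
      refine setLIntegral_mono' h.isClosed.measurableSet fun x hx => ?_
      refine ENNReal.ofReal_le_ofReal (Real.exp_le_exp.2 ?_)
      have h4 := h.excess_nonneg hx
      have h5 : (n₀ : ℝ) ≤ n := by exact_mod_cast hn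
      have h6 : β / 2 * n₀ * excess V μ ℓ x ≤ β / 2 * n * excess V μ ℓ x := by gcongr
      linarith
    refine h3.trans ?_
    rw [← ENNReal.ofReal_toReal hn₀]
    exact ENNReal.ofReal_le_ofReal (by rw [ENNReal.ofReal_toReal hn₀]; linarith)
  refine h1.trans ?_
  rw [lintegral_const_mul' _ _ ENNReal.ofReal_ne_top, lintegral_box_prod S n hmeas]
  refine (mul_le_mul_right (pow_le_pow_left₀ (by positivity) h2 n) _).trans (le_of_eq ?_)
  rw [← ENNReal.ofReal_pow hBpos.le, ← ENNReal.ofReal_mul (Real.exp_pos _).le]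
  congr 1
  have h3 : (B.toReal + 1) ^ n = Real.exp (n * Real.log (B.toReal + 1)) := by
    rw [← Real.log_pow, Real.exp_log (by positivity)]
  rw [h3, ← Real.exp_add]
  congr 1
  simp only [K]
  ring

lemma mass_univ_ne_zero (h : IsRegularEquilibrium V S μ ℓ) {β : ℝ} (hβ : 0 < β) (n : ℕ) :
    mass β V S n Set.univ ≠ 0 := by
  obtain ⟨C, hC⟩ := h.exists_le_mass_univ hβ one_pos
  have := hC n
  refine ne_bot_of_le_ne_bot ?_ this
  simp [Real.exp_pos]

lemma eventually_mass_univ_ne_top (h : IsRegularEquilibrium V S μ ℓ) {β : ℝ} (hβ : 0 < β) :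
    ∀ᶠ n in atTop, mass β V S n Set.univ ≠ ⊤ := by
  have := h.isProbabilityMeasure
  obtain ⟨ε, hε, hεs⟩ := h.regPot_approx 1 one_pos
  obtain ⟨C, n₀, hC⟩ := h.exists_mass_le hβ hε (hεs ε hε le_rfl)
  filter_upwards [eventually_ge_atTop n₀] with n hn
  refine ne_top_of_le_ne_top ENNReal.ofReal_ne_top (hC n hn 0 Set.univ MeasurableSet.univ
    fun l _ hl => ?_)
  have h1 : 0 ≤ ∑ j, excess V μ ℓ (l j) := Finset.sum_nonneg fun j _ => h.excess_nonneg (hl j)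
  have h2 := discr_nonneg h.hasLogMoment l hε
  rw [zero_mul]
  positivity

/-- Concentration: configurations whose empirical measure is not close to the equilibrium measure
have a probability that is exponentially small at the scale `n²`. -/
lemma exists_mass_compl_goodSet_le (h : IsRegularEquilibrium V S μ ℓ) {β ε η : ℝ} (hβ : 0 < β)
    (hε : 0 < ε) (hη : 0 < η) :
    ∃ c > 0, ∀ᶠ n : ℕ in atTop, mass β V S n (goodSet V μ ℓ ε η n)ᶜ ≤
      ENNReal.ofReal (Real.exp (-c * n ^ 2)) * mass β V S n Set.univ := by
  have := h.isProbabilityMeasure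
  -- the good set for `ε` contains the one for a finer regularisation, whose error is small
  obtain ⟨ε₀, hε₀, hεs⟩ := h.regPot_approx (η / 16) (by positivity)
  have hε' : 0 < min ε ε₀ := lt_min hε hε₀
  obtain ⟨C, n₀, hC⟩ := h.exists_mass_le hβ hε' (hεs _ hε' (min_le_right _ _))
  obtain ⟨C', hC'⟩ := h.exists_le_mass_univ hβ (by positivity : 0 < β * η / 16)
  refine ⟨β * η / 16, by positivity, ?_⟩
  filter_upwards [eventually_ge_atTop n₀,
    (tendsto_quadratic_atTop (by positivity : 0 < β * η / 16) (-(C + C')) 0).eventually_ge_atTop 0]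
    with n hn hq
  refine (hC n hn η _ (h.measurableSet_goodSet hε η n).compl fun l hl _ => ?_).trans ?_
  · have h1 := discr_antitone h.hasLogMoment l hε' (min_le_left ε ε₀)
    simp only [goodSet, Set.mem_compl_iff, Set.mem_ofPred_eq, not_le] at hl
    linarith
  · refine le_trans ?_ (mul_le_mul_right (hC' n) _)
    rw [← ENNReal.ofReal_mul (Real.exp_pos _).le, ← Real.exp_add]
    refine ENNReal.ofReal_le_ofReal (Real.exp_le_exp.2 ?_)
    nlinarith

/-- It is super-exponentially unlikely that no point lies to the right of `a`, if the equilibrium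
measure charges `(a, ∞)`. -/
lemma exists_mass_forall_le_le (h : IsRegularEquilibrium V S μ ℓ) {β a : ℝ} (hβ : 0 < β)
    (ha : μ (Set.Ioi a) ≠ 0) :
    ∃ c > 0, ∀ᶠ n : ℕ in atTop, mass β V S n {l | ∀ i, l i ≤ a} ≤
      ENNReal.ofReal (Real.exp (-c * n ^ 2)) * mass β V S n Set.univ := by
  have := h.isProbabilityMeasure
  obtain ⟨ε, hε, c', hc', hsep⟩ := exists_le_discr_of_forall_le h.hasLogMoment ha
  obtain ⟨c, hc, hev⟩ := h.exists_mass_compl_goodSet_le hβ hε (half_pos hc')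
  refine ⟨c, hc, ?_⟩
  filter_upwards [hev, eventually_gt_atTop 0] with n hn hn0
  refine le_trans (mass_le_of_forall_mem (B := (goodSet V μ ℓ ε (c' / 2) n)ᶜ)
    h.isClosed.measurableSet ?_) hn
  intro l hl hla hgood
  have h1 := hsep n l hla
  have h2 : 0 ≤ ∑ j, excess V μ ℓ (l j) := Finset.sum_nonneg fun j _ => h.excess_nonneg (hl j)
  have h3 : (0 : ℝ) < n := by exact_mod_cast hn0
  simp only [goodSet, Set.mem_ofPred_eq] at hgood
  have h4 : 0 < c' * (n : ℝ) ^ 2 := by positivity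
  nlinarith

lemma eventually_mass_compl_goodSet_le (h : IsRegularEquilibrium V S μ ℓ) {β ε η : ℝ} (hβ : 0 < β)
    (hε : 0 < ε) (hη : 0 < η) :
    ∀ᶠ n : ℕ in atTop, mass β V S n (goodSet V μ ℓ ε η n)ᶜ ≤
      ENNReal.ofReal (1 / 4) * mass β V S n Set.univ := by
  obtain ⟨c, hc, hev⟩ := h.exists_mass_compl_goodSet_le hβ hε hη
  have h1 : ∀ᶠ n : ℕ in atTop, 4 * Real.exp (-c * n ^ 2) ≤ Real.exp 0 := by
    refine eventually_mul_exp_le (f := fun n : ℕ => -c * (n : ℝ) ^ 2) (g := fun _ => 0) ?_ 4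
    refine (tendsto_quadratic_atTop hc 0 0).congr fun n => ?_
    ring
  filter_upwards [hev, h1] with n hn hn1
  refine hn.trans ?_
  gcongr
  rw [Real.exp_zero] at hn1
  linarith

end IsRegularEquilibrium

/-- If the complement of `A` is covered by sets carrying at most half of the total mass, `A`
carries at least half of it. -/
lemma mass_univ_le_two_mul {β : ℝ} {V : ℝ → ℝ} {S : Set ℝ} {n : ℕ} {A B C : Set (Fin n → ℝ)}
    (hABC : Set.univ ⊆ A ∪ (B ∪ C)) (htop : mass β V S n Set.univ ≠ ⊤)
    (hB : mass β V S n B ≤ ENNReal.ofReal (1 / 4) * mass β V S n Set.univ)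
    (hC : mass β V S n C ≤ ENNReal.ofReal (1 / 4) * mass β V S n Set.univ) :
    mass β V S n Set.univ ≤ 2 * mass β V S n A := by
  have h2 : mass β V S n Set.univ ≤ mass β V S n A + (ENNReal.ofReal (1 / 4) *
      mass β V S n Set.univ + ENNReal.ofReal (1 / 4) * mass β V S n Set.univ) :=
    (mass_mono hABC).trans ((mass_union_le _ _).trans
      (add_le_add le_rfl ((mass_union_le _ _).trans (add_le_add hB hC))))
  have hAtop : mass β V S n A ≠ ⊤ := ne_top_of_le_ne_top htop (mass_mono (Set.subset_univ _))
  rw [← ENNReal.ofReal_toReal htop, ← ENNReal.ofReal_toReal hAtop] at h2 ⊢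
  rw [← ENNReal.ofReal_mul (by norm_num), ← ENNReal.ofReal_add (by positivity) (by positivity),
    ← ENNReal.ofReal_add (by positivity) (by positivity),
    ENNReal.ofReal_le_ofReal_iff (by positivity)] at h2
  rw [show (2 : ENNReal) = ENNReal.ofReal 2 by simp, ← ENNReal.ofReal_mul (by norm_num)]
  exact ENNReal.ofReal_le_ofReal (by linarith)

/-! ### Adding one point -/

/-- The exponential rate, divided by `β`, at which the partition function changes when the
`(n + 1)`-st point is added. -/
def insertionRate (μ : Measure ℝ) (ℓ : ℝ) (n : ℕ) : ℝ :=
  -(n + 1) * ℓ + n * ((∫ y, logPot μ y ∂μ) - ℓ)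

namespace IsRegularEquilibrium

variable {V : ℝ → ℝ} {S : Set ℝ} {μ : Measure ℝ} {ℓ : ℝ}

/-- The lower bound for the growth of the total mass: the new point is integrated with Jensen's
inequality against a measure of bounded density close to `μ`. -/
lemma eventually_le_mass_succ (h : IsRegularEquilibrium V S μ ℓ) {β τ : ℝ} (hβ : 0 < β)
    (hτ : 0 < τ) :
    ∀ᶠ n : ℕ in atTop, ENNReal.ofReal (Real.exp (β * (insertionRate μ ℓ n - τ * n))) *
      mass β V S n Set.univ ≤ mass β V S (n + 1) Set.univ := by
  have := h.isProbabilityMeasure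
  have hVm := h.continuous_potential.measurable
  obtain ⟨ρ, M, hρ, hM, hle, ⟨A, hA⟩, hlog, hpot, hVρ, -⟩ :=
    h.exists_smooth_approx (by positivity : 0 < τ / 8)
  obtain ⟨η, hη, hgood⟩ := h.exists_good_potential one_pos (by positivity : 0 < τ / 8) 0
  set c₀ := ∫ y, logPot μ y ∂μ
  have hlim := eventually_mul_exp_le
    (f := fun n : ℕ => β * (insertionRate μ ℓ n - τ * n))
    (g := fun n : ℕ => β * (insertionRate μ ℓ n - τ / 2 * n + c₀ - τ / 8))
    ((tendsto_linear_atTop (by positivity : 0 < β * (τ / 2)) (β * (c₀ - τ / 8))).congr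
      fun n => by ring) (2 * M)
  filter_upwards [hlim, h.eventually_mass_compl_goodSet_le hβ one_pos hη,
    h.eventually_mass_univ_ne_top hβ] with n hn hbad htop
  set G := goodSet V μ ℓ 1 η n
  have hG : MeasurableSet G := h.measurableSet_goodSet one_pos η n
  have hhalf : mass β V S n Set.univ ≤ 2 * mass β V S n G :=
    mass_univ_le_two_mul (B := Gᶜ) (C := Gᶜ) (by simp) htop hbad hbad
  set K := β * (insertionRate μ ℓ n - τ / 2 * n + c₀ - τ / 8)
  -- the new point, integrated over `S` in the field of a good configuration
  have hpoint : ∀ l ∈ G, (∀ i, l i ∈ S) → ENNReal.ofReal (Real.exp K) ≤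
      ENNReal.ofReal M * ∫⁻ x in S, ENNReal.ofReal (insertionFactor β V x l) := by
    intro l hlG hl
    have hW : Integrable (fun x => (n + 1 : ℝ) * β / 2 * V x) ρ :=
      (integrable_of_bounded hA h.continuous_potential).const_mul _
    have h1 := le_lintegral_exp_mul_prod (β := β) hle hlog hW l
    have hm : Measurable fun x => ENNReal.ofReal
        (Real.exp (-((n + 1 : ℝ) * β / 2 * V x)) * ∏ j, |x - l j| ^ β) := by fun_prop
    have e : ∀ x, ENNReal.ofReal (insertionFactor β V x l) = ENNReal.ofReal
        (Real.exp (-((n + 1 : ℝ) * β / 2 * V x)) * ∏ j, |x - l j| ^ β) *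
        ENNReal.ofReal (Real.exp (-∑ j, β / 2 * V (l j))) := fun x => by
      rw [insertionFactor, ENNReal.ofReal_mul (by positivity)]
    simp only [e]
    rw [lintegral_mul_const _ hm, ← mul_assoc]
    refine le_trans ?_ (mul_le_mul_left h1 _)
    rw [← ENNReal.ofReal_mul (Real.exp_pos _).le, ← Real.exp_add]
    refine ENNReal.ofReal_le_ofReal (Real.exp_le_exp.2 ?_)
    obtain ⟨-, h2⟩ := hgood n 0 l (by simp) hl hlG
    have h3 := sum_potential V μ ℓ l
    have h4 : ∑ j, logPot ρ (l j) ≤ ∑ j, logPot μ (l j) + n * (τ / 8) := by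
      have := Finset.sum_le_sum fun i (_ : i ∈ Finset.univ) => hpot (l i)
      simpa [Finset.sum_add_distrib] using this
    rw [h.integral_potential] at hVρ
    rw [integral_const_mul, ← Finset.mul_sum, h3]
    have hn0 : (0 : ℝ) ≤ n := n.cast_nonneg
    have h5 := mul_le_mul_of_nonneg_left hVρ (by positivity : 0 ≤ (n + 1 : ℝ) * β / 2)
    have h6 := mul_le_mul_of_nonneg_left h4 hβ.le
    have h7 := mul_le_mul_of_nonneg_left h2 hβ.le
    have h8 : 0 ≤ β * τ * n := by positivity
    have h9 : 0 ≤ β * τ := by positivity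
    simp only [K, insertionRate]
    change _ ≤ _
    nlinarith
  have hM0 : ENNReal.ofReal M ≠ 0 := by simpa using hM
  rw [← ENNReal.mul_le_mul_iff_right hM0 ENNReal.ofReal_ne_top]
  calc ENNReal.ofReal M * (ENNReal.ofReal (Real.exp (β * (insertionRate μ ℓ n - τ * n))) *
        mass β V S n Set.univ)
      ≤ ENNReal.ofReal M * (ENNReal.ofReal (Real.exp (β * (insertionRate μ ℓ n - τ * n))) *
        (2 * mass β V S n G)) := by gcongr
    _ = ENNReal.ofReal (2 * M * Real.exp (β * (insertionRate μ ℓ n - τ * n))) *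
        mass β V S n G := by
      rw [ENNReal.ofReal_mul (by positivity), ENNReal.ofReal_mul (by norm_num), ENNReal.ofReal_ofNat]
      ring
    _ ≤ ENNReal.ofReal (Real.exp K) * mass β V S n G := by gcongr
    _ = ∫⁻ l in G, ENNReal.ofReal (Real.exp K) * ENNReal.ofReal (weight β V n l)
          ∂(boxMeasure S n) := by
      rw [lintegral_const_mul' _ _ ENNReal.ofReal_ne_top, mass]
    _ ≤ ∫⁻ l in G, ENNReal.ofReal M * ((∫⁻ x in S, ENNReal.ofReal (insertionFactor β V x l)) *
          ENNReal.ofReal (weight β V n l)) ∂(boxMeasure S n) := by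
      refine lintegral_mono_ae ?_
      filter_upwards [ae_restrict_mem hG,
        ae_restrict_of_ae (ae_mem_box h.isClosed.measurableSet n)] with l hlG hl
      rw [← mul_assoc]
      exact mul_le_mul_left (hpoint l hlG hl) _
    _ ≤ ENNReal.ofReal M * mass β V S (n + 1) Set.univ := by
      rw [lintegral_const_mul' _ _ ENNReal.ofReal_ne_top, mass_succ_univ_swap β hVm]
      exact mul_le_mul_right (setLIntegral_le_lintegral _ _) _

lemma lintegral_exp_neg_two_log_ne_top :
    ∫⁻ x : ℝ, ENNReal.ofReal (Real.exp (-2 * Real.log (1 + |x|))) ≠ ⊤ := by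
  have hi : Integrable fun x : ℝ => (1 + ‖x‖) ^ (-2 : ℝ) := integrable_one_add_norm (by simp)
  have e : ∀ x : ℝ, Real.exp (-2 * Real.log (1 + |x|)) = (1 + ‖x‖) ^ (-2 : ℝ) := fun x => by
    rw [Real.norm_eq_abs, Real.rpow_def_of_pos (by positivity), mul_comm]
  simp only [e]
  exact hi.lintegral_lt_top.ne

/-- The mass of the configurations with their first point in a set where the effective potential
is large: the first point is integrated against the almost deterministic potential created by the
others. -/
lemma eventually_mass_coord_le (h : IsRegularEquilibrium V S μ ℓ) {β τ c : ℝ} (hβ : 0 < β)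
    (hτ : 0 < τ) {T : Set ℝ} (hT : MeasurableSet T)
    (hc : ∀ x ∈ T, x ∈ S → c ≤ β * excess V μ ℓ x) :
    ∀ᶠ n : ℕ in atTop, mass β V S (n + 1) {l | l 0 ∈ T} ≤
      ENNReal.ofReal (Real.exp (β * (insertionRate μ ℓ n + τ * n) - (n + 1) * c)) *
        mass β V S n Set.univ := by
  have hVm := h.continuous_potential.measurable
  obtain ⟨δ, hδ, C, hcrude⟩ := h.exists_insertionFactor_le hβ
  set c₀ := ∫ y, logPot μ y ∂μ
  set σ := β * (-ℓ + (c₀ - ℓ) + τ) - c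
  -- beyond `R`, the crude bound for the insertion of a point suffices
  obtain ⟨R, hR0, hR⟩ : ∃ R : ℝ, 0 < R ∧ β * (C - δ / 2 * Real.log (1 + R)) < σ := by
    refine ⟨Real.exp (|C - σ / β| * (2 / δ) + 1), Real.exp_pos _, ?_⟩
    have h1 : |C - σ / β| * (2 / δ) + 1 ≤
        Real.log (1 + Real.exp (|C - σ / β| * (2 / δ) + 1)) := by
      rw [Real.le_log_iff_exp_le (by positivity)]
      linarith
    have h2 := mul_le_mul_of_nonneg_left h1 (by positivity : 0 ≤ δ / 2)
    have h3 : δ / 2 * (|C - σ / β| * (2 / δ) + 1) = |C - σ / β| + δ / 2 := by field_simp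
    have h4 : C - δ / 2 * Real.log (1 + Real.exp (|C - σ / β| * (2 / δ) + 1)) < σ / β := by
      have := le_abs_self (C - σ / β)
      linarith
    have h5 := mul_lt_mul_of_pos_left h4 hβ
    rwa [mul_div_cancel₀ _ hβ.ne'] at h5
  obtain ⟨ε, hε, η, hη, C₂, hgood⟩ :=
    h.exists_insertionFactor_good_le hβ (by positivity : 0 < τ / 2) R
  obtain ⟨κ, hκ, hconc⟩ := h.exists_mass_compl_goodSet_le hβ hε hη
  set q : ℝ → ENNReal := fun x => ENNReal.ofReal (Real.exp (-2 * Real.log (1 + |x|)))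
  set Q := ∫⁻ x, q x
  have hQ : Q ≠ ⊤ := lintegral_exp_neg_two_log_ne_top
  have hqm : Measurable q := by fun_prop
  set g : ℕ → ℝ := fun n => β * (insertionRate μ ℓ n + τ * n) - (n + 1) * c
  have hg : ∀ n, g n = σ * n + (-β * ℓ - c) := fun n => by
    simp only [g, σ, insertionRate]; ring
  -- the exponents for a bounded new point in the field of a good configuration, for a bounded new
  -- point in the field of a bad one, and for a new point beyond `R`
  set f₁ : ℕ → ℝ := fun n => β * (insertionRate μ ℓ n + τ / 2 * n + C₂) - (n + 1) * c
  set f₂ : ℕ → ℝ := fun n => β * (n + 1) * C - κ * n ^ 2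
  set f₃ : ℕ → ℝ := fun n => β * (n + 1) * (C - δ / 2 * Real.log (1 + R))
  have l₁ := eventually_mul_exp_le (f := f₁) (g := g)
    ((tendsto_linear_atTop (by positivity : 0 < β * (τ / 2)) (-(β * C₂))).congr
      fun n => by simp only [g, f₁]; ring) (3 * (2 * R))
  have l₂ := eventually_mul_exp_le (f := f₂) (g := g)
    ((tendsto_quadratic_atTop hκ (σ - β * C) (-β * ℓ - c - β * C)).congr
      fun n => by simp only [hg, f₂]; ring) (3 * Q.toReal)
  have l₃ := eventually_mul_exp_le (f := f₃) (g := g)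
    ((tendsto_linear_atTop (sub_pos.2 hR) (-β * ℓ - c -
      β * (C - δ / 2 * Real.log (1 + R)))).congr
      fun n => by simp only [hg, f₃]; ring) (3 * Q.toReal)
  have l₄ := (tendsto_linear_atTop (by positivity : 0 < β * δ / 2) (β * δ / 2)).eventually_ge_atTop 2
  filter_upwards [l₁, l₂, l₃, l₄, hconc] with n h₁ h₂ h₃ h₄ hbad
  set Z := mass β V S n Set.univ
  set G := goodSet V μ ℓ ε η n
  have hG : MeasurableSet G := h.measurableSet_goodSet hε η n
  set E₁ := ENNReal.ofReal (Real.exp (f₁ n))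
  set E₂ := ENNReal.ofReal (Real.exp (f₂ n))
  set E₃ := ENNReal.ofReal (Real.exp (f₃ n))
  have hcr : ∀ (x : ℝ) (B : Set (Fin n → ℝ)), ∫⁻ l in B, ENNReal.ofReal (insertionFactor β V x l) *
      ENNReal.ofReal (weight β V n l) ∂(boxMeasure S n) ≤
      ENNReal.ofReal (Real.exp (β * (n + 1) * (C - δ * Real.log (1 + |x|)))) * mass β V S n B := by
    intro x B
    rw [mass, ← lintegral_const_mul' _ _ ENNReal.ofReal_ne_top]
    exact lintegral_mono fun l => mul_le_mul_left (ENNReal.ofReal_le_ofReal (hcrude n x l)) _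
  have hinner : ∀ x ∈ S, x ∈ T → ∫⁻ l, ENNReal.ofReal (insertionFactor β V x l) *
      ENNReal.ofReal (weight β V n l) ∂(boxMeasure S n) ≤
      (Set.Icc (-R) R).indicator (fun _ => E₁ * Z) x + q x * ((E₂ + E₃) * Z) := by
    intro x hxS hxT
    have hL := log_one_add_abs_nonneg x
    rcases le_or_gt |x| R with hxR | hxR
    · rw [Set.indicator_of_mem (show x ∈ Set.Icc (-R) R from abs_le.1 hxR)]
      rw [← lintegral_add_compl _ hG]
      refine add_le_add ?_ ?_
      · calc _ ≤ ∫⁻ l in G, E₁ * ENNReal.ofReal (weight β V n l) ∂(boxMeasure S n) := by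
              refine lintegral_mono_ae ?_
              filter_upwards [ae_restrict_mem hG,
                ae_restrict_of_ae (ae_mem_box h.isClosed.measurableSet n)] with l hlG hl
              refine mul_le_mul_left (ENNReal.ofReal_le_ofReal
                ((hgood n x l hxR hl hlG).trans (Real.exp_le_exp.2 ?_))) _
              have h5 := mul_le_mul_of_nonneg_left (hc x hxT hxS) (by positivity : 0 ≤ (n + 1 : ℝ))
              simp only [f₁, insertionRate]
              change _ ≤ _
              nlinarith
          _ = E₁ * mass β V S n G := by rw [lintegral_const_mul' _ _ ENNReal.ofReal_ne_top, mass]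
          _ ≤ E₁ * Z := by gcongr; exact mass_mono (Set.subset_univ _)
      · calc _ ≤ _ := hcr x Gᶜ
          _ ≤ ENNReal.ofReal (Real.exp (β * (n + 1) * (C - δ * Real.log (1 + |x|)))) *
              (ENNReal.ofReal (Real.exp (-κ * n ^ 2)) * Z) := by gcongr
          _ ≤ q x * (E₂ * Z) := by
              simp only [q, E₂]
              rw [← mul_assoc, ← mul_assoc, ← ENNReal.ofReal_mul (Real.exp_pos _).le,
                ← ENNReal.ofReal_mul (Real.exp_pos _).le, ← Real.exp_add, ← Real.exp_add]
              refine mul_le_mul_left (ENNReal.ofReal_le_ofReal (Real.exp_le_exp.2 ?_)) _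
              have h6 := mul_le_mul_of_nonneg_right h₄ hL
              have h7 : 0 ≤ β * δ * (n + 1) * Real.log (1 + |x|) := by positivity
              simp only [f₂]
              nlinarith
          _ ≤ q x * ((E₂ + E₃) * Z) := by gcongr; exact le_self_add
    · rw [Set.indicator_of_notMem (show x ∉ Set.Icc (-R) R from
        fun hx => absurd (abs_le.2 hx) (not_le.2 hxR)), zero_add]
      calc _ ≤ ENNReal.ofReal (Real.exp (β * (n + 1) * (C - δ * Real.log (1 + |x|)))) * Z := by
            have := hcr x Set.univ
            rwa [Measure.restrict_univ] at this
        _ ≤ q x * (E₃ * Z) := by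
            simp only [q, E₃]
            rw [← mul_assoc, ← ENNReal.ofReal_mul (Real.exp_pos _).le, ← Real.exp_add]
            refine mul_le_mul_left (ENNReal.ofReal_le_ofReal (Real.exp_le_exp.2 ?_)) _
            have h6 := mul_le_mul_of_nonneg_right h₄ hL
            have h7 : Real.log (1 + R) ≤ Real.log (1 + |x|) :=
              Real.log_le_log (by positivity) (by linarith)
            have h8 := mul_le_mul_of_nonneg_left h7 (by positivity : 0 ≤ β * (n + 1) * (δ / 2))
            simp only [f₃]
            nlinarith
        _ ≤ q x * ((E₂ + E₃) * Z) := by gcongr; exact le_add_self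
  have hA : MeasurableSet {l : Fin (n + 1) → ℝ | l 0 ∈ T} := measurable_pi_apply 0 hT
  rw [mass_succ β hVm S n hA]
  calc _ ≤ ∫⁻ x in S, ((Set.Icc (-R) R).indicator (fun _ => E₁ * Z) x + q x * ((E₂ + E₃) * Z)) := by
        refine setLIntegral_mono' h.isClosed.measurableSet fun x hx => ?_
        by_cases hxT : x ∈ T
        · exact (setLIntegral_le_lintegral _ _).trans (hinner x hx hxT)
        · simp [hxT]
    _ ≤ ∫⁻ x, ((Set.Icc (-R) R).indicator (fun _ => E₁ * Z) x + q x * ((E₂ + E₃) * Z)) :=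
        setLIntegral_le_lintegral _ _
    _ = E₁ * Z * ENNReal.ofReal (2 * R) + Q * ((E₂ + E₃) * Z) := by
        rw [lintegral_add_right _ (hqm.mul_const _), lintegral_mul_const _ hqm,
          lintegral_indicator measurableSet_Icc, setLIntegral_const, Real.volume_Icc]
        congr 3
        ring
    _ = ENNReal.ofReal (2 * R * Real.exp (f₁ n) + Q.toReal * Real.exp (f₂ n) +
          Q.toReal * Real.exp (f₃ n)) * Z := by
        rw [ENNReal.ofReal_add (by positivity) (by positivity),
          ENNReal.ofReal_add (by positivity) (by positivity),
          ENNReal.ofReal_mul (p := 2 * R) (q := Real.exp (f₁ n)) (by positivity),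
          ENNReal.ofReal_mul (p := Q.toReal) (q := Real.exp (f₂ n)) (by positivity),
          ENNReal.ofReal_mul (p := Q.toReal) (q := Real.exp (f₃ n)) (by positivity),
          ENNReal.ofReal_toReal hQ]
        ring
    _ ≤ _ := by
        gcongr
        change _ ≤ Real.exp (g n)
        linarith

/-- The mass of the configurations whose first point lies in `[u, v]`, to the right of all the
other points. -/
lemma eventually_le_mass_coord (h : IsRegularEquilibrium V S μ ℓ) {β τ e p u v : ℝ} (hβ : 0 < β)
    (hτ : 0 < τ) (huv : u < v) (hpu : p < u) (hS : Set.Icc u v ⊆ S)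
    (he : ∀ x ∈ Set.Icc u v, excess V μ ℓ x ≤ e)
    (hp : ∀ᶠ n : ℕ in atTop, mass β V S n {l | ∃ i, l i ∈ Set.Ioi p} ≤
      ENNReal.ofReal (1 / 4) * mass β V S n Set.univ) :
    ∀ᶠ n : ℕ in atTop,
      ENNReal.ofReal (Real.exp (β * (insertionRate μ ℓ n - τ * n) - (n + 1) * (β * e))) *
        mass β V S n Set.univ ≤
      mass β V S (n + 1) {l | l 0 ∈ Set.Icc u v ∧ ∀ j : Fin n, l j.succ ≤ p} := by
  have hVm := h.continuous_potential.measurable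
  obtain ⟨ε, hε, η, hη, C, hgood⟩ := h.exists_le_insertionFactor_good hβ
    (by positivity : 0 < τ / 2) (sub_pos.2 hpu) (max |u| |v|)
  have hlim := eventually_mul_exp_le
    (f := fun n : ℕ => β * (insertionRate μ ℓ n - τ * n) - (n + 1) * (β * e))
    (g := fun n : ℕ => β * (insertionRate μ ℓ n - τ / 2 * n - C) - (n + 1) * (β * e))
    ((tendsto_linear_atTop (by positivity : 0 < β * (τ / 2)) (-(β * C))).congr
      fun n => by ring) (2 / (v - u))
  filter_upwards [hlim, h.eventually_mass_compl_goodSet_le hβ hε hη,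
    h.eventually_mass_univ_ne_top hβ, hp] with n hn hbad htop hpn
  set G := goodSet V μ ℓ ε η n ∩ {l | ∀ j, l j ≤ p}
  have hG : MeasurableSet G :=
    (h.measurableSet_goodSet hε η n).inter (by
      have : {l : Fin n → ℝ | ∀ j, l j ≤ p} = ⋂ j, {l | l j ≤ p} := by ext; simp
      rw [this]
      exact MeasurableSet.iInter fun j => measurableSet_le (measurable_pi_apply j) measurable_const)
  -- half of the mass is carried by the good configurations to the left of `p`
  have hhalf : mass β V S n Set.univ ≤ 2 * mass β V S n G := by
    refine mass_univ_le_two_mul (fun l _ => ?_) htop hbad hpn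
    by_cases h1 : l ∈ goodSet V μ ℓ ε η n
    · by_cases h2 : ∀ j, l j ≤ p
      · exact Or.inl ⟨h1, h2⟩
      · push Not at h2
        exact Or.inr (Or.inr h2)
    · exact Or.inr (Or.inl h1)
  set K := β * (insertionRate μ ℓ n - τ / 2 * n - C) - (n + 1) * (β * e)
  have hA : MeasurableSet {l : Fin (n + 1) → ℝ | l 0 ∈ Set.Icc u v ∧ ∀ j : Fin n, l j.succ ≤ p} := by
    have e1 : {l : Fin (n + 1) → ℝ | l 0 ∈ Set.Icc u v ∧ ∀ j : Fin n, l j.succ ≤ p} =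
      {l | l 0 ∈ Set.Icc u v} ∩ ⋂ j : Fin n, {l | l j.succ ≤ p} := by ext; simp
    rw [e1]
    exact (measurable_pi_apply 0 measurableSet_Icc).inter
      (MeasurableSet.iInter fun j => measurableSet_le (measurable_pi_apply _) measurable_const)
  rw [mass_succ β hVm S n hA]
  have hinner : ∀ x ∈ Set.Icc u v, ENNReal.ofReal (Real.exp K) * mass β V S n G ≤
      ∫⁻ l in {l : Fin n → ℝ | (Fin.cons x l : Fin (n + 1) → ℝ) ∈
        {l : Fin (n + 1) → ℝ | l 0 ∈ Set.Icc u v ∧ ∀ j : Fin n, l j.succ ≤ p}},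
      ENNReal.ofReal (insertionFactor β V x l) * ENNReal.ofReal (weight β V n l)
        ∂(boxMeasure S n) := by
    intro x hx
    have hsub : G ⊆ {l : Fin n → ℝ | (Fin.cons x l : Fin (n + 1) → ℝ) ∈
        {l : Fin (n + 1) → ℝ | l 0 ∈ Set.Icc u v ∧ ∀ j : Fin n, l j.succ ≤ p}} :=
      fun l hl => ⟨by simpa using hx, fun j => by simpa using hl.2 j⟩
    refine le_trans ?_ (lintegral_mono_set hsub)
    rw [mass, ← lintegral_const_mul' _ _ ENNReal.ofReal_ne_top]
    refine lintegral_mono_ae ?_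
    filter_upwards [ae_restrict_mem hG,
      ae_restrict_of_ae (ae_mem_box h.isClosed.measurableSet n)] with l hlG hl
    have hxR : |x| ≤ max |u| |v| := abs_le_max_abs_abs hx.1 hx.2
    have hdist : ∀ j, u - p ≤ |x - l j| := fun j =>
      le_trans (by linarith [hlG.2 j, hx.1]) (le_abs_self _)
    refine mul_le_mul_left (ENNReal.ofReal_le_ofReal
      (le_trans (Real.exp_le_exp.2 ?_) (hgood n x l hxR hl hlG.1 hdist))) _
    have h5 := mul_le_mul_of_nonneg_left (he x hx) (by positivity : 0 ≤ (n + 1 : ℝ) * β)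
    simp only [K, insertionRate]
    nlinarith
  have hvu : 0 < v - u := sub_pos.2 huv
  calc _ ≤ ENNReal.ofReal (Real.exp (β * (insertionRate μ ℓ n - τ * n) - (n + 1) * (β * e))) *
        (2 * mass β V S n G) := by gcongr
    _ = ENNReal.ofReal (v - u) * (ENNReal.ofReal (2 / (v - u) *
          Real.exp (β * (insertionRate μ ℓ n - τ * n) - (n + 1) * (β * e))) *
        mass β V S n G) := by
        generalize β * (insertionRate μ ℓ n - τ * n) - (n + 1) * (β * e) = y
        rw [← mul_assoc, ← mul_assoc, ← ENNReal.ofReal_mul hvu.le,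
          show (v - u) * (2 / (v - u) * Real.exp y) = Real.exp y * 2 by field_simp,
          ENNReal.ofReal_mul (Real.exp_pos _).le, ENNReal.ofReal_ofNat]
    _ ≤ ENNReal.ofReal (v - u) * (ENNReal.ofReal (Real.exp K) * mass β V S n G) := by gcongr
    _ = ∫⁻ x in Set.Icc u v, ENNReal.ofReal (Real.exp K) * mass β V S n G := by
        rw [setLIntegral_const, Real.volume_Icc, mul_comm]
    _ ≤ _ := (setLIntegral_mono' measurableSet_Icc hinner).trans (lintegral_mono_set hS)

end IsRegularEquilibrium

/-! ### Probabilities of deviations of single points -/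

lemma measurable_lambdaMax (n : ℕ) : Measurable (lambdaMax : (Fin n → ℝ) → ℝ) :=
  Measurable.iSup fun i => measurable_pi_apply i

lemma le_lambdaMax {n : ℕ} (l : Fin n → ℝ) (i : Fin n) : l i ≤ lambdaMax l :=
  le_ciSup (Set.finite_range l).bddAbove i

lemma exists_eq_lambdaMax {n : ℕ} (hn : 0 < n) (l : Fin n → ℝ) : ∃ i, l i = lambdaMax l := by
  have : Nonempty (Fin n) := ⟨⟨0, hn⟩⟩
  exact exists_eq_ciSup_of_finite

lemma measurableSet_exists_mem (n : ℕ) {T : Set ℝ} (hT : MeasurableSet T) :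
    MeasurableSet {l : Fin n → ℝ | ∃ i, l i ∈ T} := by
  have e : {l : Fin n → ℝ | ∃ i, l i ∈ T} = ⋃ i, (fun l => l i) ⁻¹' T := by ext; simp
  rw [e]
  exact MeasurableSet.iUnion fun i => measurable_pi_apply i hT

lemma measurableSet_forall_mem (n : ℕ) {T : Set ℝ} (hT : MeasurableSet T) :
    MeasurableSet {l : Fin n → ℝ | ∀ i, l i ∈ T} := by
  have e : {l : Fin n → ℝ | ∀ i, l i ∈ T} = ⋂ i, (fun l => l i) ⁻¹' T := by ext; simp
  rw [e]
  exact MeasurableSet.iInter fun i => measurable_pi_apply i hT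

lemma eigenvalueLaw_le_iff {β : ℝ} {V : ℝ → ℝ} {S : Set ℝ} {n : ℕ} {A : Set (Fin n → ℝ)}
    (hA : MeasurableSet A) (h0 : mass β V S n Set.univ ≠ 0) (htop : mass β V S n Set.univ ≠ ⊤)
    (K : ENNReal) :
    eigenvalueLaw β V S n A ≤ K ↔ mass β V S n A ≤ K * mass β V S n Set.univ := by
  rw [eigenvalueLaw_apply _ _ _ _ hA, ENNReal.inv_mul_le_iff h0 htop, mul_comm]

lemma le_eigenvalueLaw_iff {β : ℝ} {V : ℝ → ℝ} {S : Set ℝ} {n : ℕ} {A : Set (Fin n → ℝ)}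
    (hA : MeasurableSet A) (h0 : mass β V S n Set.univ ≠ 0) (htop : mass β V S n Set.univ ≠ ⊤)
    (K : ENNReal) :
    K ≤ eigenvalueLaw β V S n A ↔ K * mass β V S n Set.univ ≤ mass β V S n A := by
  rw [eigenvalueLaw_apply _ _ _ _ hA, mul_comm (mass β V S n Set.univ)⁻¹, ← div_eq_mul_inv,
    ENNReal.le_div_iff_mul_le (Or.inl h0) (Or.inl htop)]

lemma eigenvalueLaw_le_one (β : ℝ) (V : ℝ → ℝ) (S : Set ℝ) (n : ℕ) (A : Set (Fin n → ℝ)) :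
    eigenvalueLaw β V S n A ≤ 1 := by
  refine (measure_mono (Set.subset_univ A)).trans ?_
  rw [eigenvalueLaw_apply _ _ _ _ MeasurableSet.univ]
  exact ENNReal.inv_mul_le_one _

/-- A statement about all large `n` follows from the statement about all large `n + 1`. -/
lemma eventually_of_eventually_succ {p : ℕ → Prop} (h : ∀ᶠ n in atTop, p (n + 1)) :
    ∀ᶠ n in atTop, p n := by
  rw [← map_add_atTop_eq_nat 1]
  exact h

namespace IsRegularEquilibrium

variable {V : ℝ → ℝ} {S : Set ℝ} {μ : Measure ℝ} {ℓ : ℝ}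

/-- It is exponentially unlikely that a point lies where the effective potential is large. -/
lemma eventually_eigenvalueLaw_exists_le (h : IsRegularEquilibrium V S μ ℓ) {β τ c : ℝ}
    (hβ : 0 < β) (hτ : 0 < τ) {T : Set ℝ} (hT : MeasurableSet T)
    (hc : ∀ x ∈ T, x ∈ S → c ≤ β * excess V μ ℓ x) :
    ∀ᶠ n : ℕ in atTop, eigenvalueLaw β V S n {l | ∃ i, l i ∈ T} ≤
      ENNReal.ofReal (Real.exp (-(n * (c - τ)))) := by
  have hVm := h.continuous_potential.measurable
  refine eventually_of_eventually_succ ?_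
  set σ := τ / (4 * β)
  have hσ : 0 < σ := by positivity
  have hβσ : β * σ = τ / 4 := by simp only [σ]; field_simp
  have htop : ∀ᶠ n : ℕ in atTop, mass β V S (n + 1) Set.univ ≠ ⊤ :=
    (tendsto_add_atTop_nat 1).eventually (h.eventually_mass_univ_ne_top hβ)
  -- the polynomial factor coming from the choice of the point is absorbed by `exp (τ n / 2)`
  have hpoly : ∀ᶠ n : ℕ in atTop, ((n : ℝ) + 1) ≤ Real.exp (τ / 2 * n) := by
    have h1 : Tendsto (fun n : ℕ => Real.exp (τ / 4 * n)) atTop atTop :=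
      Real.tendsto_exp_atTop.comp (tendsto_natCast_atTop_atTop.const_mul_atTop (by positivity))
    filter_upwards [h1.eventually_ge_atTop (4 / τ), h1.eventually_ge_atTop 1] with n h2 h3
    have h4 := Real.add_one_le_exp (τ / 4 * n)
    have h5 : Real.exp (τ / 2 * n) = Real.exp (τ / 4 * n) * Real.exp (τ / 4 * n) := by
      rw [← Real.exp_add]; ring_nf
    rw [h5]
    by_cases hτ4 : 4 / τ ≤ 1
    · have h6 : 1 ≤ τ / 4 := by
        rw [div_le_one hτ] at hτ4
        linarith
      have h7 : (n : ℝ) ≤ τ / 4 * n := le_mul_of_one_le_left (by positivity) h6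
      nlinarith
    · have h6 : (4 / τ) * Real.exp (τ / 4 * n) ≤ Real.exp (τ / 4 * n) * Real.exp (τ / 4 * n) :=
        mul_le_mul_of_nonneg_right h2 (Real.exp_pos _).le
      have h7 : (4 / τ) * (τ / 4 * n + 1) ≤ (4 / τ) * Real.exp (τ / 4 * n) :=
        mul_le_mul_of_nonneg_left h4 (by positivity)
      have h8 : (4 / τ) * (τ / 4 * n + 1) = n + 4 / τ := by field_simp
      linarith
  filter_upwards [htop, hpoly, h.eventually_mass_coord_le hβ hσ hT hc,
    h.eventually_le_mass_succ hβ hσ] with n hn1 hn2 hn3 hn4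
  rw [eigenvalueLaw_le_iff (measurableSet_exists_mem _ hT) (h.mass_univ_ne_zero hβ _) hn1]
  have h1 : mass β V S n Set.univ ≤
      ENNReal.ofReal (Real.exp (-(β * (insertionRate μ ℓ n - σ * n)))) *
        mass β V S (n + 1) Set.univ := by
    refine le_trans (le_of_eq ?_) (mul_le_mul_right hn4 _)
    rw [← mul_assoc, ← ENNReal.ofReal_mul (Real.exp_pos _).le, ← Real.exp_add]
    simp
  calc _ ≤ _ := mass_exists_le β hVm S n hT
    _ ≤ ENNReal.ofReal (Real.exp (τ / 2 * n)) *
        (ENNReal.ofReal (Real.exp (β * (insertionRate μ ℓ n + σ * n) - (n + 1) * c)) *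
          (ENNReal.ofReal (Real.exp (-(β * (insertionRate μ ℓ n - σ * n)))) *
        mass β V S (n + 1) Set.univ)) := by
        refine mul_le_mul' ?_ (hn3.trans (mul_le_mul_right h1 _))
        rw [← ENNReal.ofReal_natCast]
        exact ENNReal.ofReal_le_ofReal (by push_cast; exact hn2)
    _ ≤ _ := by
        rw [← mul_assoc, ← mul_assoc, ← ENNReal.ofReal_mul (Real.exp_pos _).le, ← Real.exp_add,
          ← ENNReal.ofReal_mul (Real.exp_pos _).le, ← Real.exp_add]
        refine mul_le_mul_left (ENNReal.ofReal_le_ofReal (Real.exp_le_exp.2 ?_)) _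
        push_cast
        have h9 : β * (σ * n) = τ / 4 * n := by rw [← mul_assoc, hβσ]
        nlinarith

/-- It is super-exponentially unlikely that all points lie to the left of `a`, if the equilibrium
measure charges `(a, ∞)`. -/
lemma eventually_eigenvalueLaw_forall_le_le (h : IsRegularEquilibrium V S μ ℓ) {β a : ℝ}
    (hβ : 0 < β) (ha : μ (Set.Ioi a) ≠ 0) (K : ℝ) :
    ∀ᶠ n : ℕ in atTop, eigenvalueLaw β V S n {l | ∀ i, l i ≤ a} ≤
      ENNReal.ofReal (Real.exp (-(n * K))) := by
  obtain ⟨c, hc, hev⟩ := h.exists_mass_forall_le_le hβ ha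
  have hlarge : ∀ᶠ n : ℕ in atTop, K / c ≤ (n : ℝ) :=
    tendsto_natCast_atTop_atTop.eventually_ge_atTop _
  filter_upwards [hev, hlarge, h.eventually_mass_univ_ne_top hβ] with n hn1 hn2 htop
  rw [eigenvalueLaw_le_iff (A := {l | ∀ i, l i ≤ a}) (measurableSet_forall_mem n measurableSet_Iic)
    (h.mass_univ_ne_zero hβ _) htop]
  refine hn1.trans (mul_le_mul_left (ENNReal.ofReal_le_ofReal (Real.exp_le_exp.2 ?_)) _)
  rw [div_le_iff₀ hc] at hn2
  have : (0 : ℝ) ≤ n := by positivity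
  nlinarith

/-- The effective potential has a positive minimum over the part of `S` to the right of a point
beyond the last zero of the effective potential. -/
lemma exists_pos_le_excess (h : IsRegularEquilibrium V S μ ℓ) {a p : ℝ} (hap : a < p)
    (hpos : ∀ x ∈ S, a < x → excess V μ ℓ x ≠ 0) :
    ∃ c > 0, ∀ x ∈ Set.Ici p, x ∈ S → c ≤ excess V μ ℓ x := by
  obtain ⟨δ, hδ, C, hC⟩ := h.exists_growth_excess
  set K := S ∩ Set.Ici p ∩ {x | excess V μ ℓ x ≤ 1}
  have hK : IsCompact K := by
    refine Metric.isCompact_of_isClosed_isBounded ((h.isClosed.inter isClosed_Ici).inter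
      (isClosed_le h.continuous_excess continuous_const)) ?_
    refine (Metric.isBounded_closedBall (x := (0 : ℝ)) (r := Real.exp ((1 + C) / δ))).subset ?_
    intro x hx
    rw [mem_closedBall_zero_iff, Real.norm_eq_abs]
    have h1 := hC x
    have h2 : Real.log (1 + |x|) ≤ (1 + C) / δ := by
      rw [le_div_iff₀ hδ]
      linarith [hx.2.out]
    have h3 := (Real.log_le_iff_le_exp (by positivity)).1 h2
    linarith
  by_cases hne : K.Nonempty
  · obtain ⟨x₀, hx₀, hmin⟩ := hK.exists_isMinOn hne h.continuous_excess.continuousOn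
    have hx₀pos : 0 < excess V μ ℓ x₀ :=
      lt_of_le_of_ne (h.excess_nonneg hx₀.1.1) (hpos x₀ hx₀.1.1 (hap.trans_le hx₀.1.2)).symm
    refine ⟨min 1 (excess V μ ℓ x₀), lt_min one_pos hx₀pos, fun x hxp hxS => ?_⟩
    rcases le_total (excess V μ ℓ x) 1 with h1 | h1
    · exact (min_le_right _ _).trans (hmin ⟨⟨hxS, hxp⟩, h1⟩)
    · exact (min_le_left _ _).trans h1
  · refine ⟨1, one_pos, fun x hxp hxS => ?_⟩
    by_contra hlt
    exact hne ⟨x, ⟨hxS, hxp⟩, (not_le.1 hlt).le⟩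

/-- A lower bound for the probability that the largest point lies in `[u, v]`, beyond the
support. -/
lemma eventually_le_eigenvalueLaw_Icc (h : IsRegularEquilibrium V S μ ℓ) {β τ e a p u v : ℝ}
    (hβ : 0 < β) (hτ : 0 < τ) (hap : a < p) (hpos : ∀ x ∈ S, a < x → excess V μ ℓ x ≠ 0)
    (hpu : p < u) (huv : u < v) (hS : Set.Icc u v ⊆ S)
    (he : ∀ x ∈ Set.Icc u v, excess V μ ℓ x ≤ e) :
    ∀ᶠ n : ℕ in atTop, ENNReal.ofReal (Real.exp (-(n * (β * e + τ)))) ≤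
      eigenvalueLaw β V S n {l | lambdaMax l ∈ Set.Icc u v} := by
  have hVm := h.continuous_potential.measurable
  obtain ⟨c, hc, hcle⟩ := h.exists_pos_le_excess hap hpos
  have htop := h.eventually_mass_univ_ne_top hβ
  have hp : ∀ᶠ n : ℕ in atTop, mass β V S n {l | ∃ i, l i ∈ Set.Ioi p} ≤
      ENNReal.ofReal (1 / 4) * mass β V S n Set.univ := by
    have h1 := h.eventually_eigenvalueLaw_exists_le hβ (τ := β * c / 2) (by positivity)
      (measurableSet_Ioi (a := p)) (c := β * c) fun x hx hxS =>
        mul_le_mul_of_nonneg_left (hcle x (Set.Ioi_subset_Ici_self hx) hxS) hβ.le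
    have h2 : Tendsto (fun n : ℕ => Real.exp (-(n * (β * c - β * c / 2)))) atTop (𝓝 0) := by
      refine Real.tendsto_exp_neg_atTop_nhds_zero.comp ?_
      refine tendsto_natCast_atTop_atTop.atTop_mul_const ?_
      have : 0 < β * c := by positivity
      linarith
    filter_upwards [h1, htop, h2.eventually_le_const (by norm_num : (0 : ℝ) < 1 / 4)]
      with n hn1 hn2 hn3
    rw [← eigenvalueLaw_le_iff (measurableSet_exists_mem n measurableSet_Ioi)
      (h.mass_univ_ne_zero hβ n) hn2]
    exact hn1.trans (ENNReal.ofReal_le_ofReal hn3)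
  refine eventually_of_eventually_succ ?_
  set σ := τ / (2 * β)
  have hσ : 0 < σ := by positivity
  have hβσ : β * σ = τ / 2 := by simp only [σ]; field_simp
  have hup := h.eventually_mass_coord_le hβ hσ MeasurableSet.univ (c := 0)
    fun x _ hxS => mul_nonneg hβ.le (h.excess_nonneg hxS)
  filter_upwards [(tendsto_add_atTop_nat 1).eventually htop, hup,
    h.eventually_le_mass_coord hβ hσ huv hpu hS he hp] with n hn1 hn2 hn3
  rw [le_eigenvalueLaw_iff (A := {l | lambdaMax l ∈ Set.Icc u v})
    (measurable_lambdaMax _ measurableSet_Icc) (h.mass_univ_ne_zero hβ _) hn1]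
  simp only [Set.mem_univ, Set.ofPred_true, mul_zero, sub_zero] at hn2
  -- the total mass for `n + 1` points is bounded through the one for `n` points
  calc _ ≤ ENNReal.ofReal (Real.exp (-((n + 1 : ℕ) * (β * e + τ)))) *
        (ENNReal.ofReal (Real.exp (β * (insertionRate μ ℓ n + σ * n))) *
          mass β V S n Set.univ) := by gcongr
    _ ≤ ENNReal.ofReal (Real.exp (β * (insertionRate μ ℓ n - σ * n) - (n + 1) * (β * e))) *
        mass β V S n Set.univ := by
        rw [← mul_assoc, ← ENNReal.ofReal_mul (Real.exp_pos _).le, ← Real.exp_add]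
        refine mul_le_mul_left (ENNReal.ofReal_le_ofReal (Real.exp_le_exp.2 ?_)) _
        push_cast
        have h9 : β * (σ * n) = τ / 2 * n := by rw [← mul_assoc, hβσ]
        nlinarith
    _ ≤ _ := hn3
    _ ≤ _ := by
        refine mass_mono fun l hl => ⟨hl.1.1.trans (le_lambdaMax l 0), ?_⟩
        refine ciSup_le fun i => ?_
        refine Fin.cases hl.1.2 (fun j => ?_) i
        exact (hl.2 j).trans (hpu.trans huv).le

/-- The largest point is with high probability close to the right edge `a` of the support. -/
lemma eventually_le_eigenvalueLaw_Ioo (h : IsRegularEquilibrium V S μ ℓ) {β a η : ℝ}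
    (hβ : 0 < β) (hη : 0 < η) (hpos : ∀ x ∈ S, a < x → excess V μ ℓ x ≠ 0)
    (ha : μ (Set.Ioi (a - η)) ≠ 0) :
    ∀ᶠ n : ℕ in atTop, ENNReal.ofReal (1 / 2) ≤
      eigenvalueLaw β V S n {l | lambdaMax l ∈ Set.Ioo (a - η) (a + η)} := by
  obtain ⟨c, hc, hcle⟩ := h.exists_pos_le_excess (lt_add_of_pos_right a hη) hpos
  have h1 := h.eventually_eigenvalueLaw_exists_le hβ (τ := β * c / 2) (by positivity)
    (measurableSet_Ici (a := a + η)) (c := β * c) fun x hx hxS =>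
      mul_le_mul_of_nonneg_left (hcle x hx hxS) hβ.le
  have h2 : Tendsto (fun n : ℕ => Real.exp (-(n * (β * c - β * c / 2)))) atTop (𝓝 0) := by
    refine Real.tendsto_exp_neg_atTop_nhds_zero.comp ?_
    refine tendsto_natCast_atTop_atTop.atTop_mul_const ?_
    have : 0 < β * c := by positivity
    linarith
  have h3 : Tendsto (fun n : ℕ => Real.exp (-(n * 1))) atTop (𝓝 0) := by
    refine Real.tendsto_exp_neg_atTop_nhds_zero.comp ?_
    exact tendsto_natCast_atTop_atTop.atTop_mul_const one_pos
  filter_upwards [h1, h.eventually_eigenvalueLaw_forall_le_le hβ ha 1,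
    h2.eventually_le_const (by norm_num : (0 : ℝ) < 1 / 4),
    h3.eventually_le_const (by norm_num : (0 : ℝ) < 1 / 4), h.eventually_mass_univ_ne_top hβ,
    eventually_gt_atTop 0] with n hn1 hn2 hn3 hn4 htop hn0
  have h0 := h.mass_univ_ne_zero hβ n
  rw [le_eigenvalueLaw_iff (A := {l | lambdaMax l ∈ Set.Ioo (a - η) (a + η)})
    (measurable_lambdaMax _ measurableSet_Ioo) h0 htop]
  have hB := (eigenvalueLaw_le_iff (measurableSet_exists_mem n measurableSet_Ici) h0 htop _).1
    (hn1.trans (ENNReal.ofReal_le_ofReal hn3))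
  have hC := (eigenvalueLaw_le_iff (measurableSet_forall_mem n measurableSet_Iic) h0 htop _).1
    (hn2.trans (ENNReal.ofReal_le_ofReal hn4))
  have h5 := mass_univ_le_two_mul (A := {l | lambdaMax l ∈ Set.Ioo (a - η) (a + η)}) (fun l _ => by
    by_cases hl1 : ∃ i, l i ∈ Set.Ici (a + η)
    · exact Or.inr (Or.inl hl1)
    by_cases hl2 : ∀ i, l i ∈ Set.Iic (a - η)
    · exact Or.inr (Or.inr hl2)
    refine Or.inl ⟨?_, ?_⟩
    · push Not at hl2
      obtain ⟨i, hi⟩ := hl2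
      exact (not_le.1 hi).trans_le (le_lambdaMax l i)
    · obtain ⟨i, hi⟩ := exists_eq_lambdaMax hn0 l
      rw [← hi]
      exact not_le.1 fun h' => hl1 ⟨i, h'⟩) htop hB hC
  calc _ ≤ ENNReal.ofReal (1 / 2) * (2 * _) := mul_le_mul_right h5 _
    _ = _ := by
      rw [← mul_assoc, show (2 : ENNReal) = ENNReal.ofReal 2 by simp,
        ← ENNReal.ofReal_mul (by norm_num)]
      norm_num

end IsRegularEquilibrium

/-! ### From exponential bounds to large deviation principles -/

lemma scaledLog_mono (n : ℕ) {p q : ENNReal} (h : p ≤ q) : scaledLog n p ≤ scaledLog n q :=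
  mul_le_mul_of_nonneg_left (ENNReal.log_monotone h) (by exact_mod_cast (by positivity))

lemma scaledLog_exp {n : ℕ} (hn : 0 < n) (c : ℝ) :
    scaledLog n (ENNReal.ofReal (Real.exp (-(n * c)))) = ((-c : ℝ) : EReal) := by
  rw [scaledLog, ENNReal.log_ofReal_of_pos (Real.exp_pos _), Real.log_exp, ← EReal.coe_mul]
  congr 1
  have : (n : ℝ) ≠ 0 := by positivity
  field_simp

lemma limsup_scaledLog_le {p : ℕ → ENNReal} {c : ℝ}
    (h : ∀ᶠ n : ℕ in atTop, p n ≤ ENNReal.ofReal (Real.exp (-(n * c)))) :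
    limsup (fun n => scaledLog n (p n)) atTop ≤ ((-c : ℝ) : EReal) := by
  refine Filter.limsup_le_of_le (by isBoundedDefault) ?_
  filter_upwards [h, eventually_gt_atTop 0] with n hn hn0
  exact (scaledLog_mono n hn).trans (scaledLog_exp hn0 c).le

lemma le_liminf_scaledLog {p : ℕ → ENNReal} {c : ℝ}
    (h : ∀ᶠ n : ℕ in atTop, ENNReal.ofReal (Real.exp (-(n * c))) ≤ p n) :
    ((-c : ℝ) : EReal) ≤ liminf (fun n => scaledLog n (p n)) atTop := by
  refine Filter.le_liminf_of_le (by isBoundedDefault) ?_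
  filter_upwards [h, eventually_gt_atTop 0] with n hn hn0
  exact (scaledLog_exp hn0 c).ge.trans (scaledLog_mono n hn)

lemma limsup_scaledLog_nonpos {p : ℕ → ENNReal} (h : ∀ n, p n ≤ 1) :
    limsup (fun n => scaledLog n (p n)) atTop ≤ 0 := by
  have := limsup_scaledLog_le (p := p) (c := 0) (Eventually.of_forall fun n => by simpa using h n)
  simpa using this

/-- To bound an extended real by `-m` from above, it suffices to bound it by `-c` for all real
`c < m`. -/
lemma le_neg_of_forall_lt {x m : EReal} (h : ∀ c : ℝ, (c : EReal) < m → x ≤ ((-c : ℝ) : EReal)) :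
    x ≤ -m := by
  by_contra hlt
  obtain ⟨q, hq1, hq2⟩ := EReal.lt_iff_exists_real_btwn.1 (not_le.1 hlt)
  have h1 : ((-q : ℝ) : EReal) < m := by
    rw [EReal.coe_neg]; exact EReal.neg_lt_comm.1 hq1
  have h2 := h _ h1
  rw [neg_neg] at h2
  exact absurd hq2 (not_lt.2 h2)

lemma coe_neg_le_of_forall_pos {x : EReal} {c : ℝ}
    (h : ∀ τ : ℝ, 0 < τ → ((-(c + τ) : ℝ) : EReal) ≤ x) : ((-c : ℝ) : EReal) ≤ x := by
  by_contra hlt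
  obtain ⟨q, hq1, hq2⟩ := EReal.lt_iff_exists_real_btwn.1 (not_le.1 hlt)
  have h1 : q < -c := by exact_mod_cast hq2
  have h2 := h (-q - c) (by linarith)
  rw [show -(c + (-q - c)) = q by ring] at h2
  exact absurd hq1 (not_lt.2 h2)

lemma lawMax_apply (β : ℝ) (V : ℝ → ℝ) (S : Set ℝ) (n : ℕ) {B : Set ℝ} (hB : MeasurableSet B) :
    lawMax β V S n B = eigenvalueLaw β V S n {l | lambdaMax l ∈ B} :=
  Measure.map_apply (measurable_lambdaMax n) hB

namespace IsRegularEquilibrium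

variable {V : ℝ → ℝ} {S : Set ℝ} {μ : Measure ℝ} {ℓ : ℝ}

lemma isCompact_support (h : IsRegularEquilibrium V S μ ℓ) : IsCompact μ.support := by
  obtain ⟨A, hA⟩ := h.bounded
  refine isCompact_Icc.of_isClosed_subset μ.isClosed_support (s := Set.Icc (-A) A) ?_
  exact Measure.support_subset_of_isClosed isClosed_Icc (mem_ae_iff.2 hA)

lemma support_nonempty (h : IsRegularEquilibrium V S μ ℓ) : μ.support.Nonempty := by
  have := h.isProbabilityMeasure
  exact Measure.nonempty_support (NeZero.ne μ)

lemma support_subset (h : IsRegularEquilibrium V S μ ℓ) : μ.support ⊆ S :=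
  Measure.support_subset_of_isClosed h.isClosed (mem_ae_iff.2 h.compl_null)

lemma sSup_support_mem (h : IsRegularEquilibrium V S μ ℓ) : sSup μ.support ∈ μ.support :=
  h.isCompact_support.sSup_mem h.support_nonempty

lemma excess_eq_zero (h : IsRegularEquilibrium V S μ ℓ) {x : ℝ} (hx : x ∈ μ.support) :
    excess V μ ℓ x = 0 := by
  have := h.effective_eq x hx
  unfold excess
  linarith

lemma excess_sSup_support (h : IsRegularEquilibrium V S μ ℓ) :
    excess V μ ℓ (sSup μ.support) = 0 := h.excess_eq_zero h.sSup_support_mem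

lemma measure_Ioi_ne_zero (h : IsRegularEquilibrium V S μ ℓ) {η : ℝ} (hη : 0 < η) :
    μ (Set.Ioi (sSup μ.support - η)) ≠ 0 :=
  ((Measure.mem_support_iff_forall _).1 h.sSup_support_mem _
    (Ioi_mem_nhds (sub_lt_self _ hη))).ne'

/-- A function that is `β * excess` to the right of `a` and infinite to the left is a good rate
function on `S`. -/
lemma isGoodRateFunctionOn_max (h : IsRegularEquilibrium V S μ ℓ) {β : ℝ} (hβ : 0 < β) {a : ℝ}
    {I : ℝ → EReal} (hI₁ : ∀ x ∈ S, x < a → I x = ⊤)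
    (hI₂ : ∀ x ∈ S, a ≤ x → I x = ((β * excess V μ ℓ x : ℝ) : EReal)) :
    IsGoodRateFunctionOn I S where
  nonneg x hx := by
    rcases lt_or_ge x a with hxa | hxa
    · rw [hI₁ x hx hxa]; exact le_top
    · rw [hI₂ x hx hxa]
      exact_mod_cast mul_nonneg hβ.le (h.excess_nonneg hx)
  lowerSemicontinuousOn x hx y hy := by
    replace hy : y < I x := hy
    change ∀ᶠ z in 𝓝[S] x, y < I z
    rcases lt_or_ge x a with hxa | hxa
    · filter_upwards [self_mem_nhdsWithin, mem_nhdsWithin_of_mem_nhds (Iio_mem_nhds hxa)]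
        with z hz hza
      rw [hI₁ x hx hxa] at hy
      rwa [hI₁ z hz hza]
    · rw [hI₂ x hx hxa] at hy
      have hcont : Continuous fun z => ((β * excess V μ ℓ z : ℝ) : EReal) :=
        continuous_coe_real_ereal.comp (continuous_const.mul h.continuous_excess)
      filter_upwards [self_mem_nhdsWithin, mem_nhdsWithin_of_mem_nhds
        (hcont.continuousAt.eventually_const_lt hy)] with z hz hz'
      rcases lt_or_ge z a with hza | hza
      · rw [hI₁ z hz hza]
        exact hy.trans_le le_top
      · rwa [hI₂ z hz hza]
  isCompact_sublevel c := by
    have e : {x ∈ S | I x ≤ (c : EReal)} = S ∩ Set.Ici a ∩ {x | β * excess V μ ℓ x ≤ c} := by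
      ext x
      constructor
      · rintro ⟨hx, hxc⟩
        rcases lt_or_ge x a with hxa | hxa
        · rw [hI₁ x hx hxa] at hxc
          exact absurd hxc (not_le.2 (EReal.coe_lt_top c))
        · rw [hI₂ x hx hxa] at hxc
          exact ⟨⟨hx, hxa⟩, by exact_mod_cast hxc⟩
      · rintro ⟨⟨hx, hxa⟩, hxc⟩
        refine ⟨hx, ?_⟩
        rw [hI₂ x hx hxa]
        exact_mod_cast hxc
    rw [e]
    obtain ⟨δ, hδ, C, hC⟩ := h.exists_growth_excess
    refine Metric.isCompact_of_isClosed_isBounded ((h.isClosed.inter isClosed_Ici).inter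
      (isClosed_le (continuous_const.mul h.continuous_excess) continuous_const)) ?_
    refine (Metric.isBounded_closedBall (x := (0 : ℝ))
      (r := Real.exp ((c / β + C) / δ))).subset ?_
    intro x hx
    rw [mem_closedBall_zero_iff, Real.norm_eq_abs]
    have h1 := hC x
    have h2 : Real.log (1 + |x|) ≤ (c / β + C) / δ := by
      rw [le_div_iff₀ hδ]
      have : excess V μ ℓ x ≤ c / β := by
        rw [le_div_iff₀ hβ, mul_comm]
        exact hx.2
      linarith
    have h3 := (Real.log_le_iff_le_exp (by positivity)).1 h2
    linarith

/-- The large deviation principle for the largest point. -/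
lemma satisfiesLDPOn_max (h : IsRegularEquilibrium V S μ ℓ) {β : ℝ} (hβ : 0 < β) {a : ℝ}
    (ha : a = sSup μ.support) (hpos : ∀ x ∈ S, a < x → excess V μ ℓ x ≠ 0)
    {I : ℝ → EReal} (hI₁ : ∀ x ∈ S, x < a → I x = ⊤)
    (hI₂ : ∀ x ∈ S, a ≤ x → I x = ((β * excess V μ ℓ x : ℝ) : EReal)) :
    SatisfiesLDPOn (lawMax β V S) I S := by
  have haS : a ∈ S := ha ▸ h.support_subset h.sSup_support_mem
  have hIa : I a = 0 := by
    rw [hI₂ a haS le_rfl, ha, h.excess_sSup_support, mul_zero, EReal.coe_zero]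
  have hmeas := h.isClosed.measurableSet
  refine ⟨fun F hF => ?_, fun U hU => ?_⟩
  · refine le_neg_of_forall_lt fun c hc => ?_
    have hle : ∀ x ∈ F, x ∈ S → ∀ {c' : ℝ}, (c' : EReal) < ⨅ x ∈ F ∩ S, I x → (c' : EReal) < I x :=
      fun x hxF hxS c' hc' => hc'.trans_le (iInf₂_le x ⟨hxF, hxS⟩)
    by_cases haF : a ∈ F
    · have h1 := hle a haF haS hc
      rw [hIa] at h1
      have h2 : c < 0 := by exact_mod_cast h1
      refine (limsup_scaledLog_nonpos fun n => ?_).trans ?_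
      · rw [lawMax_apply _ _ _ _ (hF.measurableSet.inter hmeas)]
        exact eigenvalueLaw_le_one _ _ _ _ _
      · exact_mod_cast (by linarith : (0 : ℝ) ≤ -c)
    -- the largest point lies in `F` beyond `a + η`, or all points lie to the left of `a - η`
    obtain ⟨η, hη, hball⟩ := Metric.isOpen_iff.1 hF.isOpen_compl a haF
    obtain ⟨c', hc1, hc2⟩ := EReal.lt_iff_exists_real_btwn.1 hc
    have hcc : c < c' := by exact_mod_cast hc1
    set τ := (c' - c) / 2
    have hτ : 0 < τ := by simp only [τ]; linarith
    have hT : MeasurableSet (F ∩ Set.Ici (a + η)) := hF.measurableSet.inter measurableSet_Ici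
    have hup := h.eventually_eigenvalueLaw_exists_le hβ hτ hT (c := c') fun x hx hxS => by
      have h1 := hle x hx.1 hxS hc2
      rw [hI₂ x hxS (by linarith [hx.2.out])] at h1
      exact_mod_cast h1.le
    have hdown := h.eventually_eigenvalueLaw_forall_le_le hβ
      (ha ▸ h.measure_Ioi_ne_zero hη : μ (Set.Ioi (a - η)) ≠ 0) (c' - τ)
    have htwo : ∀ᶠ n : ℕ in atTop, 2 * Real.exp (-(n * (c' - τ))) ≤ Real.exp (-(n * c)) := by
      refine eventually_mul_exp_le (f := fun n : ℕ => -(n * (c' - τ))) (g := fun n => -(n * c)) ?_ 2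
      refine (tendsto_linear_atTop hτ 0).congr fun n => ?_
      simp only [τ]; ring
    refine limsup_scaledLog_le ?_
    filter_upwards [hup, hdown, htwo, eventually_gt_atTop 0] with n hn1 hn2 hn3 hn0
    rw [lawMax_apply _ _ _ _ (hF.measurableSet.inter hmeas)]
    have hsub : {l : Fin n → ℝ | lambdaMax l ∈ F ∩ S} ⊆
        {l | ∃ i, l i ∈ F ∩ Set.Ici (a + η)} ∪ {l | ∀ i, l i ≤ a - η} := by
      intro l hl
      obtain ⟨i, hi⟩ := exists_eq_lambdaMax hn0 l
      have hlF : lambdaMax l ∈ F := hl.1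
      have hout : η ≤ |lambdaMax l - a| := by
        by_contra hlt
        exact hball (by rw [Metric.mem_ball, Real.dist_eq]; exact not_le.1 hlt) hlF
      rcases le_abs.1 hout with h1 | h1
      · refine Or.inl ⟨i, ?_, ?_⟩
        · rwa [hi]
        · rw [hi, Set.mem_Ici]; linarith
      · exact Or.inr fun j => (le_lambdaMax l j).trans (by linarith)
    calc _ ≤ eigenvalueLaw β V S n {l | ∃ i, l i ∈ F ∩ Set.Ici (a + η)} +
          eigenvalueLaw β V S n {l | ∀ i, l i ≤ a - η} :=
          (measure_mono hsub).trans (measure_union_le _ _)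
      _ ≤ ENNReal.ofReal (Real.exp (-(n * (c' - τ)))) +
          ENNReal.ofReal (Real.exp (-(n * (c' - τ)))) := add_le_add hn1 hn2
      _ ≤ _ := by
        rw [← ENNReal.ofReal_add (Real.exp_pos _).le (Real.exp_pos _).le]
        exact ENNReal.ofReal_le_ofReal (by linarith)
  · rw [EReal.neg_le]
    refine le_iInf₂ fun x hx => ?_
    rw [EReal.neg_le]
    obtain ⟨hxU, hxS⟩ := hx
    obtain ⟨r, hr, hball⟩ := Metric.isOpen_iff.1 hU x hxU
    have hlaw : ∀ n, lawMax β V S n (U ∩ S) = eigenvalueLaw β V S n {l | lambdaMax l ∈ U ∩ S} :=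
      fun n => lawMax_apply _ _ _ _ (hU.measurableSet.inter hmeas)
    simp only [hlaw]
    -- configurations almost surely lie in `S`, hence so does their largest point
    have hS : ∀ (n : ℕ) (B : Set ℝ), 0 < n → MeasurableSet B → B ⊆ U →
        eigenvalueLaw β V S n {l | lambdaMax l ∈ B} ≤
          eigenvalueLaw β V S n {l | lambdaMax l ∈ U ∩ S} := by
      intro n B hn hB hBU
      rw [eigenvalueLaw_apply _ _ _ _ (A := {l | lambdaMax l ∈ B}) (measurable_lambdaMax n hB),
        eigenvalueLaw_apply _ _ _ _ (A := {l | lambdaMax l ∈ U ∩ S})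
          (measurable_lambdaMax n (hU.measurableSet.inter hmeas))]
      have hmass : mass β V S n {l | lambdaMax l ∈ B} ≤ mass β V S n {l | lambdaMax l ∈ U ∩ S} :=
        mass_le_of_forall_mem hmeas fun l hl hlB => by
          obtain ⟨i, hi⟩ := exists_eq_lambdaMax hn l
          exact ⟨hBU hlB, hi ▸ hl i⟩
      gcongr
    rcases lt_trichotomy x a with hxa | hxa | hxa
    · rw [hI₁ x hxS hxa, EReal.neg_top]
      exact bot_le
    · subst hxa
      rw [hIa]
      have := coe_neg_le_of_forall_pos (c := 0)
        (x := liminf (fun n => scaledLog n (eigenvalueLaw β V S n {l | lambdaMax l ∈ U ∩ S})) atTop)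
        fun τ hτ => le_liminf_scaledLog ?_
      · simpa using this
      have h1 := h.eventually_le_eigenvalueLaw_Ioo hβ hr hpos (ha ▸ h.measure_Ioi_ne_zero hr)
      have h2 : Tendsto (fun n : ℕ => Real.exp (-(n * (0 + τ)))) atTop (𝓝 0) := by
        refine Real.tendsto_exp_neg_atTop_nhds_zero.comp ?_
        exact tendsto_natCast_atTop_atTop.atTop_mul_const (by linarith)
      filter_upwards [h1, h2.eventually_le_const (by norm_num : (0 : ℝ) < 1 / 2),
        eventually_gt_atTop 0] with n hn1 hn2 hn0
      refine (ENNReal.ofReal_le_ofReal hn2).trans (hn1.trans (hS n _ hn0 measurableSet_Ioo ?_))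
      rwa [← Real.ball_eq_Ioo]
    · rw [hI₂ x hxS hxa.le, ← EReal.coe_neg]
      refine coe_neg_le_of_forall_pos fun τ hτ => le_liminf_scaledLog ?_
      obtain ⟨s, hs, hcont⟩ := Metric.continuousAt_iff.1
        (h.continuous_excess.continuousAt (x := x)) (τ / (2 * β)) (by positivity)
      set d := min (min (r / 2) (s / 2)) ((x - a) / 3)
      have hd : 0 < d := lt_min (lt_min (by linarith) (by linarith)) (by linarith)
      have hd1 : d ≤ r / 2 := (min_le_left _ _).trans (min_le_left _ _)
      have hd2 : d ≤ s / 2 := (min_le_left _ _).trans (min_le_right _ _)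
      have hd3 : d ≤ (x - a) / 3 := min_le_right _ _
      have h1 := h.eventually_le_eigenvalueLaw_Icc hβ (half_pos hτ) (a := a) (p := a + d)
        (u := x - d) (v := x) (e := excess V μ ℓ x + τ / (2 * β)) (by linarith) hpos (by linarith)
        (by linarith)
        (fun y hy => h.ordConnected.out haS hxS ⟨by linarith [hy.1], hy.2⟩) (fun y hy => by
          have h2 : dist y x < s := by
            rw [Real.dist_eq, abs_lt]; constructor <;> linarith [hy.1, hy.2]
          have h3 := hcont h2
          rw [Real.dist_eq, abs_lt] at h3
          linarith [h3.2])
      filter_upwards [h1, eventually_gt_atTop 0] with n hn1 hn0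
      refine le_trans (le_of_eq ?_) (hn1.trans (hS n _ hn0 measurableSet_Icc fun y hy => ?_))
      · congr 2
        field_simp
        ring
      · refine hball ?_
        rw [Metric.mem_ball, Real.dist_eq, abs_lt]
        constructor <;> linarith [hy.1, hy.2]

/-- Deviations of the largest point away from the support are exponentially unlikely. -/
lemma limsup_scaledLog_max_lt_zero (h : IsRegularEquilibrium V S μ ℓ) {β : ℝ} (hβ : 0 < β)
    {a ε : ℝ} (hε : 0 < ε) (hpos : ∀ x ∈ S, a < x → excess V μ ℓ x ≠ 0) :
    limsup (fun n => scaledLog n (eigenvalueLaw β V S n {l | a + ε ≤ lambdaMax l})) atTop < 0 := by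
  obtain ⟨c, hc, hcle⟩ := h.exists_pos_le_excess (lt_add_of_pos_right a hε) hpos
  have hβc : 0 < β * c := by positivity
  have h1 := h.eventually_eigenvalueLaw_exists_le hβ (half_pos hβc)
    (measurableSet_Ici (a := a + ε)) (c := β * c) fun x hx hxS =>
      mul_le_mul_of_nonneg_left (hcle x hx hxS) hβ.le
  refine (limsup_scaledLog_le (c := β * c - β * c / 2) ?_).trans_lt ?_
  · filter_upwards [h1, eventually_gt_atTop 0] with n hn hn0
    refine (measure_mono fun l hl => ?_).trans hn
    obtain ⟨i, hi⟩ := exists_eq_lambdaMax hn0 l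
    exact ⟨i, hi ▸ hl⟩
  · exact_mod_cast (by linarith : -(β * c - β * c / 2) < 0)

end IsRegularEquilibrium

/-! ### Reflection -/

/-- The reflection of a large deviation principle. -/
lemma SatisfiesLDPOn.reflect {P P' : ℕ → Measure ℝ} {I : ℝ → EReal} {S : Set ℝ}
    (hS : MeasurableSet S) (h : SatisfiesLDPOn P' (fun x => I (-x)) (Neg.neg ⁻¹' S))
    (hP : ∀ n, ∀ B : Set ℝ, MeasurableSet B → P n B = P' n (Neg.neg ⁻¹' B)) :
    SatisfiesLDPOn P I S := by
  have hinf : ∀ B : Set ℝ, ⨅ x ∈ (Neg.neg ⁻¹' B : Set ℝ) ∩ Neg.neg ⁻¹' S, I (-x) =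
      ⨅ x ∈ B ∩ S, I x := fun B =>
    (Equiv.neg ℝ).iInf_congr (g := fun x => ⨅ _ : x ∈ B ∩ S, I x) fun x => rfl
  refine ⟨fun F hF => ?_, fun U hU => ?_⟩
  · have := h.upper _ (hF.preimage continuous_neg)
    rw [hinf] at this
    simp only [hP _ _ (hF.measurableSet.inter hS)]
    exact this
  · have := h.lower _ (hU.preimage continuous_neg)
    rw [hinf] at this
    simp only [hP _ _ (hU.measurableSet.inter hS)]
    exact this

/-- The reflection of a good rate function. -/
lemma IsGoodRateFunctionOn.reflect {I : ℝ → EReal} {S : Set ℝ}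
    (h : IsGoodRateFunctionOn (fun x => I (-x)) (Neg.neg ⁻¹' S)) : IsGoodRateFunctionOn I S where
  nonneg x hx := by
    simpa using h.nonneg (-x) (by simpa using hx)
  lowerSemicontinuousOn x hx y hy := by
    replace hy : y < I x := hy
    change ∀ᶠ z in 𝓝[S] x, y < I z
    have h1 : ∀ᶠ z in 𝓝[Neg.neg ⁻¹' S] (-x), y < I (-z) :=
      h.lowerSemicontinuousOn (-x) (by simpa using hx) y (by simpa using hy)
    have h2 : Tendsto (fun z : ℝ => -z) (𝓝[S] x) (𝓝[Neg.neg ⁻¹' S] (-x)) :=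
      tendsto_nhdsWithin_iff.2 ⟨(continuous_neg.tendsto x).mono_left nhdsWithin_le_nhds,
        eventually_mem_nhdsWithin.mono fun z hz => by simpa using hz⟩
    simpa using h2.eventually h1
  isCompact_sublevel c := by
    have e : {x ∈ S | I x ≤ (c : EReal)} =
        Neg.neg '' {x ∈ Neg.neg ⁻¹' S | I (-x) ≤ (c : EReal)} := by
      ext x
      simp
    rw [e]
    exact (h.isCompact_sublevel c).image continuous_neg

/-- The density of the ensemble with the reflected potential. -/
lemma weight_reflect (β : ℝ) (V : ℝ → ℝ) (n : ℕ) (l : Fin n → ℝ) :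
    weight β (fun x => V (-x)) n l = weight β V n (-l) := by
  simp only [weight, Pi.neg_apply]
  congr 1
  refine Finset.prod_congr rfl fun i _ => Finset.prod_congr rfl fun j _ => ?_
  rw [← abs_neg]
  ring_nf

lemma mass_reflect (β : ℝ) (V : ℝ → ℝ) {S : Set ℝ} (hS : MeasurableSet S) (n : ℕ)
    (A : Set (Fin n → ℝ)) :
    mass β (fun x => V (-x)) (Neg.neg ⁻¹' S) n (Neg.neg ⁻¹' A) = mass β V S n A := by
  have h1 : MeasurePreserving (fun x : ℝ => -x) (volume.restrict (Neg.neg ⁻¹' S))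
      (volume.restrict S) := (Measure.measurePreserving_neg volume).restrict_preimage hS
  have h2 : MeasurePreserving (fun l : Fin n → ℝ => -l) (boxMeasure (Neg.neg ⁻¹' S) n)
      (boxMeasure S n) := measurePreserving_pi _ _ fun _ => h1
  have h3 := h2.setLIntegral_comp_preimage_emb
    (MeasurableEquiv.neg (Fin n → ℝ)).measurableEmbedding
    (fun l => ENNReal.ofReal (weight β V n l)) A
  unfold mass
  rw [← h3]
  simp only [weight_reflect]

lemma lambdaMax_neg {n : ℕ} (l : Fin n → ℝ) : lambdaMax (-l) = -lambdaMin l := by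
  have e : Set.range (-l) = -Set.range l := by
    ext x
    simp only [Set.mem_range, Pi.neg_apply, Set.mem_neg]
    exact ⟨fun ⟨i, hi⟩ => ⟨i, by rw [← hi, neg_neg]⟩, fun ⟨i, hi⟩ => ⟨i, by rw [hi, neg_neg]⟩⟩
  rw [lambdaMax, lambdaMin, iSup, iInf, Real.sInf_def, e, neg_neg]

lemma measurable_lambdaMin (n : ℕ) : Measurable (lambdaMin : (Fin n → ℝ) → ℝ) :=
  Measurable.iInf fun i => measurable_pi_apply i

/-- The smallest point is minus the largest point of the reflected ensemble. -/
lemma eigenvalueLaw_lambdaMin (β : ℝ) (V : ℝ → ℝ) {S : Set ℝ} (hS : MeasurableSet S) (n : ℕ)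
    {B : Set ℝ} (hB : MeasurableSet B) :
    eigenvalueLaw β V S n {l | lambdaMin l ∈ B} =
      eigenvalueLaw β (fun x => V (-x)) (Neg.neg ⁻¹' S) n
        {l | lambdaMax l ∈ (Neg.neg ⁻¹' B : Set ℝ)} := by
  have hA : MeasurableSet {l : Fin n → ℝ | lambdaMin l ∈ B} := measurable_lambdaMin n hB
  have e : {l : Fin n → ℝ | lambdaMax l ∈ (Neg.neg ⁻¹' B : Set ℝ)} =
      Neg.neg ⁻¹' {l : Fin n → ℝ | lambdaMin l ∈ B} := by
    ext l
    have := lambdaMax_neg (-l)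
    rw [neg_neg] at this
    simp [this]
  rw [eigenvalueLaw_apply _ _ _ _ hA, e, eigenvalueLaw_apply _ _ _ _ (measurable_neg hA),
    mass_reflect β V hS, ← mass_reflect β V hS n Set.univ, Set.preimage_univ]

lemma lawMin_apply (β : ℝ) (V : ℝ → ℝ) {S : Set ℝ} (hS : MeasurableSet S) (n : ℕ) {B : Set ℝ}
    (hB : MeasurableSet B) :
    lawMin β V S n B = lawMax β (fun x => V (-x)) (Neg.neg ⁻¹' S) n (Neg.neg ⁻¹' B) := by
  rw [lawMax_apply _ _ _ _ (measurable_neg hB), ← eigenvalueLaw_lambdaMin β V hS n hB]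
  exact Measure.map_apply (measurable_lambdaMin n) hB

lemma measurableEmbedding_neg : MeasurableEmbedding (Neg.neg : ℝ → ℝ) :=
  (MeasurableEquiv.neg ℝ).measurableEmbedding

lemma logPot_reflect (μ : Measure ℝ) (x : ℝ) : logPot (μ.map Neg.neg) x = logPot μ (-x) := by
  rw [logPot, logPot, measurableEmbedding_neg.integral_map]
  congr 2
  ext ξ
  rw [← abs_neg]
  ring_nf

lemma regPot_reflect (ε : ℝ) (μ : Measure ℝ) (x : ℝ) :
    regPot ε (μ.map Neg.neg) x = regPot ε μ (-x) := by
  rw [regPot, regPot, measurableEmbedding_neg.integral_map]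
  congr 1
  ext ξ
  rw [← regLog_neg]
  ring_nf

lemma support_map_neg (μ : Measure ℝ) : (μ.map Neg.neg).support = Neg.neg ⁻¹' μ.support := by
  have key : ∀ (ν : Measure ℝ) (x : ℝ), x ∈ ν.support → -x ∈ (ν.map Neg.neg).support := by
    intro ν x hx
    rw [Measure.mem_support_iff_forall] at hx ⊢
    intro U hU
    rw [measurableEmbedding_neg.map_apply]
    exact hx _ (continuous_neg.continuousAt.preimage_mem_nhds hU)
  ext x
  constructor
  · intro hx
    have h1 := key _ x hx
    rw [Measure.map_map measurable_neg measurable_neg] at h1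
    simpa using h1
  · intro hx
    simpa using key μ (-x) hx

namespace IsRegularEquilibrium

variable {V : ℝ → ℝ} {S : Set ℝ} {μ : Measure ℝ} {ℓ : ℝ}

/-- The reflected equilibrium measure is an equilibrium for the reflected potential. -/
lemma reflect (h : IsRegularEquilibrium V S μ ℓ) :
    IsRegularEquilibrium (fun x => V (-x)) (Neg.neg ⁻¹' S) (μ.map Neg.neg) ℓ where
  continuous_potential := h.continuous_potential.comp continuous_neg
  growth := by
    obtain ⟨δ, hδ, C, hC⟩ := h.growth
    exact ⟨δ, hδ, C, fun x => by simpa using hC (-x)⟩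
  isClosed := h.isClosed.preimage continuous_neg
  ordConnected := ⟨fun x hx y hy z hz =>
    h.ordConnected.out hy hx ⟨neg_le_neg hz.2, neg_le_neg hz.1⟩⟩
  nontrivial := by
    obtain ⟨p, q, hpq, hp, hq⟩ := h.nontrivial
    exact ⟨-q, -p, neg_lt_neg hpq, by simpa using hq, by simpa using hp⟩
  isProbabilityMeasure :=
    have := h.isProbabilityMeasure
    Measure.isProbabilityMeasure_map measurable_neg.aemeasurable
  compl_null := by
    rw [measurableEmbedding_neg.map_apply, ← h.compl_null]
    congr 1
    ext x
    simp
  bounded := by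
    obtain ⟨A, hA⟩ := h.bounded
    refine ⟨A, ?_⟩
    rw [measurableEmbedding_neg.map_apply, ← hA]
    congr 1
    ext x
    simp only [Set.mem_preimage, Set.mem_compl_iff, Set.mem_Icc]
    rw [neg_le_neg_iff, neg_le, and_comm]
  integrable_log x := by
    rw [measurableEmbedding_neg.integrable_map_iff]
    refine (h.integrable_log (-x)).congr (ae_of_all _ fun ξ => ?_)
    simp only [Function.comp_apply]
    rw [← abs_neg]
    ring_nf
  regPot_approx η hη := by
    obtain ⟨ε₀, hε₀, happ⟩ := h.regPot_approx η hη
    refine ⟨ε₀, hε₀, fun ε hε hε' x => ?_⟩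
    rw [regPot_reflect, logPot_reflect]
    exact happ ε hε hε' (-x)
  le_effective x hx := by
    rw [logPot_reflect]
    exact h.le_effective (-x) hx
  effective_eq x hx := by
    rw [support_map_neg] at hx
    rw [logPot_reflect]
    exact h.effective_eq (-x) hx

lemma excess_reflect (V : ℝ → ℝ) (μ : Measure ℝ) (ℓ x : ℝ) :
    excess (fun x => V (-x)) (μ.map Neg.neg) ℓ x = excess V μ ℓ (-x) := by
  rw [excess, excess, logPot_reflect]

lemma sSup_support_map_neg (μ : Measure ℝ) : sSup (μ.map Neg.neg).support = -sInf μ.support := by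
  rw [support_map_neg, Real.sInf_def, neg_neg]
  rfl

lemma isGoodRateFunctionOn_min (h : IsRegularEquilibrium V S μ ℓ) {β : ℝ} (hβ : 0 < β) {a : ℝ}
    {I : ℝ → EReal} (hI₁ : ∀ x ∈ S, a < x → I x = ⊤)
    (hI₂ : ∀ x ∈ S, x ≤ a → I x = ((β * excess V μ ℓ x : ℝ) : EReal)) :
    IsGoodRateFunctionOn I S :=
  (h.reflect.isGoodRateFunctionOn_max (a := -a) (I := fun x => I (-x)) hβ
    (fun x hx hxa => hI₁ (-x) hx (lt_neg.1 hxa)) fun x hx hxa => by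
      rw [excess_reflect]
      exact hI₂ (-x) hx (neg_le.1 hxa)).reflect

lemma satisfiesLDPOn_min (h : IsRegularEquilibrium V S μ ℓ) {β : ℝ} (hβ : 0 < β) {a : ℝ}
    (ha : a = sInf μ.support) (hpos : ∀ x ∈ S, x < a → excess V μ ℓ x ≠ 0)
    {I : ℝ → EReal} (hI₁ : ∀ x ∈ S, a < x → I x = ⊤)
    (hI₂ : ∀ x ∈ S, x ≤ a → I x = ((β * excess V μ ℓ x : ℝ) : EReal)) :
    SatisfiesLDPOn (lawMin β V S) I S :=
  (h.reflect.satisfiesLDPOn_max (a := -a) (I := fun x => I (-x)) hβ (by rw [sSup_support_map_neg, ha])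
    (fun x hx hxa => by
      rw [excess_reflect]
      exact hpos (-x) hx (neg_lt.1 hxa))
    (fun x hx hxa => hI₁ (-x) hx (lt_neg.1 hxa)) fun x hx hxa => by
      rw [excess_reflect]
      exact hI₂ (-x) hx (neg_le.1 hxa)).reflect h.isClosed.measurableSet
    fun n _ hB => lawMin_apply β V h.isClosed.measurableSet n hB

lemma limsup_scaledLog_min_lt_zero (h : IsRegularEquilibrium V S μ ℓ) {β : ℝ} (hβ : 0 < β)
    {a ε : ℝ} (hε : 0 < ε) (hpos : ∀ x ∈ S, x < a → excess V μ ℓ x ≠ 0) :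
    limsup (fun n => scaledLog n (eigenvalueLaw β V S n {l | lambdaMin l ≤ a - ε})) atTop < 0 := by
  have h1 := h.reflect.limsup_scaledLog_max_lt_zero hβ (a := -a) hε fun x hx hxa => by
    rw [excess_reflect]
    exact hpos (-x) hx (neg_lt.1 hxa)
  have e : ∀ n, eigenvalueLaw β V S n {l | lambdaMin l ≤ a - ε} =
      eigenvalueLaw β (fun x => V (-x)) (Neg.neg ⁻¹' S) n {l | -a + ε ≤ lambdaMax l} := by
    intro n
    refine (eigenvalueLaw_lambdaMin β V h.isClosed.measurableSet n measurableSet_Iic).trans ?_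
    congr 1
    ext l
    simp only [Set.mem_preimage, Set.mem_Iic, Set.mem_ofPred_eq]
    rw [neg_le, neg_sub, sub_eq_add_neg, add_comm]
  simpa only [e] using h1

end IsRegularEquilibrium

/-! ### The energy as the integral of a nonnegative kernel -/

/-- A continuous potential on the line growing faster than `2 ln |x|`, with the constants of the
growth condition. -/
structure IsConfining (V : ℝ → ℝ) (δ C : ℝ) : Prop where
  continuous_potential : Continuous V
  pos : 0 < δ
  growth : ∀ x, (1 + δ) * Real.log (1 + |x|) ≤ V x / 2 + C

/-- The kernel `V x / 2 + V y / 2 - ln |x - y|`, shifted by a constant that makes it nonnegative for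
a confining potential. Its value on the diagonal is `∞`. -/
def kernel (V : ℝ → ℝ) (C x y : ℝ) : ENNReal :=
  if x = y then ⊤ else ENNReal.ofReal (V x / 2 + V y / 2 - Real.log |x - y| + 2 * C)

/-- Continuous bounded approximations of `kernel` from below. -/
def truncKernel (V : ℝ → ℝ) (C : ℝ) (m : ℕ) (x y : ℝ) : ℝ :=
  min (V x / 2 + V y / 2 + regLog (1 / (m + 1)) (x - y) + 2 * C) m

/-- The energy of a measure for the nonnegative kernel. -/
def kernelEnergy (V : ℝ → ℝ) (C : ℝ) (ν : Measure ℝ) : ENNReal := ∫⁻ x, ∫⁻ y, kernel V C x y ∂ν ∂ν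

lemma log_abs_sub_le (x y : ℝ) : Real.log |x - y| ≤ Real.log (1 + |x|) + Real.log (1 + |y|) := by
  refine le_trans ?_ (log_one_add_abs_sub_le x y)
  rcases eq_or_ne (x - y) 0 with h | h
  · simp [h]
  · exact Real.log_le_log (abs_pos.2 h) (by linarith)

lemma regLog_le_regLog {a b : ℝ} (ha : 0 < a) (hab : a ≤ b) (x : ℝ) : regLog b x ≤ regLog a x := by
  have h1 : Real.log (x ^ 2 + a ^ 2) ≤ Real.log (x ^ 2 + b ^ 2) :=
    Real.log_le_log (by positivity) (by gcongr)
  simp only [regLog]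
  linarith

lemma neg_log_one_add_abs_le_regLog {ε : ℝ} (hε : 0 < ε) (hε1 : ε ≤ 1) (x : ℝ) :
    -Real.log (1 + |x|) ≤ regLog ε x := by
  refine le_trans ?_ (regLog_le_regLog hε hε1 x)
  have h1 : Real.log (x ^ 2 + 1) ≤ Real.log ((1 + |x|) ^ 2) := by
    refine Real.log_le_log (by positivity) ?_
    nlinarith [abs_nonneg x, sq_abs x]
  rw [Real.log_pow] at h1
  push_cast at h1
  simp only [regLog, one_pow]
  linarith

lemma neg_half_log_sq (x : ℝ) : -(1 / 2) * Real.log (x ^ 2) = -Real.log |x| := by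
  rw [← sq_abs, Real.log_pow]
  push_cast
  ring

lemma tendsto_regLog {x : ℝ} (hx : x ≠ 0) :
    Tendsto (fun m : ℕ => regLog (1 / (m + 1)) x) atTop (𝓝 (-Real.log |x|)) := by
  have h1 : Tendsto (fun m : ℕ => x ^ 2 + (1 / ((m : ℝ) + 1)) ^ 2) atTop (𝓝 (x ^ 2 + 0 ^ 2)) :=
    (tendsto_one_div_add_atTop_nhds_zero_nat.pow 2).const_add _
  rw [← neg_half_log_sq]
  have h2 := (h1.log (by positivity)).const_mul (-(1 / 2))
  simpa [regLog] using h2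

namespace IsConfining

variable {V : ℝ → ℝ} {δ C : ℝ}

lemma growth_two (h : IsConfining V δ C) (x y : ℝ) :
    δ * Real.log (1 + |x|) + δ * Real.log (1 + |y|) ≤
      V x / 2 + V y / 2 - (Real.log (1 + |x|) + Real.log (1 + |y|)) + 2 * C := by
  have := h.growth x
  have := h.growth y
  linarith

lemma real_kernel_nonneg (h : IsConfining V δ C) (x y : ℝ) :
    0 ≤ V x / 2 + V y / 2 - Real.log |x - y| + 2 * C := by
  have h1 := h.growth_two x y
  have h2 := log_abs_sub_le x y
  have h3 := mul_nonneg h.pos.le (log_one_add_abs_nonneg x)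
  have h4 := mul_nonneg h.pos.le (log_one_add_abs_nonneg y)
  linarith

lemma le_kernel (h : IsConfining V δ C) (x y : ℝ) :
    ENNReal.ofReal (δ * Real.log (1 + |x|)) ≤ kernel V C x y := by
  unfold kernel
  split_ifs
  · exact le_top
  · refine ENNReal.ofReal_le_ofReal ?_
    have h1 := h.growth_two x y
    have h2 := log_abs_sub_le x y
    have h4 := mul_nonneg h.pos.le (log_one_add_abs_nonneg y)
    linarith

/-- The kernel controls the potential. -/
lemma potential_le_kernel (h : IsConfining V δ C) (x y : ℝ) :
    ENNReal.ofReal (δ / (1 + δ) * (V x / 2 + C)) ≤ kernel V C x y := by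
  unfold kernel
  split_ifs
  · exact le_top
  · refine ENNReal.ofReal_le_ofReal ?_
    have hδ := h.pos
    have h1 := h.growth x
    have h2 := h.growth y
    have h3 := log_abs_sub_le x y
    have h4 := mul_nonneg h.pos.le (log_one_add_abs_nonneg y)
    have h5 : Real.log (1 + |x|) ≤ (V x / 2 + C) / (1 + δ) := by
      rw [le_div_iff₀ (by positivity)]; linarith
    have h6 : δ / (1 + δ) * (V x / 2 + C) = (V x / 2 + C) - (V x / 2 + C) / (1 + δ) := by
      field_simp; ring
    linarith

lemma kernel_comm (V : ℝ → ℝ) (C x y : ℝ) : kernel V C x y = kernel V C y x := by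
  simp only [kernel, eq_comm (a := x), abs_sub_comm x y, add_comm (V x / 2)]

lemma truncKernel_nonneg (h : IsConfining V δ C) (m : ℕ) (x y : ℝ) :
    0 ≤ truncKernel V C m x y := by
  have h1 := h.growth_two x y
  have h2 := neg_log_one_add_abs_le_regLog (ε := 1 / (m + 1)) (by positivity)
    (by rw [div_le_one (by positivity)]; linarith [(Nat.cast_nonneg m : (0 : ℝ) ≤ m)]) (x - y)
  have h3 := mul_nonneg h.pos.le (log_one_add_abs_nonneg x)
  have h4 := mul_nonneg h.pos.le (log_one_add_abs_nonneg y)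
  have h5 := log_one_add_abs_sub_le x y
  exact le_min (by linarith) (Nat.cast_nonneg m)

lemma truncKernel_mono (V : ℝ → ℝ) (C x y : ℝ) : Monotone fun m : ℕ => truncKernel V C m x y := by
  intro m k hmk
  have h0 : (m : ℝ) ≤ k := by exact_mod_cast hmk
  have h1 := regLog_le_regLog (a := 1 / (k + 1)) (b := 1 / (m + 1)) (by positivity)
    (one_div_le_one_div_of_le (by positivity) (by linarith)) (x - y)
  exact min_le_min (by linarith) h0

lemma continuous_truncKernel (h : IsConfining V δ C) (m : ℕ) :
    Continuous fun p : ℝ × ℝ => truncKernel V C m p.1 p.2 := by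
  have h1 := h.continuous_potential
  have h2 := continuous_regLog (ε := 1 / ((m : ℝ) + 1)) (by positivity)
  unfold truncKernel
  fun_prop

/-- The kernel is the increasing limit of continuous bounded functions, hence lower
semicontinuous. -/
lemma iSup_truncKernel (V : ℝ → ℝ) (C x y : ℝ) :
    ⨆ m : ℕ, ENNReal.ofReal (truncKernel V C m x y) = kernel V C x y := by
  have hmono : Monotone fun m : ℕ => ENNReal.ofReal (truncKernel V C m x y) := fun m k hmk =>
    ENNReal.ofReal_le_ofReal (truncKernel_mono V C x y hmk)
  refine iSup_eq_of_tendsto hmono ?_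
  unfold kernel
  split_ifs with hxy
  · subst hxy
    refine ENNReal.tendsto_ofReal_atTop.comp ?_
    have h1 : Tendsto (fun m : ℕ => V x / 2 + V x / 2 + regLog (1 / (m + 1)) (x - x) + 2 * C) atTop
        atTop := by
      have e : ∀ m : ℕ, V x / 2 + V x / 2 + regLog (1 / ((m : ℝ) + 1)) (x - x) + 2 * C =
          Real.log ((m : ℝ) + 1) + (V x + 2 * C) := fun m => by
        simp only [regLog, sub_self, one_div, inv_pow, Real.log_inv, Real.log_pow, ne_eq,
          OfNat.ofNat_ne_zero, not_false_eq_true, zero_pow, zero_add]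
        push_cast
        ring
      simp only [e]
      exact tendsto_atTop_add_const_right _ _ (Real.tendsto_log_atTop.comp
        (tendsto_atTop_add_const_right _ _ tendsto_natCast_atTop_atTop))
    refine tendsto_atTop.2 fun b => ?_
    filter_upwards [h1.eventually_ge_atTop b, tendsto_natCast_atTop_atTop.eventually_ge_atTop b]
      with m hm1 hm2
    exact le_min hm1 hm2
  · have hne : x - y ≠ 0 := sub_ne_zero.2 hxy
    refine ENNReal.tendsto_ofReal ?_
    have h1 : Tendsto (fun m : ℕ => V x / 2 + V y / 2 + regLog (1 / (m + 1)) (x - y) + 2 * C) atTop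
        (𝓝 (V x / 2 + V y / 2 - Real.log |x - y| + 2 * C)) :=
      ((tendsto_regLog hne).const_add _).add_const _
    refine h1.congr' ?_
    filter_upwards [tendsto_natCast_atTop_atTop.eventually_ge_atTop
      (V x / 2 + V y / 2 - Real.log |x - y| + 2 * C)] with m hm
    refine (min_eq_left ?_).symm
    have := regLog_le_neg_log (ε := 1 / ((m : ℝ) + 1)) hne
    linarith

lemma measurable_kernel (h : IsConfining V δ C) :
    Measurable fun p : ℝ × ℝ => kernel V C p.1 p.2 := by
  simp only [← iSup_truncKernel]
  exact Measurable.iSup fun m => (h.continuous_truncKernel m).measurable.ennreal_ofReal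

lemma kernelEnergy_eq_prod (h : IsConfining V δ C) (ν : Measure ℝ) [SFinite ν] :
    kernelEnergy V C ν = ∫⁻ p, kernel V C p.1 p.2 ∂(ν.prod ν) :=
  (lintegral_prod (fun p : ℝ × ℝ => kernel V C p.1 p.2) h.measurable_kernel.aemeasurable).symm

lemma kernelEnergy_eq_iSup (h : IsConfining V δ C) (ν : Measure ℝ) [SFinite ν] :
    kernelEnergy V C ν =
      ⨆ m : ℕ, ∫⁻ p, ENNReal.ofReal (truncKernel V C m p.1 p.2) ∂(ν.prod ν) := by
  rw [h.kernelEnergy_eq_prod, ← lintegral_iSup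
    (fun m => (h.continuous_truncKernel m).measurable.ennreal_ofReal)
    fun m k hmk p => ENNReal.ofReal_le_ofReal (truncKernel_mono V C p.1 p.2 hmk)]
  simp only [iSup_truncKernel]

lemma integrable_of_kernelEnergy_ne_top (h : IsConfining V δ C) {ν : Measure ℝ}
    [IsProbabilityMeasure ν] (hν : kernelEnergy V C ν ≠ ⊤) : Integrable V ν := by
  have hδ := h.pos
  have h1 : ∫⁻ x, ENNReal.ofReal (δ / (1 + δ) * (V x / 2 + C)) ∂ν ≠ ⊤ := by
    refine ne_top_of_le_ne_top hν (lintegral_mono fun x => ?_)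
    calc _ = ∫⁻ _, ENNReal.ofReal (δ / (1 + δ) * (V x / 2 + C)) ∂ν := by simp
      _ ≤ _ := lintegral_mono fun y => h.potential_le_kernel x y
  have hc : Continuous fun x => δ / (1 + δ) * (V x / 2 + C) :=
    continuous_const.mul ((h.continuous_potential.div_const 2).add continuous_const)
  have h2 : Integrable (fun x => δ / (1 + δ) * (V x / 2 + C)) ν := by
    refine (lintegral_ofReal_ne_top_iff_integrable hc.aestronglyMeasurable
      (ae_of_all _ fun x => ?_)).1 h1
    have h3 := h.growth x
    have h4 := log_one_add_abs_nonneg x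
    have : 0 ≤ V x / 2 + C := le_trans (by positivity) h3
    positivity
  have h3 := ((h2.const_mul ((1 + δ) / δ)).sub (integrable_const C)).const_mul 2
  refine h3.congr (ae_of_all _ fun x => ?_)
  simp only [Pi.sub_apply]
  field_simp
  ring

/-- The positive and the negative part of `-ln |x - y|`, in the form in which they enter
`logEnergy`. -/
lemma toENNReal_neg_log_edist {x y : ℝ} (hxy : x ≠ y) :
    (-(ENNReal.log (edist x y))).toENNReal = ENNReal.ofReal (-Real.log |x - y|) ∧
      (ENNReal.log (edist x y)).toENNReal = ENNReal.ofReal (Real.log |x - y|) := by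
  have h1 : 0 < |x - y| := abs_pos.2 (sub_ne_zero.2 hxy)
  rw [edist_dist, Real.dist_eq, ENNReal.log_ofReal_of_pos h1, ← EReal.coe_neg,
    EReal.real_coe_toENNReal, EReal.real_coe_toENNReal]
  exact ⟨rfl, rfl⟩

lemma measurable_log_edist : Measurable fun p : ℝ × ℝ => ENNReal.log (edist p.1 p.2) :=
  ENNReal.measurable_log.comp (continuous_edist.measurable)

lemma ofReal_add_ofReal_neg {a b : ℝ} (ha : 0 ≤ a) (hab : 0 ≤ a - b) :
    ENNReal.ofReal (a - b) + ENNReal.ofReal b = ENNReal.ofReal a + ENNReal.ofReal (-b) := by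
  rcases le_total 0 b with hb | hb
  · rw [← ENNReal.ofReal_add hab hb, ENNReal.ofReal_of_nonpos (by linarith : -b ≤ 0)]
    simp
  · rw [ENNReal.ofReal_of_nonpos hb, ← ENNReal.ofReal_add ha (by linarith), add_zero, sub_eq_add_neg]

lemma potential_add_nonneg (h : IsConfining V δ C) (x : ℝ) : 0 ≤ V x / 2 + C := by
  have h3 := h.growth x
  have h4 := log_one_add_abs_nonneg x
  have := h.pos
  exact le_trans (by positivity) h3

lemma kernel_add_log (h : IsConfining V δ C) (x y : ℝ) :
    kernel V C x y + (ENNReal.log (edist x y)).toENNReal =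
      ENNReal.ofReal (V x / 2 + C + (V y / 2 + C)) + (-(ENNReal.log (edist x y))).toENNReal := by
  have hx := h.potential_add_nonneg x
  have hy := h.potential_add_nonneg y
  by_cases hxy : x = y
  · subst hxy
    simp [kernel]
  · rw [(toENNReal_neg_log_edist hxy).1, (toENNReal_neg_log_edist hxy).2, kernel, if_neg hxy,
      ← ofReal_add_ofReal_neg (by positivity)]
    · congr 2
      ring
    · have := h.real_kernel_nonneg x y
      linarith

/-- The energy of the ensemble differs by a constant from the integral of the nonnegative
kernel. -/
lemma energy_add_eq (h : IsConfining V δ C) (ν : Measure ℝ) [IsProbabilityMeasure ν] :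
    energy V ν + ((2 * C : ℝ) : EReal) = (kernelEnergy V C ν : EReal) := by
  by_cases hV : Integrable V ν
  swap
  · have h1 : kernelEnergy V C ν = ⊤ := by
      by_contra hne
      exact hV (h.integrable_of_kernelEnergy_ne_top hne)
    rw [energy, if_neg hV, h1]
    exact EReal.top_add_coe _
  set A := ∫⁻ x, ∫⁻ y, (-(ENNReal.log (edist x y))).toENNReal ∂ν ∂ν
  set B := ∫⁻ x, ∫⁻ y, (ENNReal.log (edist x y)).toENNReal ∂ν ∂ν
  set P := ∫⁻ x, ∫⁻ y, ENNReal.ofReal (V x / 2 + C + (V y / 2 + C)) ∂ν ∂ν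
  have hc : Continuous fun x => V x / 2 + C := (h.continuous_potential.div_const 2).add_const C
  have hi : Integrable (fun x => V x / 2 + C) ν := (hV.div_const 2).add (integrable_const C)
  have hcm : Measurable fun p : ℝ × ℝ => ENNReal.ofReal (V p.1 / 2 + C + (V p.2 / 2 + C)) :=
    ((hc.comp continuous_fst).add (hc.comp continuous_snd)).measurable.ennreal_ofReal
  have hP : P = ENNReal.ofReal (∫ x, V x ∂ν + 2 * C) := by
    have e1 : P = ∫⁻ p, ENNReal.ofReal (V p.1 / 2 + C + (V p.2 / 2 + C)) ∂(ν.prod ν) :=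
      (lintegral_prod (fun p : ℝ × ℝ => ENNReal.ofReal (V p.1 / 2 + C + (V p.2 / 2 + C)))
        hcm.aemeasurable).symm
    have hi1 : Integrable (fun p : ℝ × ℝ => V p.1 / 2 + C) (ν.prod ν) := hi.comp_fst ν
    have hi2 : Integrable (fun p : ℝ × ℝ => V p.2 / 2 + C) (ν.prod ν) := hi.comp_snd ν
    have e2 := ofReal_integral_eq_lintegral_ofReal (hi1.add hi2) (ae_of_all _ fun p =>
      add_nonneg (h.potential_add_nonneg p.1) (h.potential_add_nonneg p.2))
    simp only [Pi.add_apply] at e2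
    rw [e1, ← e2, integral_add hi1 hi2, integral_fun_fst (fun x => V x / 2 + C),
      integral_fun_snd (fun x => V x / 2 + C), integral_add (hV.div_const 2) (integrable_const C),
      integral_div]
    simp only [probReal_univ, one_smul, integral_const]
    congr 1
    ring
  have hB : B ≠ ⊤ := by
    have h1 : B ≤ P := by
      refine lintegral_mono fun x => lintegral_mono fun y => ?_
      by_cases hxy : x = y
      · subst hxy; simp
      · rw [(toENNReal_neg_log_edist hxy).2]
        refine ENNReal.ofReal_le_ofReal ?_
        have h2 := h.real_kernel_nonneg x y
        linarith
    exact ne_top_of_le_ne_top (by rw [hP]; exact ENNReal.ofReal_ne_top) h1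
  have key : kernelEnergy V C ν + B = P + A := by
    have m1 : Measurable fun p : ℝ × ℝ => (ENNReal.log (edist p.1 p.2)).toENNReal :=
      measurable_ereal_toENNReal.comp measurable_log_edist
    have m3 := h.measurable_kernel
    have s1 : ∀ x : ℝ, ∫⁻ y, kernel V C x y + (ENNReal.log (edist x y)).toENNReal ∂ν =
        ∫⁻ y, kernel V C x y ∂ν + ∫⁻ y, (ENNReal.log (edist x y)).toENNReal ∂ν := fun x =>
      lintegral_add_right _ (m1.comp measurable_prodMk_left)
    have s2 : ∀ x : ℝ, ∫⁻ y, ENNReal.ofReal (V x / 2 + C + (V y / 2 + C)) +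
        (-(ENNReal.log (edist x y))).toENNReal ∂ν =
        ∫⁻ y, ENNReal.ofReal (V x / 2 + C + (V y / 2 + C)) ∂ν +
          ∫⁻ y, (-(ENNReal.log (edist x y))).toENNReal ∂ν := fun x =>
      lintegral_add_left (hcm.comp measurable_prodMk_left) _
    rw [kernelEnergy, ← lintegral_add_right _ m1.lintegral_prod_right',
      ← lintegral_add_left hcm.lintegral_prod_right']
    simp only [← s1, ← s2, h.kernel_add_log]
  have hnn : 0 ≤ ∫ x, V x ∂ν + 2 * C := by
    have := integral_nonneg (μ := ν) (f := fun x => V x / 2 + C) fun x => h.potential_add_nonneg x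
    rw [integral_add (hV.div_const 2) (integrable_const C), integral_div] at this
    simp at this
    linarith
  rw [energy, if_pos hV, logEnergy]
  change (((∫ x, V x ∂ν : ℝ) : EReal) + ((A : EReal) - (B : EReal))) + _ = _
  have hPr : (P : EReal) = ((∫ x, V x ∂ν + 2 * C : ℝ) : EReal) := by
    rw [hP, EReal.coe_ennreal_ofReal, max_eq_left hnn]
  have key' : (kernelEnergy V C ν : EReal) + (B : EReal) = (P : EReal) + (A : EReal) := by
    exact_mod_cast congrArg (fun t : ENNReal => (t : EReal)) key
  lift B to NNReal using hB with b
  have hb : ((b : ENNReal) : EReal) = ((b : ℝ) : EReal) := rfl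
  rw [hb] at key' ⊢
  have k2 : (kernelEnergy V C ν : EReal) = (P : EReal) + (A : EReal) - ((b : ℝ) : EReal) := by
    rw [← key', EReal.add_sub_cancel_right]
  rw [k2, hPr, EReal.coe_add, sub_eq_add_neg, sub_eq_add_neg]
  simp only [add_assoc]
  congr 1
  rw [add_comm (-((b : ℝ) : EReal)), add_left_comm]

end IsConfining

/-! ### Uniform measures on segments -/

/-- The uniform probability measure on the segment between `x` and `x + d`. -/
def segmentMeasure (x d : ℝ) : Measure ℝ :=
  (volume.restrict (Set.Icc (0 : ℝ) 1)).map fun u => x + d * u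

instance (x d : ℝ) : IsProbabilityMeasure (segmentMeasure x d) := by
  have : IsProbabilityMeasure (volume.restrict (Set.Icc (0 : ℝ) 1)) := ⟨by simp⟩
  exact Measure.isProbabilityMeasure_map (by fun_prop)

lemma lintegral_segmentMeasure (x d : ℝ) {f : ℝ → ENNReal} (hf : Measurable f) :
    ∫⁻ y, f y ∂(segmentMeasure x d) = ∫⁻ u in Set.Icc (0 : ℝ) 1, f (x + d * u) :=
  lintegral_map hf (by fun_prop)

lemma integrableOn_neg_log_abs_sub (w : ℝ) :
    IntegrableOn (fun u => -Real.log |w - u|) (Set.Icc 0 1) := by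
  have h1 : IntervalIntegrable (fun u => Real.log (w - u)) volume 0 1 := by
    have := (intervalIntegral.intervalIntegrable_log' (a := w - 0) (b := w - 1)).comp_sub_left w
    simpa using this
  have h2 := (intervalIntegrable_iff_integrableOn_Icc_of_le zero_le_one).1 h1
  simp only [Real.log_abs]
  exact h2.neg

/-- The average of `-ln |w - u|` over `u ∈ [0, 1]`. -/
lemma integral_neg_log_abs_sub (w : ℝ) :
    ∫ u in Set.Icc (0 : ℝ) 1, -Real.log |w - u| =
      (w - 1) * Real.log (w - 1) - w * Real.log w + 1 := by
  rw [integral_Icc_eq_integral_Ioc, ← intervalIntegral.integral_of_le zero_le_one]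
  simp only [Real.log_abs, intervalIntegral.integral_neg]
  rw [intervalIntegral.integral_comp_sub_left (fun v => Real.log v) w, integral_log]
  ring_nf

/-- The average of `-ln |w - u|` over `u ∈ [0, 1]` exceeds `-ln |w|` by at most a constant. -/
lemma integral_neg_log_abs_sub_le {w : ℝ} (hw : w ≠ 0) :
    ∫ u in Set.Icc (0 : ℝ) 1, -Real.log |w - u| ≤ -Real.log |w| + 2 := by
  rw [integral_neg_log_abs_sub, Real.log_abs]
  -- it remains to bound `s ln |s / w|` for `s = w - 1`
  have key : (w - 1) * (Real.log (w - 1) - Real.log w) ≤ 1 := by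
    rcases eq_or_ne (w - 1) 0 with h0 | h0
    · rw [h0]; simp
    have hq : Real.log (w - 1) - Real.log w = Real.log (|w - 1| / |w|) := by
      rw [Real.log_div (abs_ne_zero.2 h0) (abs_ne_zero.2 hw), Real.log_abs, Real.log_abs]
    have hw' := abs_pos.2 hw
    have h0' := abs_pos.2 h0
    rw [hq]
    rcases lt_or_ge w 0 with hneg | hpos
    · have : 0 ≤ Real.log (|w - 1| / |w|) := by
        refine Real.log_nonneg ((one_le_div hw').2 ?_)
        rw [abs_of_neg hneg, abs_of_neg (by linarith)]
        linarith
      nlinarith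
    rcases lt_or_ge (w - 1) 0 with h1 | h1
    · have h2 := Real.log_le_sub_one_of_pos (x := |w| / |w - 1|) (by positivity)
      have h3 : Real.log (|w - 1| / |w|) = -Real.log (|w| / |w - 1|) := by
        rw [← Real.log_inv, inv_div]
      rw [h3]
      have h4 : (w - 1) = -|w - 1| := by rw [abs_of_neg h1, neg_neg]
      calc (w - 1) * -Real.log (|w| / |w - 1|) = |w - 1| * Real.log (|w| / |w - 1|) := by
            nth_rewrite 1 [h4]; ring
        _ ≤ |w - 1| * (|w| / |w - 1| - 1) := by gcongr
        _ = |w| - |w - 1| := by field_simp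
        _ ≤ 1 := by rw [abs_of_nonneg hpos]; linarith [abs_nonneg (w - 1)]
    · have : Real.log (|w - 1| / |w|) ≤ 0 := by
        refine Real.log_nonpos (by positivity) ((div_le_one hw').2 ?_)
        rw [abs_of_nonneg h1, abs_of_nonneg hpos]
        linarith
      nlinarith
  linarith

/-- Far away, the average of `-ln |w - u|` over `u ∈ [0, 1]` is close to `-ln |w|`. -/
lemma integral_neg_log_abs_sub_le_of_lt {w : ℝ} (hw : 1 < |w|) :
    ∫ u in Set.Icc (0 : ℝ) 1, -Real.log |w - u| ≤ -Real.log |w| + 1 / (|w| - 1) := by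
  have h1 : ∀ u ∈ Set.Icc (0 : ℝ) 1, -Real.log |w - u| ≤ -Real.log |w| + 1 / (|w| - 1) := by
    intro u hu
    have h2 : |w| - 1 ≤ |w - u| := by
      have := abs_sub_abs_le_abs_sub w u
      rw [abs_of_nonneg hu.1] at this
      linarith [hu.2]
    have h3 : Real.log (|w| - 1) ≤ Real.log |w - u| := Real.log_le_log (by linarith) h2
    have h4 := Real.log_le_sub_one_of_pos (x := |w| / (|w| - 1)) (by
      apply div_pos <;> linarith)
    rw [Real.log_div (by linarith) (by linarith)] at h4
    have h5 : |w| / (|w| - 1) - 1 = 1 / (|w| - 1) := by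
      have : |w| - 1 ≠ 0 := by linarith
      field_simp
      ring
    linarith
  calc _ ≤ ∫ u in Set.Icc (0 : ℝ) 1, (-Real.log |w| + 1 / (|w| - 1)) :=
        setIntegral_mono_on (integrableOn_neg_log_abs_sub w) (by simp) measurableSet_Icc h1
    _ = _ := by simp

/-- The potential of the uniform measure on `[0, 1]` is bounded on `[0, 1]`. -/
lemma integral_neg_log_abs_sub_le_two {w : ℝ} (hw : w ∈ Set.Icc (0 : ℝ) 1) :
    ∫ u in Set.Icc (0 : ℝ) 1, -Real.log |w - u| ≤ 2 := by
  have key : ∀ t : ℝ, 0 ≤ t → -(t * Real.log t) ≤ 1 - t := by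
    intro t ht
    rcases ht.eq_or_lt with rfl | ht
    · simp
    · have h1 := Real.log_le_sub_one_of_pos (inv_pos.2 ht)
      rw [Real.log_inv] at h1
      have h2 := mul_le_mul_of_nonneg_left h1 ht.le
      have h3 : t * (t⁻¹ - 1) = 1 - t := by field_simp
      linarith
  have h1 := key w hw.1
  have h2 := key (1 - w) (by linarith [hw.2])
  have h3 : Real.log (w - 1) = Real.log (1 - w) := by rw [← Real.log_neg_eq_log, neg_sub]
  rw [integral_neg_log_abs_sub, h3]
  linarith

namespace IsConfining

variable {V : ℝ → ℝ} {δ C : ℝ}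

/-- The average of the kernel over a segment. -/
lemma lintegral_kernel_segment_le (h : IsConfining V δ C) {x d y A : ℝ} (hd : d ≠ 0)
    (hA : ∀ u ∈ Set.Icc (0 : ℝ) 1, V (x + d * u) / 2 ≤ A) :
    ∫⁻ u in Set.Icc (0 : ℝ) 1, kernel V C (x + d * u) y ≤
      ENNReal.ofReal (A + V y / 2 + 2 * C - Real.log |d| +
        ∫ u in Set.Icc (0 : ℝ) 1, -Real.log |(y - x) / d - u|) := by
  have hprob : IsProbabilityMeasure (volume.restrict (Set.Icc (0 : ℝ) 1)) := ⟨by simp⟩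
  set w := (y - x) / d
  have hw : y = x + d * w := by simp only [w]; field_simp; ring
  set M := A + V y / 2 + 2 * C - Real.log |d|
  have hne : ∀ᵐ u ∂(volume.restrict (Set.Icc (0 : ℝ) 1)), u ≠ w :=
    ae_restrict_of_ae (Measure.ae_ne volume w)
  have hpt : ∀ᵐ u ∂(volume.restrict (Set.Icc (0 : ℝ) 1)),
      kernel V C (x + d * u) y ≤ ENNReal.ofReal (M + -Real.log |w - u|) ∧
        0 ≤ M + -Real.log |w - u| := by
    filter_upwards [hne, ae_restrict_mem measurableSet_Icc] with u hu hu1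
    have hxy : x + d * u ≠ y := by
      rw [hw]
      intro h'
      exact hu (mul_left_cancel₀ hd (by linarith))
    have habs : |x + d * u - y| = |d| * |w - u| := by
      rw [← abs_mul, hw, ← abs_neg]
      ring_nf
    have hlog : Real.log |x + d * u - y| = Real.log |d| + Real.log |w - u| := by
      rw [habs, Real.log_mul (abs_ne_zero.2 hd) (abs_ne_zero.2 (sub_ne_zero.2 hu.symm))]
    have h1 := hA u hu1
    have h2 := h.real_kernel_nonneg (x + d * u) y
    rw [hlog] at h2
    have h3 : V (x + d * u) / 2 + V y / 2 - (Real.log |d| + Real.log |w - u|) + 2 * C ≤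
        M + -Real.log |w - u| := by
      simp only [M]; linarith
    refine ⟨?_, h2.trans h3⟩
    rw [kernel, if_neg hxy, hlog]
    exact ENNReal.ofReal_le_ofReal h3
  have hint := integrableOn_neg_log_abs_sub w
  calc _ ≤ ∫⁻ u in Set.Icc (0 : ℝ) 1, ENNReal.ofReal (M + -Real.log |w - u|) :=
        lintegral_mono_ae (hpt.mono fun u hu => hu.1)
    _ = ENNReal.ofReal (∫ u in Set.Icc (0 : ℝ) 1, (M + -Real.log |w - u|)) :=
        (ofReal_integral_eq_lintegral_ofReal ((integrable_const M).add hint)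
          (hpt.mono fun u hu => hu.2)).symm
    _ = _ := by
        rw [integral_add (integrable_const M) hint]
        simp

lemma measurable_kernel_right (h : IsConfining V δ C) (x : ℝ) : Measurable (kernel V C x) :=
  h.measurable_kernel.comp measurable_prodMk_left

lemma exists_potential_le (h : IsConfining V δ C) (x d : ℝ) :
    ∃ A, ∀ u ∈ Set.Icc (0 : ℝ) 1, V (x + d * u) / 2 ≤ A := by
  have hc : Continuous fun u => V (x + d * u) / 2 := by
    have := h.continuous_potential
    fun_prop
  obtain ⟨A, hA⟩ := (isCompact_Icc (a := (0 : ℝ)) (b := 1)).bddAbove_image hc.continuousOn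
  exact ⟨A, fun u hu => hA ⟨u, hu, rfl⟩⟩

lemma kernelEnergy_segmentMeasure_ne_top (h : IsConfining V δ C) (x : ℝ) {d : ℝ} (hd : d ≠ 0) :
    kernelEnergy V C (segmentMeasure x d) ≠ ⊤ := by
  obtain ⟨A, hA⟩ := h.exists_potential_le x d
  have h1 : ∀ u ∈ Set.Icc (0 : ℝ) 1, ∫⁻ y, kernel V C (x + d * u) y ∂(segmentMeasure x d) ≤
      ENNReal.ofReal (A + A + 2 * C - Real.log |d| + 2) := by
    intro u hu
    rw [lintegral_segmentMeasure x d (h.measurable_kernel_right _)]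
    simp only [kernel_comm V C (x + d * u)]
    refine (h.lintegral_kernel_segment_le hd hA).trans (ENNReal.ofReal_le_ofReal ?_)
    have h2 : (x + d * u - x) / d = u := by field_simp; ring
    rw [h2]
    have := integral_neg_log_abs_sub_le_two hu
    have := hA u hu
    linarith
  have hm : Measurable fun z => ∫⁻ y, kernel V C z y ∂(segmentMeasure x d) :=
    h.measurable_kernel.lintegral_prod_right'
  rw [kernelEnergy, lintegral_segmentMeasure x d hm]
  refine ne_top_of_le_ne_top (ENNReal.ofReal_ne_top (r := A + A + 2 * C - Real.log |d| + 2)) ?_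
  calc _ ≤ ∫⁻ u in Set.Icc (0 : ℝ) 1, ENNReal.ofReal (A + A + 2 * C - Real.log |d| + 2) :=
        setLIntegral_mono' measurableSet_Icc h1
    _ = _ := by simp

/-! ### Existence of a minimiser -/

lemma continuous_lintegral_truncKernel (h : IsConfining V δ C) (m : ℕ) :
    Continuous fun ν : ProbabilityMeasure ℝ =>
      ∫⁻ p, ENNReal.ofReal (truncKernel V C m p.1 p.2) ∂((ν : Measure ℝ).prod ν) := by
  let f : BoundedContinuousFunction (ℝ × ℝ) NNReal :=
    BoundedContinuousFunction.mkOfBound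
      ⟨fun p => (truncKernel V C m p.1 p.2).toNNReal,
        continuous_real_toNNReal.comp (h.continuous_truncKernel m)⟩ m (fun p q => by
        have b : ∀ p : ℝ × ℝ, 0 ≤ truncKernel V C m p.1 p.2 ∧ truncKernel V C m p.1 p.2 ≤ m :=
          fun p => ⟨h.truncKernel_nonneg m _ _, min_le_right _ _⟩
        rw [NNReal.dist_eq]
        simp only [ContinuousMap.coe_mk]
        rw [Real.coe_toNNReal _ (b p).1, Real.coe_toNNReal _ (b q).1, abs_le]
        constructor <;> linarith [(b p).1, (b q).1, (b p).2, (b q).2])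
  refine continuous_iff_continuousAt.2 fun ν => ?_
  have h1 : Tendsto (fun ν' : ProbabilityMeasure ℝ => ν'.prod ν') (𝓝 ν) (𝓝 (ν.prod ν)) :=
    (ProbabilityMeasure.continuous_prod.comp (continuous_id.prodMk continuous_id)).tendsto ν
  exact ProbabilityMeasure.tendsto_iff_forall_lintegral_tendsto.1 h1 f

lemma lowerSemicontinuous_kernelEnergy (h : IsConfining V δ C) :
    LowerSemicontinuous fun ν : ProbabilityMeasure ℝ => kernelEnergy V C (ν : Measure ℝ) := by
  simp only [h.kernelEnergy_eq_iSup]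
  exact lowerSemicontinuous_iSup fun m =>
    (h.continuous_lintegral_truncKernel m).lowerSemicontinuous

lemma isClosed_setOf_measure_compl_eq_zero {S : Set ℝ} (hS : IsClosed S) :
    IsClosed {ν : ProbabilityMeasure ℝ | (ν : Measure ℝ) Sᶜ = 0} := by
  refine isClosed_of_closure_subset fun ν hν => ?_
  have hne := mem_closure_iff_nhdsWithin_neBot.1 hν
  have h1 : Tendsto id (𝓝[{ν : ProbabilityMeasure ℝ | (ν : Measure ℝ) Sᶜ = 0}] ν) (𝓝 ν) :=
    nhdsWithin_le_nhds
  have h2 := ProbabilityMeasure.le_liminf_measure_open_of_tendsto h1 hS.isOpen_compl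
  have h3 : liminf (fun ν' : ProbabilityMeasure ℝ => ((id ν' : ProbabilityMeasure ℝ) : Measure ℝ) Sᶜ)
      (𝓝[{ν : ProbabilityMeasure ℝ | (ν : Measure ℝ) Sᶜ = 0}] ν) = 0 := by
    refine (liminf_congr (v := fun _ => 0) ?_).trans (liminf_const 0)
    exact eventually_mem_nhdsWithin
  exact le_antisymm (h2.trans h3.le) bot_le

/-- By the logarithmic growth of the kernel, sublevel sets of the energy are tight. -/
lemma isTightMeasureSet_kernelEnergy_le (h : IsConfining V δ C) (M : NNReal) :
    IsTightMeasureSet {ν : Measure ℝ | IsProbabilityMeasure ν ∧ kernelEnergy V C ν ≤ M} := by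
  rw [isTightMeasureSet_iff_exists_isCompact_measure_compl_le]
  intro η hη
  have hδ := h.pos
  rcases eq_or_ne η ⊤ with rfl | hηtop
  · exact ⟨∅, isCompact_empty, fun _ _ => le_top⟩
  have hη' : 0 < η.toReal := ENNReal.toReal_pos hη.ne' hηtop
  set R := Real.exp ((M + 1) / (δ * η.toReal))
  refine ⟨Set.Icc (-R) R, isCompact_Icc, fun ν hν => ?_⟩
  have := hν.1
  set c := δ * Real.log (1 + R)
  have hc : (M + 1) / η.toReal ≤ c := by
    have h1 : (M + 1) / (δ * η.toReal) ≤ Real.log (1 + R) := by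
      rw [Real.le_log_iff_exp_le (by positivity)]
      linarith
    have h2 := mul_le_mul_of_nonneg_left h1 hδ.le
    refine le_trans (le_of_eq ?_) h2
    field_simp
  have hcpos : 0 < c := lt_of_lt_of_le (by positivity) hc
  have h1 : ENNReal.ofReal c * ν (Set.Icc (-R) R)ᶜ ≤ M := by
    refine le_trans ?_ hν.2
    calc _ = ∫⁻ x in (Set.Icc (-R) R)ᶜ, ENNReal.ofReal c ∂ν := by rw [setLIntegral_const]
      _ ≤ ∫⁻ x in (Set.Icc (-R) R)ᶜ, (∫⁻ y, kernel V C x y ∂ν) ∂ν := by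
          refine setLIntegral_mono' measurableSet_Icc.compl fun x hx => ?_
          have hxR : R ≤ |x| := by
            by_contra hlt
            exact hx (abs_le.1 (not_le.1 hlt).le)
          have h3 : c ≤ δ * Real.log (1 + |x|) := by
            have : Real.log (1 + R) ≤ Real.log (1 + |x|) :=
              Real.log_le_log (by positivity) (by linarith)
            exact mul_le_mul_of_nonneg_left this hδ.le
          calc ENNReal.ofReal c ≤ ∫⁻ _, ENNReal.ofReal (δ * Real.log (1 + |x|)) ∂ν := by
                simpa using ENNReal.ofReal_le_ofReal h3
            _ ≤ _ := lintegral_mono fun y => h.le_kernel x y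
      _ ≤ _ := setLIntegral_le_lintegral _ _
  have h2 : (M : ENNReal) ≤ ENNReal.ofReal c * η := by
    rw [← ENNReal.ofReal_toReal hηtop, ← ENNReal.ofReal_mul hcpos.le, ← ENNReal.ofReal_coe_nnreal]
    refine ENNReal.ofReal_le_ofReal ?_
    rw [div_le_iff₀ hη'] at hc
    linarith
  exact (ENNReal.mul_le_mul_iff_right (by simpa using hcpos) ENNReal.ofReal_ne_top).1 (h1.trans h2)

/-- The sublevel sets of the energy are closed and tight, hence compact, and a minimum is attained. -/
lemma exists_isMinimizer (h : IsConfining V δ C) {S : Set ℝ} (hS : IsClosed S)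
    (hne : ∃ ν : Measure ℝ, IsProbabilityMeasure ν ∧ ν Sᶜ = 0 ∧ kernelEnergy V C ν ≠ ⊤) :
    ∃ μ : Measure ℝ, IsProbabilityMeasure μ ∧ μ Sᶜ = 0 ∧
      ∀ ν : Measure ℝ, IsProbabilityMeasure ν → ν Sᶜ = 0 →
        kernelEnergy V C μ ≤ kernelEnergy V C ν := by
  obtain ⟨ν₀, hν₀, hν₀S, hν₀E⟩ := hne
  lift kernelEnergy V C ν₀ to NNReal using hν₀E with M hM
  set K := {ν : ProbabilityMeasure ℝ | (ν : Measure ℝ) Sᶜ = 0} ∩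
    (fun ν : ProbabilityMeasure ℝ => kernelEnergy V C (ν : Measure ℝ)) ⁻¹' Set.Iic (M : ENNReal)
  have hKcl : IsClosed K := (isClosed_setOf_measure_compl_eq_zero hS).inter
    (h.lowerSemicontinuous_kernelEnergy.isClosed_preimage _)
  have hK : IsCompact K := by
    have h1 : IsTightMeasureSet {x : Measure ℝ | ∃ μ ∈ K, (μ : Measure ℝ) = x} := by
      refine (h.isTightMeasureSet_kernelEnergy_le M).subset ?_
      rintro x ⟨μ, hμ, rfl⟩
      exact ⟨inferInstance, hμ.2⟩
    simpa [hKcl.closure_eq] using isCompact_closure_of_isTightMeasureSet h1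
  have hmem : (⟨ν₀, hν₀⟩ : ProbabilityMeasure ℝ) ∈ K := ⟨hν₀S, hM.ge⟩
  have hKne : K.Nonempty := ⟨_, hmem⟩
  obtain ⟨μ, hμ, hmin⟩ := LowerSemicontinuousOn.exists_isMinOn hKne hK
    (h.lowerSemicontinuous_kernelEnergy.lowerSemicontinuousOn K)
  refine ⟨μ, inferInstance, hμ.1, fun ν hν hνS => ?_⟩
  rcases le_total (kernelEnergy V C ν) M with h1 | h1
  · exact hmin (show (⟨ν, hν⟩ : ProbabilityMeasure ℝ) ∈ K from ⟨hνS, h1⟩)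
  · exact hμ.2.trans h1

end IsConfining

/-! ### The Euler-Lagrange conditions -/

/-- The potential of `μ` for the nonnegative kernel. -/
def kernelPot (V : ℝ → ℝ) (C : ℝ) (μ : Measure ℝ) (x : ℝ) : ENNReal := ∫⁻ y, kernel V C x y ∂μ

/-- `μ` is a minimiser, of finite energy, of `kernelEnergy` among the probability measures on an
interval `S`. -/
structure IsKernelMinimizer (V : ℝ → ℝ) (δ C : ℝ) (S : Set ℝ) (μ : Measure ℝ) : Prop where
  isConfining : IsConfining V δ C
  isClosed : IsClosed S
  ordConnected : S.OrdConnected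
  nontrivial : ∃ p q, p < q ∧ p ∈ S ∧ q ∈ S
  isProbabilityMeasure : IsProbabilityMeasure μ
  compl_null : μ Sᶜ = 0
  energy_le : ∀ ν : Measure ℝ, IsProbabilityMeasure ν → ν Sᶜ = 0 →
    kernelEnergy V C μ ≤ kernelEnergy V C ν

lemma segmentMeasure_compl {S : Set ℝ} (hS : MeasurableSet S) {x d : ℝ}
    (h : ∀ u ∈ Set.Icc (0 : ℝ) 1, x + d * u ∈ S) : segmentMeasure x d Sᶜ = 0 := by
  rw [segmentMeasure, Measure.map_apply (by fun_prop) hS.compl,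
    Measure.restrict_apply' measurableSet_Icc]
  convert measure_empty (μ := (volume : Measure ℝ))
  ext u
  simp only [Set.mem_inter_iff, Set.mem_preimage, Set.mem_compl_iff, Set.mem_empty_iff_false,
    iff_false, not_and]
  exact fun h1 hu => h1 (h u hu)

lemma add_mul_mem_of_ordConnected {S : Set ℝ} (hS : S.OrdConnected) {x y : ℝ} (hx : x ∈ S)
    (hy : y ∈ S) {u : ℝ} (hu : u ∈ Set.Icc (0 : ℝ) 1) : x + (y - x) * u ∈ S := by
  refine hS.uIcc_subset hx hy ?_
  rw [Set.mem_uIcc]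
  rcases le_total x y with h | h
  · left; constructor <;> nlinarith [hu.1, hu.2]
  · right; constructor <;> nlinarith [hu.1, hu.2]

/-- A quadratic in `t` that starts at its minimum `E` has a nonnegative derivative `2 (M - E)`
there. -/
lemma le_of_forall_quadratic {E M N : ℝ}
    (h : ∀ t ∈ Set.Ioo (0 : ℝ) 1, E ≤ (1 - t) ^ 2 * E + 2 * (t * (1 - t)) * M + t ^ 2 * N) :
    E ≤ M := by
  by_contra hlt
  have hD : 0 < E - M := sub_pos.2 (not_le.1 hlt)
  set X := |E - 2 * M + N|
  have hX : 0 ≤ X := abs_nonneg _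
  have hX' : E - 2 * M + N ≤ X := le_abs_self _
  set t := min (1 / 2) ((E - M) / (X + 1))
  have ht0 : 0 < t := lt_min (by norm_num) (by positivity)
  have ht1 : t ≤ 1 / 2 := min_le_left _ _
  have ht2 : t * (X + 1) ≤ E - M := (le_div_iff₀ (by positivity)).1 (min_le_right _ _)
  have h1 := h t ⟨ht0, by linarith⟩
  have h2 : 2 * t * (E - M) ≤ t * (t * (E - 2 * M + N)) := by linarith
  have h3 : 2 * (E - M) ≤ t * (E - 2 * M + N) := by
    have : t * (2 * (E - M)) ≤ t * (t * (E - 2 * M + N)) := by linarith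
    exact le_of_mul_le_mul_left this ht0
  have h4 : t * (E - 2 * M + N) ≤ t * X := mul_le_mul_of_nonneg_left hX' ht0.le
  linarith

lemma IsConfining.measurable_kernelPot {V : ℝ → ℝ} {δ C : ℝ} (h : IsConfining V δ C)
    (μ : Measure ℝ) [SFinite μ] : Measurable (kernelPot V C μ) :=
  h.measurable_kernel.lintegral_prod_right'

/-- The energy of a mixture. -/
lemma IsConfining.kernelEnergy_mix {V : ℝ → ℝ} {δ C : ℝ} (h : IsConfining V δ C)
    (μ ν : Measure ℝ) [SFinite μ] [SFinite ν] {t : ℝ} (ht : t ∈ Set.Ioo (0 : ℝ) 1) :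
    kernelEnergy V C (ENNReal.ofReal (1 - t) • μ + ENNReal.ofReal t • ν) =
      ENNReal.ofReal ((1 - t) ^ 2) * kernelEnergy V C μ +
        ENNReal.ofReal (2 * (t * (1 - t))) * (∫⁻ x, kernelPot V C μ x ∂ν) +
        ENNReal.ofReal (t ^ 2) * kernelEnergy V C ν := by
  have h1 : (0 : ℝ) ≤ 1 - t := by linarith [ht.2]
  have h0 := ht.1.le
  have hswap : ∫⁻ x, kernelPot V C ν x ∂μ = ∫⁻ x, kernelPot V C μ x ∂ν := by
    unfold kernelPot
    rw [lintegral_lintegral_swap h.measurable_kernel.aemeasurable]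
    simp only [fun x y => IsConfining.kernel_comm V C x y]
  have e : ∀ x, ∫⁻ y, kernel V C x y ∂(ENNReal.ofReal (1 - t) • μ + ENNReal.ofReal t • ν) =
      ENNReal.ofReal (1 - t) * kernelPot V C μ x + ENNReal.ofReal t * kernelPot V C ν x := by
    intro x
    rw [lintegral_add_measure, lintegral_smul_measure, lintegral_smul_measure]
    rfl
  have hμ := h.measurable_kernelPot μ
  have hν := h.measurable_kernelPot ν
  have hE : ∀ ρ : Measure ℝ, ∫⁻ x, kernelPot V C ρ x ∂ρ = kernelEnergy V C ρ := fun ρ => rfl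
  rw [kernelEnergy]
  simp only [e]
  rw [lintegral_add_measure, lintegral_smul_measure, lintegral_smul_measure,
    lintegral_add_left (hμ.const_mul _), lintegral_add_left (hμ.const_mul _),
    lintegral_const_mul _ hμ, lintegral_const_mul _ hμ, lintegral_const_mul _ hν,
    lintegral_const_mul _ hν, hswap, hE, hE, two_mul, ENNReal.ofReal_add (by positivity)
    (by positivity), ENNReal.ofReal_mul h0, ENNReal.ofReal_pow h1, ENNReal.ofReal_pow h0]
  simp only [smul_eq_mul]
  ring

namespace IsKernelMinimizer

variable {V : ℝ → ℝ} {δ C : ℝ} {S : Set ℝ} {μ : Measure ℝ}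

lemma energy_ne_top (h : IsKernelMinimizer V δ C S μ) : kernelEnergy V C μ ≠ ⊤ := by
  obtain ⟨p, q, hpq, hp, hq⟩ := h.nontrivial
  refine ne_top_of_le_ne_top (h.isConfining.kernelEnergy_segmentMeasure_ne_top p
    (sub_ne_zero.2 hpq.ne')) (h.energy_le _ inferInstance ?_)
  exact segmentMeasure_compl h.isClosed.measurableSet fun u hu =>
    add_mul_mem_of_ordConnected h.ordConnected hp hq hu

/-- The first variation of the energy at the minimiser is nonnegative. -/
lemma energy_le_lintegral_kernelPot (h : IsKernelMinimizer V δ C S μ) {ν : Measure ℝ}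
    [IsProbabilityMeasure ν] (hνS : ν Sᶜ = 0) (hν : kernelEnergy V C ν ≠ ⊤) :
    kernelEnergy V C μ ≤ ∫⁻ x, kernelPot V C μ x ∂ν := by
  have := h.isProbabilityMeasure
  have hE := h.energy_ne_top
  by_cases hM : ∫⁻ x, kernelPot V C μ x ∂ν = ⊤
  · rw [hM]; exact le_top
  rw [← ENNReal.toReal_le_toReal hE hM]
  refine le_of_forall_quadratic (N := (kernelEnergy V C ν).toReal) fun t ht => ?_
  have h1 : (0 : ℝ) ≤ 1 - t := by linarith [ht.2]
  have h0 := ht.1.le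
  have hprob : IsProbabilityMeasure (ENNReal.ofReal (1 - t) • μ + ENNReal.ofReal t • ν) :=
    ⟨by simp [← ENNReal.ofReal_add h1 h0]⟩
  have h2 := h.energy_le _ hprob (by simp [h.compl_null, hνS])
  rw [h.isConfining.kernelEnergy_mix μ ν ht] at h2
  have h3 := ENNReal.toReal_mono (by finiteness) h2
  rwa [ENNReal.toReal_add (by finiteness) (by finiteness), ENNReal.toReal_add (by finiteness)
    (by finiteness), ENNReal.toReal_mul, ENNReal.toReal_mul, ENNReal.toReal_mul,
    ENNReal.toReal_ofReal (by positivity), ENNReal.toReal_ofReal (by positivity),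
    ENNReal.toReal_ofReal (by positivity)] at h3

/-- The kernel is infinite on the diagonal, so that a point with a finite potential has no mass. -/
lemma measure_singleton_of_kernelPot_ne_top {x : ℝ} (hx : kernelPot V C μ x ≠ ⊤) :
    μ {x} = 0 := by
  by_contra hne
  refine hx (top_unique ?_)
  calc (⊤ : ENNReal) = ⊤ * μ {x} := (ENNReal.top_mul hne).symm
    _ = ∫⁻ y in {x}, kernel V C x y ∂μ := by
        rw [Measure.restrict_singleton, lintegral_smul_measure, lintegral_dirac, kernel,
          if_pos rfl, smul_eq_mul, mul_comm]
    _ ≤ _ := setLIntegral_le_lintegral _ _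

/-- The Euler-Lagrange inequality, from the variation towards uniform measures on small segments
starting at `x`. -/
lemma energy_le_kernelPot (h : IsKernelMinimizer V δ C S μ) {x : ℝ} (hx : x ∈ S) :
    kernelEnergy V C μ ≤ kernelPot V C μ x := by
  have := h.isProbabilityMeasure
  have hcf := h.isConfining
  have hE := h.energy_ne_top
  by_contra hlt
  push Not at hlt
  have hF := hlt.ne_top
  set η := ((kernelEnergy V C μ).toReal - (kernelPot V C μ x).toReal) / 8
  have hη : 0 < η := by
    have := (ENNReal.toReal_lt_toReal hF hE).2 hlt
    simp only [η]; linarith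
  have hcontra : kernelPot V C μ x + ENNReal.ofReal (4 * η) < kernelEnergy V C μ := by
    rw [← ENNReal.ofReal_toReal hF, ← ENNReal.ofReal_toReal hE,
      ← ENNReal.ofReal_add ENNReal.toReal_nonneg (by positivity)]
    refine (ENNReal.ofReal_lt_ofReal_iff_of_nonneg (by positivity)).2 ?_
    have : 8 * η = (kernelEnergy V C μ).toReal - (kernelPot V C μ x).toReal := by
      simp only [η]; ring
    linarith
  -- a ball around `x` with small mass
  obtain ⟨ρ, hρ, hball⟩ : ∃ ρ > 0, μ (Metric.ball x ρ) ≤ ENNReal.ofReal η := by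
    obtain ⟨U, hxU, hU, hμU⟩ := Set.exists_isOpen_lt_of_lt (μ := μ) {x} (ENNReal.ofReal η)
      (by rw [measure_singleton_of_kernelPot_ne_top hF]; simpa using hη)
    obtain ⟨ρ, hρ, hρU⟩ := Metric.isOpen_iff.1 hU x (hxU rfl)
    exact ⟨ρ, hρ, (measure_mono hρU).trans hμU.le⟩
  obtain ⟨r, hr, hV⟩ := Metric.continuousAt_iff.1
    (hcf.continuous_potential.continuousAt (x := x)) (2 * η) (by positivity)
  -- a direction from `x` into `S`
  obtain ⟨d₀, hd₀, hdS⟩ : ∃ d₀ : ℝ, d₀ ≠ 0 ∧ ∀ u ∈ Set.Icc (0 : ℝ) 1, x + d₀ * u ∈ S := by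
    obtain ⟨p, q, hpq, hp, hq⟩ := h.nontrivial
    rcases lt_or_ge x q with hxq | hxq
    · exact ⟨q - x, by linarith, fun u hu => add_mul_mem_of_ordConnected h.ordConnected hx hq hu⟩
    · exact ⟨p - x, by linarith, fun u hu => add_mul_mem_of_ordConnected h.ordConnected hx hp hu⟩
  have hd₀' := abs_pos.2 hd₀
  set κ := ρ * η / (1 + η)
  have hκ : 0 < κ := by positivity
  set s := min 1 (min (κ / |d₀|) (r / 2 / |d₀|))
  have hs : 0 < s := lt_min one_pos (lt_min (by positivity) (by positivity))
  have hs1 : s ≤ 1 := min_le_left _ _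
  have hs2 : s * |d₀| ≤ κ := (le_div_iff₀ hd₀').1 ((min_le_right _ _).trans (min_le_left _ _))
  have hs3 : s * |d₀| ≤ r / 2 := (le_div_iff₀ hd₀').1 ((min_le_right _ _).trans (min_le_right _ _))
  set d := s * d₀
  have hdabs : |d| = s * |d₀| := by rw [abs_mul, abs_of_pos hs]
  have hd : d ≠ 0 := mul_ne_zero hs.ne' hd₀
  have hdpos := abs_pos.2 hd
  have hdS' : ∀ u ∈ Set.Icc (0 : ℝ) 1, x + d * u ∈ S := fun u hu => by
    have := hdS (s * u) ⟨mul_nonneg hs.le hu.1, mul_le_one₀ hs1 hu.1 hu.2⟩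
    rwa [show d * u = d₀ * (s * u) by simp only [d]; ring]
  have hA : ∀ u ∈ Set.Icc (0 : ℝ) 1, V (x + d * u) / 2 ≤ V x / 2 + η := fun u hu => by
    have h1 : dist (x + d * u) x < r := by
      rw [Real.dist_eq, add_sub_cancel_left, abs_mul, abs_of_nonneg hu.1]
      nlinarith [hu.2]
    have h2 := hV h1
    rw [Real.dist_eq, abs_lt] at h2
    linarith [h2.2]
  -- the average of the kernel over the segment, near `x` and away from `x`
  have hpt : ∀ y, ∫⁻ u in Set.Icc (0 : ℝ) 1, kernel V C (x + d * u) y ≤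
      kernel V C x y + (ENNReal.ofReal (2 * η) +
        (Metric.ball x ρ).indicator (fun _ => ENNReal.ofReal 2) y) := by
    intro y
    by_cases hxy : x = y
    · rw [kernel, if_pos hxy, top_add]; exact le_top
    have hyx : y - x ≠ 0 := sub_ne_zero.2 (Ne.symm hxy)
    have hw : (y - x) / d ≠ 0 := div_ne_zero hyx hd
    have hlog : Real.log |(y - x) / d| = Real.log |x - y| - Real.log |d| := by
      rw [abs_div, Real.log_div (abs_ne_zero.2 hyx) (abs_ne_zero.2 hd), abs_sub_comm]
    refine (hcf.lintegral_kernel_segment_le hd hA).trans ?_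
    have hk := hcf.real_kernel_nonneg x y
    rw [kernel, if_neg hxy]
    by_cases hyb : y ∈ Metric.ball x ρ
    · rw [Set.indicator_of_mem hyb, ← ENNReal.ofReal_add (by positivity) (by norm_num),
        ← ENNReal.ofReal_add hk (by positivity)]
      have h1 := integral_neg_log_abs_sub_le hw
      rw [hlog] at h1
      exact ENNReal.ofReal_le_ofReal (by linarith)
    · rw [Set.indicator_of_notMem hyb, add_zero, ← ENNReal.ofReal_add hk (by positivity)]
      have hyρ : ρ ≤ |y - x| := by
        rw [Metric.mem_ball, Real.dist_eq] at hyb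
        exact not_lt.1 hyb
      have hw1 : (1 + η) / η ≤ |(y - x) / d| := by
        rw [abs_div, div_le_div_iff₀ hη hdpos]
        have h2 : |d| ≤ ρ * η / (1 + η) := hdabs ▸ hs2
        rw [le_div_iff₀ (by positivity)] at h2
        nlinarith
      have hw2 : (1 + η) / η = 1 / η + 1 := by field_simp
      have hη1 : 0 < 1 / η := by positivity
      have h1 := integral_neg_log_abs_sub_le_of_lt (w := (y - x) / d) (by linarith)
      have h3 : 1 / (|(y - x) / d| - 1) ≤ η := by
        rw [div_le_iff₀ (by linarith)]
        have : η * (1 / η) = 1 := by field_simp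
        nlinarith
      rw [hlog] at h1
      exact ENNReal.ofReal_le_ofReal (by linarith)
  have hvar := h.energy_le_lintegral_kernelPot
    (segmentMeasure_compl h.isClosed.measurableSet hdS')
    (hcf.kernelEnergy_segmentMeasure_ne_top x hd)
  refine absurd (hvar.trans ?_) (not_le.2 hcontra)
  have hm : Measurable fun p : ℝ × ℝ => kernel V C (x + d * p.1) p.2 :=
    hcf.measurable_kernel.comp (by fun_prop : Measurable fun p : ℝ × ℝ => (x + d * p.1, p.2))
  rw [lintegral_segmentMeasure x d (hcf.measurable_kernelPot μ)]
  unfold kernelPot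
  rw [lintegral_lintegral_swap hm.aemeasurable]
  refine (lintegral_mono hpt).trans ?_
  rw [lintegral_add_left (hcf.measurable_kernel_right x), lintegral_add_left measurable_const,
    lintegral_indicator_const Metric.isOpen_ball.measurableSet, lintegral_const, measure_univ,
    mul_one]
  gcongr
  calc _ ≤ ENNReal.ofReal (2 * η) + ENNReal.ofReal 2 * ENNReal.ofReal η := by gcongr
    _ = _ := by
      rw [← ENNReal.ofReal_mul (by norm_num), ← ENNReal.ofReal_add (by positivity) (by positivity)]
      congr 1
      ring

/-- On the support, equality holds in the Euler-Lagrange inequality. -/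
lemma kernelPot_le_energy (h : IsKernelMinimizer V δ C S μ) {x : ℝ} (hx : x ∈ μ.support) :
    kernelPot V C μ x ≤ kernelEnergy V C μ := by
  have := h.isProbabilityMeasure
  have hcf := h.isConfining
  have hE := h.energy_ne_top
  by_contra hlt
  push Not at hlt
  have hsup : ∀ z, kernelPot V C μ z =
      ⨆ m : ℕ, ∫⁻ y, ENNReal.ofReal (truncKernel V C m z y) ∂μ := by
    intro z
    rw [kernelPot, ← lintegral_iSup (f := fun m y => ENNReal.ofReal (truncKernel V C m z y))
      (fun m => ((hcf.continuous_truncKernel m).comp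
        (Continuous.prodMk_right z)).measurable.ennreal_ofReal)
      fun m k hmk y => ENNReal.ofReal_le_ofReal (IsConfining.truncKernel_mono V C z y hmk)]
    simp only [IsConfining.iSup_truncKernel]
  rw [hsup] at hlt
  obtain ⟨m, hm⟩ := lt_iSup_iff.1 hlt
  have hint : ∀ z, Integrable (fun y => truncKernel V C m z y) μ := fun z =>
    (integrable_const (m : ℝ)).mono' ((hcf.continuous_truncKernel m).comp
      (Continuous.prodMk_right z)).aestronglyMeasurable (ae_of_all _ fun y => by
        rw [Real.norm_eq_abs, abs_of_nonneg (hcf.truncKernel_nonneg m z y)]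
        exact min_le_right _ _)
  have e : ∀ z, ∫⁻ y, ENNReal.ofReal (truncKernel V C m z y) ∂μ =
      ENNReal.ofReal (∫ y, truncKernel V C m z y ∂μ) := fun z =>
    (ofReal_integral_eq_lintegral_ofReal (hint z)
      (ae_of_all _ fun y => hcf.truncKernel_nonneg m z y)).symm
  have hcont : Continuous fun z => ∫ y, truncKernel V C m z y ∂μ := by
    refine continuous_of_dominated (bound := fun _ => (m : ℝ)) (fun z => (hint z).1)
      (fun z => ae_of_all _ fun y => ?_) (integrable_const _) (ae_of_all _ fun y =>
        (hcf.continuous_truncKernel m).comp (Continuous.prodMk_left y))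
    rw [Real.norm_eq_abs, abs_of_nonneg (hcf.truncKernel_nonneg m z y)]
    exact min_le_right _ _
  -- a truncation of the potential is continuous and exceeds the energy near `x`
  have hopen : {z | kernelEnergy V C μ < ENNReal.ofReal (∫ y, truncKernel V C m z y ∂μ)} ∈ 𝓝 x := by
    refine (ENNReal.continuous_ofReal.comp hcont).continuousAt.eventually_const_lt ?_
    rw [Function.comp_apply, ← e]
    exact hm
  have hpos := (Measure.mem_support_iff_forall _).1 hx _ hopen
  refine hpos.ne' ?_
  -- the potential is almost everywhere equal to its mean, by the Euler-Lagrange inequality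
  have hae : (fun _ => kernelEnergy V C μ) =ᵐ[μ] kernelPot V C μ := by
    refine ae_eq_of_ae_le_of_lintegral_le ?_ (by simpa using hE)
      (hcf.measurable_kernelPot μ).aemeasurable (by rw [lintegral_const, measure_univ, mul_one]; rfl)
    filter_upwards [compl_mem_ae_iff.2 h.compl_null] with z hz
    exact h.energy_le_kernelPot (not_not.1 hz)
  refine measure_mono_null (fun z hz => ?_) (ae_iff.1 hae)
  refine ne_of_lt (lt_of_lt_of_le hz ?_)
  rw [← e, hsup]
  exact le_iSup (fun m : ℕ => ∫⁻ y, ENNReal.ofReal (truncKernel V C m z y) ∂μ) m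

end IsKernelMinimizer

/-! ### Regularity of the equilibrium measure -/

/-- The effect of the regularisation decreases with the distance to the singularity. -/
lemma neg_log_sub_regLog_le {ε z w : ℝ} (hε : 0 < ε) (hw : w ≠ 0) (hwz : |w| ≤ 2 * |z|) :
    -Real.log |z| - regLog ε z ≤ -Real.log |w| - regLog (2 * ε) w := by
  have hz : z ≠ 0 := by
    rintro rfl
    have := abs_pos.2 hw
    simp at hwz
    exact hw hwz
  have h1 : w ^ 2 ≤ 4 * z ^ 2 := by
    rw [← sq_abs w, ← sq_abs z]
    nlinarith [abs_nonneg w, abs_nonneg z]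
  have h2 : Real.log ((z ^ 2 + ε ^ 2) * w ^ 2) ≤ Real.log ((w ^ 2 + (2 * ε) ^ 2) * z ^ 2) := by
    refine Real.log_le_log (by positivity) ?_
    nlinarith [sq_nonneg ε]
  rw [Real.log_mul (by positivity) (by positivity), Real.log_mul (by positivity)
    (by positivity)] at h2
  rw [← neg_half_log_sq, ← neg_half_log_sq, regLog, regLog]
  linarith

namespace IsKernelMinimizer

variable {V : ℝ → ℝ} {δ C : ℝ} {S : Set ℝ} {μ : Measure ℝ}

/-- The potential for the kernel is bounded on the support and grows at infinity. -/
lemma exists_support_subset (h : IsKernelMinimizer V δ C S μ) :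
    ∃ A, μ.support ⊆ Set.Icc (-A) A := by
  have := h.isProbabilityMeasure
  have hδ := h.isConfining.pos
  refine ⟨Real.exp ((kernelEnergy V C μ).toReal / δ), fun x hx => abs_le.1 ?_⟩
  have h1 : ENNReal.ofReal (δ * Real.log (1 + |x|)) ≤ kernelEnergy V C μ := by
    refine le_trans ?_ (h.kernelPot_le_energy hx)
    calc _ = ∫⁻ _, ENNReal.ofReal (δ * Real.log (1 + |x|)) ∂μ := by simp
      _ ≤ _ := lintegral_mono fun y => h.isConfining.le_kernel x y
  rw [ENNReal.ofReal_le_iff_le_toReal h.energy_ne_top] at h1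
  have h2 : Real.log (1 + |x|) ≤ (kernelEnergy V C μ).toReal / δ := by
    rw [le_div_iff₀ hδ]; linarith
  have h3 := (Real.log_le_iff_le_exp (by positivity)).1 h2
  linarith

lemma exists_bounded (h : IsKernelMinimizer V δ C S μ) : ∃ A : ℝ, μ (Set.Icc (-A) A)ᶜ = 0 := by
  obtain ⟨A, hA⟩ := h.exists_support_subset
  exact ⟨A, measure_mono_null (Set.compl_subset_compl.2 hA) Measure.measure_compl_support⟩

lemma ae_mem_support (μ : Measure ℝ) : ∀ᵐ x ∂μ, x ∈ μ.support := by
  filter_upwards [compl_mem_ae_iff.2 (Measure.measure_compl_support (μ := μ))] with x hx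
  exact not_not.1 hx

lemma measure_singleton (h : IsKernelMinimizer V δ C S μ) (x : ℝ) : μ {x} = 0 := by
  by_cases hx : x ∈ μ.support
  · exact measure_singleton_of_kernelPot_ne_top
      (ne_top_of_le_ne_top h.energy_ne_top (h.kernelPot_le_energy hx))
  · exact measure_mono_null (Set.singleton_subset_iff.2 hx) Measure.measure_compl_support

lemma ae_ne (h : IsKernelMinimizer V δ C S μ) (x : ℝ) : ∀ᵐ ξ ∂μ, ξ ≠ x := by
  filter_upwards [compl_mem_ae_iff.2 (h.measure_singleton x)] with ξ hξ
  exact hξ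

lemma integrable_of_continuous (h : IsKernelMinimizer V δ C S μ) {f : ℝ → ℝ} (hf : Continuous f) :
    Integrable f μ := by
  have := h.isProbabilityMeasure
  obtain ⟨A, hA⟩ := h.exists_bounded
  exact integrable_of_bounded hA hf

lemma integrable_log (h : IsKernelMinimizer V δ C S μ) (x : ℝ) :
    Integrable (fun ξ => Real.log |x - ξ|) μ := by
  have := h.isProbabilityMeasure
  have hcf := h.isConfining
  by_cases hx : x ∈ μ.support
  · have hm : Measurable fun y => V x / 2 + V y / 2 - Real.log |x - y| + 2 * C := by
      have := hcf.continuous_potential.measurable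
      fun_prop
    have h1 : Integrable (fun y => V x / 2 + V y / 2 - Real.log |x - y| + 2 * C) μ := by
      refine (lintegral_ofReal_ne_top_iff_integrable hm.aestronglyMeasurable
        (ae_of_all _ fun y => hcf.real_kernel_nonneg x y)).1 ?_
      refine ne_top_of_le_ne_top h.energy_ne_top (le_trans ?_ (h.kernelPot_le_energy hx))
      refine lintegral_mono fun y => ?_
      unfold kernel
      split_ifs
      · exact le_top
      · exact le_rfl
    have h2 : Integrable (fun y => V x / 2 + V y / 2 + 2 * C) μ := by
      refine h.integrable_of_continuous ?_
      have := hcf.continuous_potential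
      fun_prop
    refine (h2.sub h1).congr (ae_of_all _ fun y => ?_)
    simp only [Pi.sub_apply]
    ring
  · obtain ⟨ρ, hρ, hball⟩ := Metric.isOpen_iff.1 μ.isClosed_support.isOpen_compl x hx
    have h1 : Integrable (fun ξ => Real.log (max ρ |x - ξ|)) μ :=
      h.integrable_of_continuous (Continuous.log (by fun_prop) fun ξ =>
        (hρ.trans_le (le_max_left _ _)).ne')
    refine h1.congr ?_
    filter_upwards [ae_mem_support μ] with ξ hξ
    rw [max_eq_right]
    by_contra hlt
    refine hball ?_ hξ
    rw [Metric.mem_ball, dist_comm, Real.dist_eq]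
    exact not_le.1 hlt

/-- The potential for the kernel is, up to a constant, the effective potential. -/
lemma kernelPot_eq (h : IsKernelMinimizer V δ C S μ) (x : ℝ) :
    0 ≤ V x / 2 + logPot μ x + (∫ y, V y ∂μ) / 2 + 2 * C ∧
      kernelPot V C μ x =
        ENNReal.ofReal (V x / 2 + logPot μ x + (∫ y, V y ∂μ) / 2 + 2 * C) := by
  have := h.isProbabilityMeasure
  have hcf := h.isConfining
  have hV := h.integrable_of_continuous hcf.continuous_potential
  have i1 : Integrable (fun y => V x / 2 + V y / 2) μ := (integrable_const _).add (hV.div_const 2)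
  have i2 : Integrable (fun y => V x / 2 + V y / 2 - Real.log |x - y|) μ :=
    i1.sub (h.integrable_log x)
  have e1 : ∫ y, (V x / 2 + V y / 2 - Real.log |x - y| + 2 * C) ∂μ =
      V x / 2 + logPot μ x + (∫ y, V y ∂μ) / 2 + 2 * C := by
    rw [integral_add i2 (integrable_const _), integral_sub i1 (h.integrable_log x),
      integral_add (integrable_const _) (hV.div_const 2), logPot]
    simp only [integral_div, integral_const, probReal_univ, one_smul]
    ring
  refine ⟨e1 ▸ integral_nonneg fun y => hcf.real_kernel_nonneg x y, ?_⟩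
  rw [← e1, ofReal_integral_eq_lintegral_ofReal
    (f := fun y => V x / 2 + V y / 2 - Real.log |x - y| + 2 * C) (i2.add (integrable_const _))
    (ae_of_all _ fun y => hcf.real_kernel_nonneg x y)]
  refine lintegral_congr_ae ?_
  filter_upwards [h.ae_ne x] with y hy
  rw [kernel, if_neg hy.symm]

lemma hasLogMoment (h : IsKernelMinimizer V δ C S μ) : HasLogMoment μ :=
  h.integrable_of_continuous continuous_log_one_add_abs

lemma integrable_neg_log_sub_regLog (h : IsKernelMinimizer V δ C S μ) {ε : ℝ} (hε : 0 < ε)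
    (x : ℝ) : Integrable (fun ξ => -Real.log |x - ξ| - regLog ε (x - ξ)) μ :=
  have := h.isProbabilityMeasure
  (h.integrable_log x).neg.sub (h.hasLogMoment.integrable_regLog hε x)

lemma logPot_sub_regPot (h : IsKernelMinimizer V δ C S μ) {ε : ℝ} (hε : 0 < ε) (x : ℝ) :
    logPot μ x - regPot ε μ x = ∫ ξ, (-Real.log |x - ξ| - regLog ε (x - ξ)) ∂μ := by
  have := h.isProbabilityMeasure
  rw [integral_sub (f := fun ξ => -Real.log |x - ξ|) (h.integrable_log x).neg
    (h.hasLogMoment.integrable_regLog hε x), integral_neg,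
    logPot, regPot]

lemma regPot_le_logPot (h : IsKernelMinimizer V δ C S μ) {ε : ℝ} (hε : 0 < ε) (x : ℝ) :
    regPot ε μ x ≤ logPot μ x := by
  have h1 := h.logPot_sub_regPot hε x
  have h2 : 0 ≤ ∫ ξ, (-Real.log |x - ξ| - regLog ε (x - ξ)) ∂μ := by
    refine integral_nonneg_of_ae ?_
    filter_upwards [h.ae_ne x] with ξ hξ
    have := regLog_le_neg_log (ε := ε) (sub_ne_zero.2 hξ.symm)
    simp only [Pi.zero_apply]
    linarith
  linarith

lemma regPot_le_regPot (h : IsKernelMinimizer V δ C S μ) {a b : ℝ} (ha : 0 < a) (hab : a ≤ b)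
    (x : ℝ) : regPot b μ x ≤ regPot a μ x :=
  have := h.isProbabilityMeasure
  integral_mono (h.hasLogMoment.integrable_regLog (ha.trans_le hab) x)
    (h.hasLogMoment.integrable_regLog ha x) fun ξ => regLog_le_regLog ha hab (x - ξ)

lemma tendsto_regPot (h : IsKernelMinimizer V δ C S μ) (x : ℝ) :
    Tendsto (fun m : ℕ => regPot (1 / (m + 1)) μ x) atTop (𝓝 (logPot μ x)) := by
  have := h.isProbabilityMeasure
  have e : logPot μ x = ∫ ξ, -Real.log |x - ξ| ∂μ := by rw [integral_neg, logPot]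
  rw [e]
  refine integral_tendsto_of_tendsto_of_monotone
    (fun m => h.hasLogMoment.integrable_regLog (by positivity) x) (h.integrable_log x).neg
    (ae_of_all _ fun ξ m k hmk => ?_) ?_
  · have h0 : (m : ℝ) ≤ k := by exact_mod_cast hmk
    exact regLog_le_regLog (by positivity)
      (one_div_le_one_div_of_le (by positivity) (by linarith)) _
  · filter_upwards [h.ae_ne x] with ξ hξ
    exact tendsto_regLog (sub_ne_zero.2 hξ.symm)

/-- The minimiser satisfies the Euler-Lagrange conditions, and the regularised potentials converge
uniformly: on the support by Dini's theorem, since the potential is there an affine function of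
`V`, and off the support by comparison with a nearest point of the support. -/
lemma isRegularEquilibrium (h : IsKernelMinimizer V δ C S μ) :
    IsRegularEquilibrium V S μ
      ((kernelEnergy V C μ).toReal - (∫ y, V y ∂μ) / 2 - 2 * C) := by
  have := h.isProbabilityMeasure
  have hE := h.energy_ne_top
  have heq : ∀ x ∈ μ.support, V x / 2 + logPot μ x =
      (kernelEnergy V C μ).toReal - (∫ y, V y ∂μ) / 2 - 2 * C := by
    intro x hx
    have hxS : x ∈ S :=
      Measure.support_subset_of_isClosed h.isClosed (mem_ae_iff.2 h.compl_null) hx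
    have h1 := le_antisymm (h.energy_le_kernelPot hxS) (h.kernelPot_le_energy hx)
    rw [(h.kernelPot_eq x).2] at h1
    rw [h1, ENNReal.toReal_ofReal (h.kernelPot_eq x).1]
    ring
  exact {
    continuous_potential := h.isConfining.continuous_potential
    growth := ⟨δ, h.isConfining.pos, C, h.isConfining.growth⟩
    isClosed := h.isClosed
    ordConnected := h.ordConnected
    nontrivial := h.nontrivial
    isProbabilityMeasure := h.isProbabilityMeasure
    compl_null := h.compl_null
    bounded := h.exists_bounded
    integrable_log := h.integrable_log
    le_effective := fun x hx => by
      have h1 := h.energy_le_kernelPot hx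
      rw [(h.kernelPot_eq x).2] at h1
      have h2 := ENNReal.toReal_mono ENNReal.ofReal_ne_top h1
      rw [ENNReal.toReal_ofReal (h.kernelPot_eq x).1] at h2
      linarith
    effective_eq := heq
    regPot_approx := fun η hη => by
      obtain ⟨A, hA⟩ := h.exists_support_subset
      have hcpt : IsCompact μ.support := isCompact_Icc.of_isClosed_subset μ.isClosed_support hA
      have hne : μ.support.Nonempty := Measure.nonempty_support (NeZero.ne μ)
      have hcont : ContinuousOn (logPot μ) μ.support := by
        have h1 : Continuous fun x => (kernelEnergy V C μ).toReal - (∫ y, V y ∂μ) / 2 - 2 * C -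
            V x / 2 := by
          have := h.isConfining.continuous_potential
          fun_prop
        exact h1.continuousOn.congr fun x hx => by linarith [heq x hx]
      have hdini := Monotone.tendstoUniformlyOn_of_forall_tendsto
        (F := fun (m : ℕ) x => regPot (1 / ((m : ℝ) + 1)) μ x) hcpt
        (fun m => (continuous_regPot h.hasLogMoment (by positivity)).continuousOn)
        (fun x _ m k hmk => by
          have h0 : (m : ℝ) ≤ k := by exact_mod_cast hmk
          exact h.regPot_le_regPot (by positivity)
            (one_div_le_one_div_of_le (by positivity) (by linarith)) x)
        hcont fun x _ => h.tendsto_regPot x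
      obtain ⟨m, hm⟩ := (Metric.tendstoUniformlyOn_iff.1 hdini η hη).exists
      have hε₀ : (0 : ℝ) < 1 / ((m : ℝ) + 1) := by positivity
      have hsupp : ∀ ε, 0 < ε → ε ≤ 1 / ((m : ℝ) + 1) → ∀ x ∈ μ.support,
          logPot μ x - regPot ε μ x ≤ η := by
        intro ε hε hε' x hx
        have h1 := hm x hx
        rw [Real.dist_eq] at h1
        have h2 := h.regPot_le_regPot hε hε' x
        linarith [(abs_lt.1 h1).2]
      refine ⟨1 / ((m : ℝ) + 1) / 2, half_pos hε₀, fun ε hε hε' x =>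
        ⟨h.regPot_le_logPot hε x, ?_⟩⟩
      obtain ⟨x', hx', hdist⟩ := hcpt.exists_infDist_eq_dist hne x
      have h1 := hsupp (2 * ε) (by positivity) (by linarith) x' hx'
      have h2 : logPot μ x - regPot ε μ x ≤ logPot μ x' - regPot (2 * ε) μ x' := by
        rw [h.logPot_sub_regPot hε, h.logPot_sub_regPot (by positivity)]
        refine integral_mono_ae (h.integrable_neg_log_sub_regLog hε x)
          (h.integrable_neg_log_sub_regLog (by positivity) x') ?_
        filter_upwards [h.ae_ne x', ae_mem_support μ] with ξ hξ hξs
        refine neg_log_sub_regLog_le hε (sub_ne_zero.2 hξ.symm) ?_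
        have h3 : dist x x' ≤ dist x ξ := hdist ▸ Metric.infDist_le_dist_of_mem hξs
        have h4 := dist_triangle x' x ξ
        rw [dist_comm x' x] at h4
        rw [Real.dist_eq, Real.dist_eq] at h3 h4
        rw [Real.dist_eq] at h4
        linarith
      linarith }

end IsKernelMinimizer

/-! ### The equilibrium measure of a confining potential -/

lemma IsConfining.energy_eq {V : ℝ → ℝ} {δ C : ℝ} (h : IsConfining V δ C) (ν : Measure ℝ)
    [IsProbabilityMeasure ν] :
    energy V ν = (kernelEnergy V C ν : EReal) - ((2 * C : ℝ) : EReal) := by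
  rw [← h.energy_add_eq, EReal.add_sub_cancel_right]

lemma IsConfining.isEquilibriumMeasure_iff {V : ℝ → ℝ} {δ C : ℝ} (h : IsConfining V δ C)
    {S : Set ℝ} {μ : Measure ℝ} :
    IsEquilibriumMeasure V S μ ↔ IsProbabilityMeasure μ ∧ μ Sᶜ = 0 ∧
      ∀ ν : Measure ℝ, IsProbabilityMeasure ν → ν Sᶜ = 0 →
        kernelEnergy V C μ ≤ kernelEnergy V C ν := by
  constructor
  · intro hμ
    have := hμ.isProbabilityMeasure
    refine ⟨hμ.isProbabilityMeasure, hμ.compl_null, fun ν hν hνS => ?_⟩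
    have h1 := add_le_add_left (hμ.energy_le ν hν hνS) ((2 * C : ℝ) : EReal)
    rwa [h.energy_add_eq, h.energy_add_eq, EReal.coe_ennreal_le_coe_ennreal_iff] at h1
  · rintro ⟨hμ, hμS, hmin⟩
    refine ⟨hμ, hμS, fun ν hν hνS => ?_⟩
    rw [h.energy_eq, h.energy_eq]
    exact EReal.sub_le_sub (EReal.coe_ennreal_le_coe_ennreal_iff.2 (hmin ν hν hνS)) le_rfl

lemma IsConfining.isKernelMinimizer {V : ℝ → ℝ} {δ C : ℝ} (h : IsConfining V δ C) {S : Set ℝ}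
    (hS : IsClosed S) (hSo : S.OrdConnected) (hSn : ∃ p q, p < q ∧ p ∈ S ∧ q ∈ S) :
    IsKernelMinimizer V δ C S (equilibriumMeasure V S) := by
  obtain ⟨p, q, hpq, hp, hq⟩ := hSn
  obtain ⟨μ, hμ⟩ := h.exists_isMinimizer hS ⟨segmentMeasure p (q - p), inferInstance,
    segmentMeasure_compl hS.measurableSet fun u hu => add_mul_mem_of_ordConnected hSo hp hq hu,
    h.kernelEnergy_segmentMeasure_ne_top p (sub_ne_zero.2 hpq.ne')⟩
  have h1 : IsEquilibriumMeasure V S (equilibriumMeasure V S) :=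
    Classical.epsilon_spec (p := IsEquilibriumMeasure V S) ⟨μ, h.isEquilibriumMeasure_iff.2 hμ⟩
  obtain ⟨h2, h3, h4⟩ := h.isEquilibriumMeasure_iff.1 h1
  exact ⟨h, hS, hSo, ⟨p, q, hpq, hp, hq⟩, h2, h3, h4⟩

section EffectivePotential

variable {V : ℝ → ℝ} {δ C : ℝ} {S : Set ℝ} {ℓ : ℝ}

lemma effPotential_of_mem (h : IsKernelMinimizer V δ C S (equilibriumMeasure V S)) {x : ℝ}
    (hx : x ∈ S) : effPotential V S x =
      ((excess V (equilibriumMeasure V S) ℓ x + ℓ : ℝ) : EReal) := by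
  rw [effPotential, if_pos ⟨hx, h.measure_singleton x, h.integrable_log x⟩]
  congr 1
  simp only [excess, logPot]
  ring

lemma iInf_effPotential (h : IsKernelMinimizer V δ C S (equilibriumMeasure V S))
    (hr : IsRegularEquilibrium V S (equilibriumMeasure V S) ℓ) :
    ⨅ ξ ∈ S, effPotential V S ξ = (ℓ : EReal) := by
  refine le_antisymm ?_ (le_iInf₂ fun x hx => ?_)
  · refine (iInf₂_le _ (hr.support_subset hr.sSup_support_mem)).trans ?_
    rw [effPotential_of_mem (ℓ := ℓ) h (hr.support_subset hr.sSup_support_mem),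
      hr.excess_sSup_support, zero_add]
  · rw [effPotential_of_mem (ℓ := ℓ) h hx]
    exact_mod_cast le_add_of_nonneg_left (hr.excess_nonneg hx)

lemma effPotentialTilde_of_mem (h : IsKernelMinimizer V δ C S (equilibriumMeasure V S))
    (hr : IsRegularEquilibrium V S (equilibriumMeasure V S) ℓ) {x : ℝ} (hx : x ∈ S) :
    effPotentialTilde V S x = ((excess V (equilibriumMeasure V S) ℓ x : ℝ) : EReal) := by
  rw [effPotentialTilde, iInf_effPotential h hr, effPotential_of_mem (ℓ := ℓ) h hx,
    EReal.coe_add, EReal.add_sub_cancel_right]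

lemma mul_effPotentialMax_of_lt {β : ℝ} (hβ : 0 < β) {x : ℝ} (hx : x < alphaPlus V S) :
    (β : EReal) * effPotentialMax V S x = ⊤ := by
  rw [effPotentialMax, if_pos hx, EReal.coe_mul_top_of_pos hβ]

lemma mul_effPotentialMin_of_lt {β : ℝ} (hβ : 0 < β) {x : ℝ} (hx : alphaMinus V S < x) :
    (β : EReal) * effPotentialMin V S x = ⊤ := by
  rw [effPotentialMin, if_pos hx, EReal.coe_mul_top_of_pos hβ]

lemma mul_effPotentialMax_of_le (h : IsKernelMinimizer V δ C S (equilibriumMeasure V S))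
    (hr : IsRegularEquilibrium V S (equilibriumMeasure V S) ℓ) (β : ℝ) {x : ℝ} (hxS : x ∈ S)
    (hx : alphaPlus V S ≤ x) : (β : EReal) * effPotentialMax V S x =
      ((β * excess V (equilibriumMeasure V S) ℓ x : ℝ) : EReal) := by
  rw [effPotentialMax, if_neg (not_lt.2 hx), effPotentialTilde_of_mem h hr hxS, EReal.coe_mul]

lemma mul_effPotentialMin_of_le (h : IsKernelMinimizer V δ C S (equilibriumMeasure V S))
    (hr : IsRegularEquilibrium V S (equilibriumMeasure V S) ℓ) (β : ℝ) {x : ℝ} (hxS : x ∈ S)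
    (hx : x ≤ alphaMinus V S) : (β : EReal) * effPotentialMin V S x =
      ((β * excess V (equilibriumMeasure V S) ℓ x : ℝ) : EReal) := by
  rw [effPotentialMin, if_neg (not_lt.2 hx), effPotentialTilde_of_mem h hr hxS, EReal.coe_mul]

end EffectivePotential

/-! ### Dependence on the potential outside the interval -/

section Congr

variable {V W : ℝ → ℝ} {S : Set ℝ}

lemma energy_congr (hVW : Set.EqOn V W S) {ν : Measure ℝ} (hν : ν Sᶜ = 0) :
    energy V ν = energy W ν := by
  have hae : V =ᵐ[ν] W := by
    filter_upwards [compl_mem_ae_iff.2 hν] with x hx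
    exact hVW (not_not.1 hx)
  rw [energy, energy, integral_congr_ae hae]
  by_cases hV : Integrable V ν
  · rw [if_pos hV, if_pos ((integrable_congr hae).1 hV)]
  · rw [if_neg hV, if_neg fun hW => hV ((integrable_congr hae).2 hW)]

lemma equilibriumMeasure_congr (hVW : Set.EqOn V W S) :
    equilibriumMeasure V S = equilibriumMeasure W S := by
  have key : ∀ {V W : ℝ → ℝ}, Set.EqOn V W S → ∀ μ, IsEquilibriumMeasure V S μ →
      IsEquilibriumMeasure W S μ := fun h μ hμ =>
    ⟨hμ.isProbabilityMeasure, hμ.compl_null, fun ν hν hνS => by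
      rw [← energy_congr h hμ.compl_null, ← energy_congr h hνS]
      exact hμ.energy_le ν hν hνS⟩
  unfold equilibriumMeasure
  congr 1
  ext μ
  exact ⟨key hVW μ, key hVW.symm μ⟩

lemma effPotential_congr (hVW : Set.EqOn V W S) : effPotential V S = effPotential W S := by
  ext x
  unfold effPotential
  rw [equilibriumMeasure_congr hVW]
  by_cases hx : x ∈ S
  · rw [hVW hx]
  · simp [hx]

lemma effPotentialTilde_congr (hVW : Set.EqOn V W S) :
    effPotentialTilde V S = effPotentialTilde W S := by
  ext x
  rw [effPotentialTilde, effPotentialTilde, effPotential_congr hVW]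

lemma alphaPlus_congr (hVW : Set.EqOn V W S) : alphaPlus V S = alphaPlus W S := by
  rw [alphaPlus, alphaPlus, equilibriumMeasure_congr hVW]

lemma alphaMinus_congr (hVW : Set.EqOn V W S) : alphaMinus V S = alphaMinus W S := by
  rw [alphaMinus, alphaMinus, equilibriumMeasure_congr hVW]

lemma effPotentialMax_congr (hVW : Set.EqOn V W S) : effPotentialMax V S = effPotentialMax W S := by
  ext x
  rw [effPotentialMax, effPotentialMax, alphaPlus_congr hVW, effPotentialTilde_congr hVW]

lemma effPotentialMin_congr (hVW : Set.EqOn V W S) : effPotentialMin V S = effPotentialMin W S := by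
  ext x
  rw [effPotentialMin, effPotentialMin, alphaMinus_congr hVW, effPotentialTilde_congr hVW]

lemma eigenvalueLaw_congr (hS : MeasurableSet S) (hVW : Set.EqOn V W S) (β : ℝ) :
    eigenvalueLaw β V S = eigenvalueLaw β W S := by
  ext1 n
  have hw : ∀ l : Fin n → ℝ, (∀ i, l i ∈ S) → weight β V n l = weight β W n l := by
    intro l hl
    simp only [weight, fun i => hVW (hl i)]
  have hae : (fun l => ENNReal.ofReal (weight β V n l))
      =ᵐ[volume.restrict {l : Fin n → ℝ | ∀ i, l i ∈ S}]
      fun l => ENNReal.ofReal (weight β W n l) := by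
    filter_upwards [ae_restrict_mem (measurableSet_forall_mem n hS)] with l hl
    rw [hw l hl]
  rw [eigenvalueLaw, eigenvalueLaw, partitionFunction, partitionFunction, lintegral_congr_ae hae,
    withDensity_congr_ae hae]

end Congr

/-! ### Confining potentials on an interval -/

lemma isClosed_interval (bm bp : EReal) : IsClosed (interval bm bp) :=
  (isClosed_Icc (a := bm) (b := bp)).preimage continuous_coe_real_ereal

lemma ordConnected_interval (bm bp : EReal) : (interval bm bp).OrdConnected :=
  ⟨fun _ hx _ hy _ hz =>
    ⟨hx.1.trans (EReal.coe_le_coe_iff.2 hz.1), (EReal.coe_le_coe_iff.2 hz.2).trans hy.2⟩⟩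

lemma nontrivial_interval {bm bp : EReal} (hb : bm < bp) :
    ∃ p q, p < q ∧ p ∈ interval bm bp ∧ q ∈ interval bm bp := by
  obtain ⟨p, hp1, hp2⟩ := EReal.lt_iff_exists_real_btwn.1 hb
  obtain ⟨q, hq1, hq2⟩ := EReal.lt_iff_exists_real_btwn.1 hp2
  exact ⟨p, q, EReal.coe_lt_coe_iff.1 hq1, ⟨hp1.le, hp2.le⟩, ⟨(hp1.trans hq1).le, hq2.le⟩⟩

/-- The quantitative form of the growth condition on the potential at an infinite end. -/
lemma exists_eventually_le_of_lt_liminf {V : ℝ → ℝ} {F : Filter ℝ}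
    (hF : ∀ᶠ x : ℝ in F, 1 < |x|)
    (h : 1 < liminf (fun x : ℝ => ((V x / (2 * Real.log |x|) : ℝ) : EReal)) F) :
    ∃ c > 1, ∀ᶠ x : ℝ in F, c * Real.log |x| ≤ V x / 2 := by
  obtain ⟨c, hc1, hc2⟩ := EReal.lt_iff_exists_real_btwn.1 h
  refine ⟨c, by exact_mod_cast hc1, ?_⟩
  filter_upwards [hF, eventually_lt_of_lt_liminf hc2] with x hx hcx
  have h1 : 0 < Real.log |x| := Real.log_pos hx
  have h2 : c < V x / (2 * Real.log |x|) := by exact_mod_cast hcx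
  rw [lt_div_iff₀ (by positivity)] at h2
  linarith

/-- The growth conditions at the infinite ends and the continuity of `V` give a growth condition on
the whole interval. -/
lemma exists_growth_interval {bm bp : EReal} {V : ℝ → ℝ}
    (hV : ContinuousOn V (interval bm bp))
    (hconf_bot : bm = ⊥ →
      1 < liminf (fun x : ℝ => ((V x / (2 * Real.log |x|) : ℝ) : EReal)) atBot)
    (hconf_top : bp = ⊤ →
      1 < liminf (fun x : ℝ => ((V x / (2 * Real.log |x|) : ℝ) : EReal)) atTop) :
    ∃ δ > 0, ∃ C, ∀ x ∈ interval bm bp, (1 + δ) * Real.log (1 + |x|) ≤ V x / 2 + C := by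
  have hbot : ∃ c > 1, ∀ᶠ x : ℝ in atBot, x ∈ interval bm bp → c * Real.log |x| ≤ V x / 2 := by
    by_cases h : bm = ⊥
    · obtain ⟨c, hc, hev⟩ := exists_eventually_le_of_lt_liminf
        (tendsto_abs_atBot_atTop.eventually_gt_atTop 1) (hconf_bot h)
      exact ⟨c, hc, hev.mono fun x hx _ => hx⟩
    · refine ⟨2, by norm_num, ?_⟩
      filter_upwards [eventually_lt_atBot bm.toReal] with x hx hxS
      exact absurd (EReal.toReal_le_toReal hxS.1 h (EReal.coe_ne_top x)) (not_le.2 hx)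
  have htop : ∃ c > 1, ∀ᶠ x : ℝ in atTop, x ∈ interval bm bp → c * Real.log |x| ≤ V x / 2 := by
    by_cases h : bp = ⊤
    · obtain ⟨c, hc, hev⟩ := exists_eventually_le_of_lt_liminf
        (tendsto_abs_atTop_atTop.eventually_gt_atTop 1) (hconf_top h)
      exact ⟨c, hc, hev.mono fun x hx _ => hx⟩
    · refine ⟨2, by norm_num, ?_⟩
      filter_upwards [eventually_gt_atTop bp.toReal] with x hx hxS
      exact absurd (EReal.toReal_le_toReal hxS.2 (EReal.coe_ne_bot x) h) (not_le.2 hx)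
  obtain ⟨c₁, hc₁, h₁⟩ := hbot
  obtain ⟨c₂, hc₂, h₂⟩ := htop
  obtain ⟨R₁, hR₁⟩ := eventually_atBot.1 h₁
  obtain ⟨R₂, hR₂⟩ := eventually_atTop.1 h₂
  set R := max 1 (max (-R₁) R₂)
  have hR1 : 1 ≤ R := le_max_left _ _
  have hRR₁ : -R₁ ≤ R := (le_max_left _ _).trans (le_max_right _ _)
  have hRR₂ : R₂ ≤ R := (le_max_right _ _).trans (le_max_right _ _)
  set c := min c₁ c₂
  have hc : 1 < c := lt_min hc₁ hc₂
  obtain ⟨M, hM⟩ := (isCompact_Icc.inter_left (isClosed_interval bm bp)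
    (t := Set.Icc (-R) R)).bddBelow_image (hV.mono Set.inter_subset_left)
  refine ⟨c - 1, by linarith, c * Real.log (1 + R) + |M| / 2 + c * Real.log 2, fun x hx => ?_⟩
  have hlog2 : 0 < Real.log 2 := Real.log_pos (by norm_num)
  have hlogR : 0 ≤ Real.log (1 + R) := Real.log_nonneg (by linarith)
  rw [add_sub_cancel]
  rcases le_or_gt |x| R with hxR | hxR
  · have h3 := hM ⟨x, ⟨hx, abs_le.1 hxR⟩, rfl⟩
    have h4 : Real.log (1 + |x|) ≤ Real.log (1 + R) := Real.log_le_log (by positivity) (by linarith)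
    have h5 : c * Real.log (1 + |x|) ≤ c * Real.log (1 + R) := by gcongr
    have h6 : 0 < c * Real.log 2 := by positivity
    linarith [neg_abs_le M]
  · have hx1 : 1 < |x| := by linarith
    have h3 : c * Real.log |x| ≤ V x / 2 := by
      have h0 := (Real.log_pos hx1).le
      rcases lt_abs.1 hxR with h | h
      · exact (mul_le_mul_of_nonneg_right (min_le_right _ _) h0).trans (hR₂ x (by linarith) hx)
      · exact (mul_le_mul_of_nonneg_right (min_le_left _ _) h0).trans (hR₁ x (by linarith) hx)
    have h4 : Real.log (1 + |x|) ≤ Real.log 2 + Real.log |x| := by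
      rw [← Real.log_mul (by norm_num) (by positivity)]
      exact Real.log_le_log (by positivity) (by linarith)
    have h5 : c * Real.log (1 + |x|) ≤ c * (Real.log 2 + Real.log |x|) := by gcongr
    have h6 : 0 ≤ c * Real.log (1 + R) := by positivity
    have h7 : c * (Real.log 2 + Real.log |x|) = c * Real.log 2 + c * Real.log |x| := mul_add _ _ _
    linarith [abs_nonneg M]

/-- A potential that is confining on the closed set `S` extends to one that is confining on the
line. -/
lemma exists_isConfining_extension {S : Set ℝ} (hS : IsClosed S) {V : ℝ → ℝ}
    (hV : ContinuousOn V S) {δ C : ℝ} (hδ : 0 < δ)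
    (hg : ∀ x ∈ S, (1 + δ) * Real.log (1 + |x|) ≤ V x / 2 + C) :
    ∃ W : ℝ → ℝ, Set.EqOn V W S ∧ IsConfining W δ C := by
  obtain ⟨g, hg'⟩ := ContinuousMap.exists_restrict_eq hS ⟨S.domRestrict V, hV.domRestrict⟩
  have hgV : ∀ x ∈ S, g x = V x := fun x hx => by
    have := congrArg (fun f : C(S, ℝ) => f ⟨x, hx⟩) hg'
    exact this
  refine ⟨fun x => max (g x) (2 * ((1 + δ) * Real.log (1 + |x|) - C)), fun x hx => ?_, ?_, hδ,
    fun x => ?_⟩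
  · simp only [hgV x hx]
    rw [max_eq_left]
    linarith [hg x hx]
  · have := continuous_log_one_add_abs
    have := g.continuous
    fun_prop
  · have := le_max_right (g x) (2 * ((1 + δ) * Real.log (1 + |x|) - C))
    linarith

end BetaEnsemble

end

theorem mainTheorem5 (β : ℝ) (hβ : 0 < β) (bm bp : EReal) (hb : bm < bp) (V : ℝ → ℝ)
    (hV : ContinuousOn V (BetaEnsemble.interval bm bp))
    (hconf_bot : bm = ⊥ →
      1 < liminf (fun x : ℝ => ((V x / (2 * Real.log |x|) : ℝ) : EReal)) atBot)
    (hconf_top : bp = ⊤ →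
      1 < liminf (fun x : ℝ => ((V x / (2 * Real.log |x|) : ℝ) : EReal)) atTop)
    (hJ : ∀ x : ℝ,
      x ∉ Set.Icc (BetaEnsemble.alphaMinus V (BetaEnsemble.interval bm bp))
        (BetaEnsemble.alphaPlus V (BetaEnsemble.interval bm bp)) →
      BetaEnsemble.effPotentialTilde V (BetaEnsemble.interval bm bp) x ≠ 0) :
    -- good rate functions, vanishing at the edges
    (BetaEnsemble.IsGoodRateFunctionOn
        (fun x => (β : EReal) * BetaEnsemble.effPotentialMax V (BetaEnsemble.interval bm bp) x)
        (BetaEnsemble.interval bm bp) ∧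
      (β : EReal) * BetaEnsemble.effPotentialMax V (BetaEnsemble.interval bm bp)
        (BetaEnsemble.alphaPlus V (BetaEnsemble.interval bm bp)) = 0) ∧
    (BetaEnsemble.IsGoodRateFunctionOn
        (fun x => (β : EReal) * BetaEnsemble.effPotentialMin V (BetaEnsemble.interval bm bp) x)
        (BetaEnsemble.interval bm bp) ∧
      (β : EReal) * BetaEnsemble.effPotentialMin V (BetaEnsemble.interval bm bp)
        (BetaEnsemble.alphaMinus V (BetaEnsemble.interval bm bp)) = 0) ∧
    -- large deviation principles
    BetaEnsemble.SatisfiesLDPOn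
      (BetaEnsemble.lawMax β V (BetaEnsemble.interval bm bp))
      (fun x => (β : EReal) * BetaEnsemble.effPotentialMax V (BetaEnsemble.interval bm bp) x)
      (BetaEnsemble.interval bm bp) ∧
    BetaEnsemble.SatisfiesLDPOn
      (BetaEnsemble.lawMin β V (BetaEnsemble.interval bm bp))
      (fun x => (β : EReal) * BetaEnsemble.effPotentialMin V (BetaEnsemble.interval bm bp) x)
      (BetaEnsemble.interval bm bp) ∧
    -- exponentially small probabilities of deviations away from the support
    (∀ ε : ℝ, 0 < ε →
      limsup (fun N : ℕ => BetaEnsemble.scaledLog N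
        (BetaEnsemble.eigenvalueLaw β V (BetaEnsemble.interval bm bp) N
          {l | BetaEnsemble.lambdaMin l ≤
            BetaEnsemble.alphaMinus V (BetaEnsemble.interval bm bp) - ε})) atTop < 0 ∧
      limsup (fun N : ℕ => BetaEnsemble.scaledLog N
        (BetaEnsemble.eigenvalueLaw β V (BetaEnsemble.interval bm bp) N
          {l | BetaEnsemble.alphaPlus V (BetaEnsemble.interval bm bp) + ε ≤
            BetaEnsemble.lambdaMax l})) atTop < 0) := by
  classical
  set S := BetaEnsemble.interval bm bp
  have hS : IsClosed S := BetaEnsemble.isClosed_interval bm bp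
  obtain ⟨δ, hδ, C, hg⟩ := BetaEnsemble.exists_growth_interval hV hconf_bot hconf_top
  obtain ⟨W, hVW, hW⟩ := BetaEnsemble.exists_isConfining_extension hS hV hδ hg
  -- all objects depend on the potential through its values on `S` only
  have eLaw := BetaEnsemble.eigenvalueLaw_congr hS.measurableSet hVW β
  have eMax : BetaEnsemble.lawMax β V S = BetaEnsemble.lawMax β W S := by
    ext1 n; rw [BetaEnsemble.lawMax, BetaEnsemble.lawMax, eLaw]
  have eMin : BetaEnsemble.lawMin β V S = BetaEnsemble.lawMin β W S := by
    ext1 n; rw [BetaEnsemble.lawMin, BetaEnsemble.lawMin, eLaw]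
  rw [BetaEnsemble.alphaMinus_congr hVW, BetaEnsemble.alphaPlus_congr hVW,
    BetaEnsemble.effPotentialTilde_congr hVW] at hJ
  rw [eMax, eMin, eLaw, BetaEnsemble.alphaMinus_congr hVW, BetaEnsemble.alphaPlus_congr hVW,
    BetaEnsemble.effPotentialMax_congr hVW, BetaEnsemble.effPotentialMin_congr hVW]
  have hk := hW.isKernelMinimizer hS (BetaEnsemble.ordConnected_interval bm bp)
    (BetaEnsemble.nontrivial_interval hb)
  have hr := hk.isRegularEquilibrium
  have hposMax : ∀ x ∈ S, BetaEnsemble.alphaPlus W S < x → BetaEnsemble.excess W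
      (BetaEnsemble.equilibriumMeasure W S) _ x ≠ 0 := fun x hx hxa h0 =>
    hJ x (fun h => absurd h.2 (not_le.2 hxa)) (by
      rw [BetaEnsemble.effPotentialTilde_of_mem hk hr hx, h0, EReal.coe_zero])
  have hposMin : ∀ x ∈ S, x < BetaEnsemble.alphaMinus W S → BetaEnsemble.excess W
      (BetaEnsemble.equilibriumMeasure W S) _ x ≠ 0 := fun x hx hxa h0 =>
    hJ x (fun h => absurd h.1 (not_le.2 hxa)) (by
      rw [BetaEnsemble.effPotentialTilde_of_mem hk hr hx, h0, EReal.coe_zero])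
  have hplus : BetaEnsemble.alphaPlus W S ∈ S := hr.support_subset hr.sSup_support_mem
  have hminus : BetaEnsemble.alphaMinus W S ∈ (BetaEnsemble.equilibriumMeasure W S).support :=
    hr.isCompact_support.sInf_mem hr.support_nonempty
  refine ⟨⟨?_, ?_⟩, ⟨?_, ?_⟩, ?_, ?_, fun ε hε => ⟨?_, ?_⟩⟩
  · exact hr.isGoodRateFunctionOn_max hβ
      (fun x _ hx => BetaEnsemble.mul_effPotentialMax_of_lt hβ hx)
      fun x hxS hx => BetaEnsemble.mul_effPotentialMax_of_le hk hr β hxS hx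
  · rw [BetaEnsemble.mul_effPotentialMax_of_le hk hr β hplus le_rfl,
      BetaEnsemble.alphaPlus, hr.excess_sSup_support, mul_zero, EReal.coe_zero]
  · exact hr.isGoodRateFunctionOn_min hβ
      (fun x _ hx => BetaEnsemble.mul_effPotentialMin_of_lt hβ hx)
      fun x hxS hx => BetaEnsemble.mul_effPotentialMin_of_le hk hr β hxS hx
  · rw [BetaEnsemble.mul_effPotentialMin_of_le hk hr β (hr.support_subset hminus) le_rfl,
      hr.excess_eq_zero hminus, mul_zero, EReal.coe_zero]
  · exact hr.satisfiesLDPOn_max hβ rfl hposMax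
      (fun x _ hx => BetaEnsemble.mul_effPotentialMax_of_lt hβ hx)
      fun x hxS hx => BetaEnsemble.mul_effPotentialMax_of_le hk hr β hxS hx
  · exact hr.satisfiesLDPOn_min hβ rfl hposMin
      (fun x _ hx => BetaEnsemble.mul_effPotentialMin_of_lt hβ hx)
      fun x hxS hx => BetaEnsemble.mul_effPotentialMin_of_le hk hr β hxS hx
  · exact hr.limsup_scaledLog_min_lt_zero hβ hε hposMin
  · exact hr.limsup_scaledLog_max_lt_zero hβ hε hposMax
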